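/- Theorem 1.5. Let $\sigma$ be the normalized surface measure on the unit circle $\mathbb S^1\subset\mathbb R^2$, and for $E\subset[1,2]$ let $$A_tf(x)=\int_{\mathbb S^1}f(x-ty)\,d\sigma(y),\qquad M_Ef(x)=\sup_{t\in E}|A_tf(x)|\qquad(x\in\mathbb R^2).$$ For a bounded set $F\subset\mathbb R$ and $\delta>0$ let $N(F,\delta)$ be the minimal number of intervals of length $\delta$ needed to cover $F$, and for $0<\delta<1$ put $$\chi^E_{\mathrm M,\beta}(\delta)=\delta^{\beta}N(E,\delta),\qquad \chi^E_{\mathrm A,\gamma}(\delta)=\sup_{|I|\ge\delta}\Big(\frac{\delta}{|I|}\Big)^{\gamma}N(E\cap I,\delta),$$ where $I$ runs over bounded intervals. Let the radial type set $\mathcal T_E^{rad}$ be the set of all $(\frac1p,\frac1q)\in[0,1]^2$ such that $M_E$ is bounded from $L^p_{rad}(\mathbb R^2)$ to $L^q(\mathbb R^2)$, that is, there is a constant $C$ such that for every radial function $f(x)=f_0(|x|)$ in $L^p(\mathbb R^2)$ the averages $A_tf(x)$, $t\in E$, all exist for almost every $x$, $M_Ef$ is (almost everywhere equal to a) measurable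 function, and $\|M_Ef\|_{L^q}\le C\|f\|_{L^p}$. Say that $M_E$ is of radial restricted weak type $(p,q)$ if, in the same sense, it is bounded from the radial functions in the Lorentz space $L^{p,1}(\mathbb R^2)$ to $L^{q,\infty}(\mathbb R^2)$. Put $$O=(0,0),\quad Q_1(\beta)=\Big(\frac1{1+\beta},\frac1{1+\beta}\Big),\quad Q_2(\beta)=\Big(\frac{2}{3+\beta},\frac1{3+\beta}\Big),$$ and let $\Delta(\beta)$ be the closed triangle with vertices $O,Q_1(\beta),Q_2(\beta)$. For $0\le\beta<1$ and $\beta+1\le2\gamma\le2$ put $$\theta=\frac{1-\beta}{2(\gamma-\beta)},\qquad Q_3(\beta,\gamma)=\Big(\frac{2-\beta(1-\theta)}{2(1+\gamma\theta)},\frac1{2(1+\gamma\theta)}\Big),$$ and let $\mathcal Q(\beta,\gamma)$ be the closed (possibly degenerate) quadrilateral with vertices $O,Q_1(\beta),Q_3(\beta,\gamma),Q_2(2\gamma-1)$. Let $E\subset[1,2]$, $0\le\beta<1$ and $\beta\le\gamma\le1$, and suppose that $$\sup_{0<\delta<1}\chi^E_{\mathrm M,\beta}(\delta)<\infty\quad\text{and}\quad\sup_{0<\delta<1}\chi^E_{\mathrm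 A,\gamma}(\delta)<\infty .$$ (i) If $2\gamma<\beta+1$, then $\Delta(\beta)\subset\mathcal T_E^{rad}$. (ii) If $2\gamma\ge\beta+1$, then $\mathcal Q(\beta,\gamma)\setminus\{Q_2(2\gamma-1)\}\subset\mathcal T_E^{rad}$. Moreover, $M_E$ is of radial restricted weak type $(p,q)$ when $(\frac1p,\frac1q)=Q_2(2\gamma-1)$. -/

import Mathlib

open MeasureTheory Set
open scoped ENNReal NNReal

noncomputable section

namespace RadialMaximal

/-! ### Covering numbers and the two characteristics -/

/-- The minimal number of intervals of length `δ` needed to cover `F` (`⊤` if no finite family does).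
Passing to closures shows that it is enough to use closed intervals. -/
def coveringNumber (F : Set ℝ) (δ : ℝ) : ℕ∞ :=
  ⨅ (s : Finset ℝ) (_ : F ⊆ ⋃ a ∈ s, Icc a (a + δ)), (s.card : ℕ∞)

/-- The `β`-Minkowski characteristic `δ ^ β * N(E, δ)`. -/
def minkowskiChar (E : Set ℝ) (β δ : ℝ) : ℝ≥0∞ :=
  ENNReal.ofReal (δ ^ β) * (coveringNumber E δ : ℝ≥0∞)

/-- The `γ`-Assouad characteristic: the supremum of `(δ / |I|) ^ γ * N(E ∩ I, δ)` over all
intervals `I = [a, b]` with `|I| = b - a ≥ δ`. -/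
def assouadChar (E : Set ℝ) (γ δ : ℝ) : ℝ≥0∞ :=
  ⨆ (a : ℝ) (b : ℝ) (_ : δ ≤ b - a),
    ENNReal.ofReal ((δ / (b - a)) ^ γ) * (coveringNumber (E ∩ Icc a b) δ : ℝ≥0∞)

/-! ### Spherical means and the maximal operator -/

/-- The normalized surface measure on the unit sphere of `ℝᵈ`. -/
def sphereMeasure (d : ℕ) : Measure (Metric.sphere (0 : EuclideanSpace ℝ (Fin d)) 1) :=
  ((volume : Measure (EuclideanSpace ℝ (Fin d))).toSphere univ)⁻¹ •
    (volume : Measure (EuclideanSpace ℝ (Fin d))).toSphere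

/-- The spherical mean `A_t f (x) = ∫ f (x - t y) dσ(y)`. -/
def sphericalMean {d : ℕ} (t : ℝ) (f : EuclideanSpace ℝ (Fin d) → ℂ)
    (x : EuclideanSpace ℝ (Fin d)) : ℂ :=
  ∫ y : Metric.sphere (0 : EuclideanSpace ℝ (Fin d)) 1,
    f (x - t • (y : EuclideanSpace ℝ (Fin d))) ∂(sphereMeasure d)

/-- The maximal function `M_E f (x) = sup_{t ∈ E} |A_t f (x)|`, with values in `[0, ∞]`. -/
def maximalFunction {d : ℕ} (E : Set ℝ) (f : EuclideanSpace ℝ (Fin d) → ℂ)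
    (x : EuclideanSpace ℝ (Fin d)) : ℝ≥0∞ :=
  ⨆ t ∈ E, ‖sphericalMean t f x‖ₑ

/-- `M_E f` is well defined almost everywhere: for almost every `x` all the averages `A_t f (x)`,
`t ∈ E`, exist as absolutely convergent integrals, and `M_E f` is a measurable function (up to a
null set). -/
def MaximalWellDefined {d : ℕ} (E : Set ℝ) (f : EuclideanSpace ℝ (Fin d) → ℂ) : Prop :=
  (∀ᵐ x : EuclideanSpace ℝ (Fin d), ∀ t ∈ E,
    Integrable (fun y : Metric.sphere (0 : EuclideanSpace ℝ (Fin d)) 1 =>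
      f (x - t • (y : EuclideanSpace ℝ (Fin d)))) (sphereMeasure d)) ∧
  AEMeasurable (maximalFunction E f) volume

/-- `f` is radial: `f x = f₀ |x|`. -/
def IsRadial {d : ℕ} (f : EuclideanSpace ℝ (Fin d) → ℂ) : Prop :=
  ∃ f₀ : ℝ → ℂ, ∀ x, f x = f₀ ‖x‖

/-! ### Lorentz norms -/

/-- The `L^{p,1}` (quasi-)norm, through the distribution function:
`p ∫₀^∞ |{|f| > s}|^{1/p} ds`, which equals `∫₀^∞ τ^{1/p} f^*(τ) dτ/τ`. -/
def lorentzOneNorm {d : ℕ} (p : ℝ) (f : EuclideanSpace ℝ (Fin d) → ℂ) : ℝ≥0∞ :=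
  ENNReal.ofReal p *
    ∫⁻ s in Ioi (0 : ℝ), (volume {x | ENNReal.ofReal s < ‖f x‖ₑ}) ^ (1 / p)

/-- The `L^{q,∞}` (weak `L^q`) quasi-norm of a `[0, ∞]`-valued function:
`sup_{s > 0} s |{g > s}|^{1/q}`. -/
def weakNorm {d : ℕ} (q : ℝ) (g : EuclideanSpace ℝ (Fin d) → ℝ≥0∞) : ℝ≥0∞ :=
  ⨆ (s : ℝ) (_ : 0 < s),
    ENNReal.ofReal s * (volume {x | ENNReal.ofReal s < g x}) ^ (1 / q)

/-! ### Radial strong type and radial restricted weak type -/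

/-- `M_E` is bounded from `L^p_rad(ℝᵈ)` to `L^q(ℝᵈ)`, `p, q ∈ [1, ∞]`. -/
def RadialStrongType (d : ℕ) (E : Set ℝ) (p q : ℝ≥0∞) : Prop :=
  ∃ C : ℝ≥0, ∀ f : EuclideanSpace ℝ (Fin d) → ℂ, IsRadial f → MemLp f p volume →
    MaximalWellDefined E f ∧
    eLpNorm (maximalFunction E f) q volume ≤ C * eLpNorm f p volume

/-- `M_E` is bounded from `L^{p,1}_rad(ℝᵈ)` to `L^{q,∞}(ℝᵈ)`, `p, q ∈ [1, ∞)`. -/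
def RadialRestrictedWeakType (d : ℕ) (E : Set ℝ) (p q : ℝ) : Prop :=
  ∃ C : ℝ≥0, ∀ f : EuclideanSpace ℝ (Fin d) → ℂ, IsRadial f →
    AEStronglyMeasurable f volume → lorentzOneNorm p f < ∞ →
    MaximalWellDefined E f ∧
    weakNorm q (maximalFunction E f) ≤ C * lorentzOneNorm p f

/-- The radial type set: the points `(1/p, 1/q) ∈ [0,1]²` such that `M_E` is bounded from
`L^p_rad` to `L^q`; the coordinate `0` stands for the exponent `∞`. -/
def radialTypeSet (d : ℕ) (E : Set ℝ) : Set (ℝ × ℝ) :=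
  {z | z.1 ∈ Icc (0 : ℝ) 1 ∧ z.2 ∈ Icc (0 : ℝ) 1 ∧
    RadialStrongType d E (ENNReal.ofReal z.1)⁻¹ (ENNReal.ofReal z.2)⁻¹}

/-! ### The regions -/

/-- The vertex `Q₁(β)`. -/
def Q₁ (d : ℕ) (β : ℝ) : ℝ × ℝ :=
  (((d : ℝ) - 1) / ((d : ℝ) - 1 + β), ((d : ℝ) - 1) / ((d : ℝ) - 1 + β))

/-- The vertex `Q₂(β)`. -/
def Q₂ (d : ℕ) (β : ℝ) : ℝ × ℝ :=
  ((d : ℝ) * ((d : ℝ) - 1) / ((d : ℝ) ^ 2 - 1 + β), ((d : ℝ) - 1) / ((d : ℝ) ^ 2 - 1 + β))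

/-- `θ(β, γ) = (1 - β) / (2 (γ - β))`, for `β < 1` and `β + 1 ≤ 2 γ` (so that `β < γ`). -/
def theta (β γ : ℝ) : ℝ := (1 - β) / (2 * (γ - β))

/-- The vertex `Q₃(β, γ)`, in dimension two, for `β < 1` and `β + 1 ≤ 2 γ`. -/
def Q₃ (β γ : ℝ) : ℝ × ℝ :=
  ((2 - β * (1 - theta β γ)) / (2 * (1 + γ * theta β γ)), 1 / (2 * (1 + γ * theta β γ)))

/-- The closed triangle `Δ(β)` with vertices `O`, `Q₁(β)`, `Q₂(β)`. -/
def triangle (d : ℕ) (β : ℝ) : Set (ℝ × ℝ) :=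
  convexHull ℝ {(0, 0), Q₁ d β, Q₂ d β}

/-- The closed (convex) quadrilateral `𝒬(β, γ)` with vertices
`O`, `Q₁(β)`, `Q₃(β, γ)`, `Q₂(2γ - 1)`, in dimension two. -/
def quadrilateral (β γ : ℝ) : Set (ℝ × ℝ) :=
  convexHull ℝ {(0, 0), Q₁ 2 β, Q₃ β γ, Q₂ 2 (2 * γ - 1)}

end RadialMaximal

end

/-! On radial functions the problem is one-dimensional. For `|x| = r` the law of cosines bounds a
circular mean by a constant times the integral of the profile against `circleKernel r t` over `(|r -
t|, r + t)` (`lintegral_sphereMeasure_le`). This kernel has inverse square root singularities at the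
two endpoints, so the maximal function is dominated by fractional integrals of order 1/2 at the
points `± r ± t`, `t ∈ E`. Cut the singularity dyadically. At distance `2^(-k)` it gives `2^(k/2)`
times an integral over an interval of length about `2^(-k)`, so `t` may be rounded to the grid of
mesh `2^(-k)`, and the supremum runs over at most `C 2^(βk)` points. Replacing it by an `ℓ^q` sum
and using Young's inequality gives an `L^p → L^q` bound for each piece (`lnorm_vmax_le`). What
remains is to sum the pieces. Write `x = 1/p`, `y = 1/q`, with `p ≤ q`.

Outputs `r ≥ 1/2`, inputs `s ≥ 1` (`farMax`): the scales sum as soon as `x - (1-β)y < 1/2`.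

Outputs `r ≥ 1/2`, inputs `s ~ 2^(-m)` (`nearMax`): only radii within `2^(-m)` of `E` matter. On the
critical line `2x - (1-β)y = 1`, which passes through `Q₁(β)` and `Q₂(β)`, nothing decays in `m`.
The neighbourhoods of `E` are cut into annuli; for a fixed relative index the annuli are disjoint as
`m` varies, and `p ≤ q` sums the dyadic pieces of the input (`lnorm_nearMax_le`).

Outputs `r ~ 2^(-m)` below 1/2 (`smallMax`): the inputs lie in `[1/2, 5/2]`, and a given input only
sees dilations in an interval of length about `2^(-m)`. At scale `2^(-m-n)` the count is thus at
most a constant times the smaller of `2^(β(m+n))` and `2^(γn)`, which leads to the exponent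
`smallExp`. Its two regimes meet on the ray `n = β/(γ-β) m`, and the edge from `Q₃` to `Q₂(2γ-1)` is
where the exponent vanishes along that ray. Where the exponent decays in both indices the pieces are
summed directly. Where it decays only away from a ray, `p` is perturbed in both directions at fixed
`q`, and `tsum_rpow_le_of_geometric_bounds` interpolates. At `Q₂(2γ-1)` the exponent given by the
Assouad count vanishes identically; perturbing both `p` and `q` in the manner of Bourgain bounds
indicator functions tested against sets (`setLIntegral_smallMax_indicator_le`), and the layer cake
formula passes to `L^{p,1}`.

The regions are described by linear inequalities, collected in `Admissible` and verified at the
vertices. Since `E` may be uncountable, measurability of the maximal function is not automatic: it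
follows by approximating the profile by continuous ones, the error being controlled by the strong
type bound at `Q₁(β)`, that is `p = q = 1 + β`. -/

namespace RadialMaximal

/-! ### Powers of two in `[0, ∞]` -/

/-- The power `2 ^ a`, as an extended nonnegative real. -/
noncomputable def pw (a : ℝ) : ℝ≥0∞ := (2 : ℝ≥0∞) ^ a

lemma pw_add (a b : ℝ) : pw (a + b) = pw a * pw b :=
  ENNReal.rpow_add _ _ (by norm_num) (by norm_num)

lemma pw_rpow (a b : ℝ) : pw a ^ b = pw (a * b) := (ENNReal.rpow_mul _ _ _).symm

lemma pw_zero : pw 0 = 1 := ENNReal.rpow_zero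

lemma pw_ne_top (a : ℝ) : pw a ≠ ∞ := by
  simp [pw, ENNReal.rpow_eq_top_iff]

lemma pw_ne_zero (a : ℝ) : pw a ≠ 0 := by
  simp [pw, ENNReal.rpow_eq_zero_iff]

lemma pw_mono {a b : ℝ} (h : a ≤ b) : pw a ≤ pw b :=
  ENNReal.rpow_le_rpow_of_exponent_le (by norm_num) h

lemma pw_neg_mul (a : ℝ) : pw (-a) * pw a = 1 := by
  rw [← pw_add]; simp [pw_zero]

lemma ofReal_two_rpow (a : ℝ) : ENNReal.ofReal (2 ^ a) = pw a := by
  rw [← ENNReal.ofReal_rpow_of_pos (by norm_num)]; simp [pw]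

lemma pw_nat (n : ℕ) : pw n = 2 ^ n := by simp [pw]

lemma tsum_pw_lt_top {ε : ℝ} (hε : 0 < ε) : ∑' n : ℕ, pw (-(ε * n)) < ∞ := by
  have h : ∀ n : ℕ, pw (-(ε * n)) = (pw (-ε)) ^ n := by
    intro n
    rw [← ENNReal.rpow_natCast, pw_rpow]; ring_nf
  simp_rw [h]
  rw [ENNReal.tsum_geometric]
  have : pw (-ε) < 1 := ENNReal.rpow_lt_one_of_one_lt_of_neg (by norm_num) (by linarith)
  simp only [ENNReal.inv_lt_top, tsub_pos_iff_lt]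
  exact this

/-- Combines two bounds that decay in different indices into one bound that decays in both. -/
lemma min_le_rpow_mul_rpow (a b : ℝ≥0∞) {τ : ℝ} (h0 : 0 ≤ τ) (h1 : τ ≤ 1) :
    min a b ≤ a ^ (1 - τ) * b ^ τ := by
  calc min a b = (min a b) ^ (1 - τ) * (min a b) ^ τ := by
        rw [← ENNReal.rpow_add_of_nonneg _ _ (by linarith) h0]; simp
    _ ≤ _ := by
        exact mul_le_mul' (ENNReal.rpow_le_rpow (min_le_left _ _) (by linarith))
          (ENNReal.rpow_le_rpow (min_le_right _ _) h0)

/-! ### `L^p` norms of `[0, ∞]`-valued functions -/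

variable {α : Type*} [MeasurableSpace α]

/-- The `L^p` norm of a `[0, ∞]`-valued function, for finite `p > 0`. -/
noncomputable def lnorm (p : ℝ) (μ : Measure α) (f : α → ℝ≥0∞) : ℝ≥0∞ :=
  (∫⁻ a, f a ^ p ∂μ) ^ (1 / p)

variable {μ : Measure α} {p q : ℝ} {f g : α → ℝ≥0∞}

lemma lnorm_rpow (hp : 0 < p) : lnorm p μ f ^ p = ∫⁻ a, f a ^ p ∂μ := by
  rw [lnorm, ← ENNReal.rpow_mul, one_div_mul_cancel hp.ne', ENNReal.rpow_one]

lemma lnorm_mono_ae (hp : 0 < p) (h : ∀ᵐ a ∂μ, f a ≤ g a) : lnorm p μ f ≤ lnorm p μ g := by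
  unfold lnorm
  refine ENNReal.rpow_le_rpow (lintegral_mono_ae ?_) (by positivity)
  filter_upwards [h] with a ha
  exact ENNReal.rpow_le_rpow ha hp.le

lemma lnorm_mono (hp : 0 < p) (h : ∀ a, f a ≤ g a) : lnorm p μ f ≤ lnorm p μ g :=
  lnorm_mono_ae hp (.of_forall h)

lemma lnorm_mono_measure {ν : Measure α} (hp : 0 < p) (h : μ ≤ ν) : lnorm p μ f ≤ lnorm p ν f :=
  ENNReal.rpow_le_rpow (lintegral_mono' h le_rfl) (by positivity)

lemma lnorm_le_iff (hp : 0 < p) {C : ℝ≥0∞} : lnorm p μ f ≤ C ↔ ∫⁻ a, f a ^ p ∂μ ≤ C ^ p := by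
  rw [lnorm, one_div, ENNReal.rpow_inv_le_iff hp]

lemma lnorm_const_mul (hp : 0 < p) (c : ℝ≥0∞) (hf : Measurable f) :
    lnorm p μ (fun a => c * f a) = c * lnorm p μ f := by
  unfold lnorm
  simp_rw [ENNReal.mul_rpow_of_nonneg _ _ hp.le]
  rw [lintegral_const_mul _ (hf.pow_const _), ENNReal.mul_rpow_of_nonneg _ _ (by positivity),
    ← ENNReal.rpow_mul, mul_one_div_cancel hp.ne', ENNReal.rpow_one]

lemma lnorm_zero (hp : 0 < p) : lnorm p μ (fun _ => 0) = 0 := by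
  simp [lnorm, hp]

lemma lnorm_add_le (hp : 1 ≤ p) (hf : Measurable f) (hg : Measurable g) :
    lnorm p μ (fun a => f a + g a) ≤ lnorm p μ f + lnorm p μ g :=
  ENNReal.lintegral_Lp_add_le hf.aemeasurable hg.aemeasurable hp

lemma lnorm_sum_le {ι : Type*} (hp : 1 ≤ p) (s : Finset ι) {F : ι → α → ℝ≥0∞}
    (hF : ∀ i, Measurable (F i)) :
    lnorm p μ (fun a => ∑ i ∈ s, F i a) ≤ ∑ i ∈ s, lnorm p μ (F i) := by
  classical
  induction s using Finset.induction_on with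
  | empty => simp [lnorm_zero (lt_of_lt_of_le one_pos hp)]
  | insert i s hi ih =>
    simp_rw [Finset.sum_insert hi]
    refine (lnorm_add_le hp (hF i) (Finset.measurable_fun_sum _ fun j _ => hF j)).trans ?_
    gcongr

/-- Minkowski's inequality for series. -/
lemma lnorm_tsum_le (hp : 1 ≤ p) {F : ℕ → α → ℝ≥0∞} (hF : ∀ i, Measurable (F i)) :
    lnorm p μ (fun a => ∑' i, F i a) ≤ ∑' i, lnorm p μ (F i) := by
  have hp0 : 0 < p := lt_of_lt_of_le one_pos hp
  rw [lnorm_le_iff hp0]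
  have h1 : ∀ a, (∑' i, F i a) ^ p = ⨆ n : ℕ, (∑ i ∈ Finset.range n, F i a) ^ p := by
    intro a
    rw [ENNReal.tsum_eq_iSup_nat]
    exact (ENNReal.orderIsoRpow p hp0).map_iSup _
  simp_rw [h1]
  rw [lintegral_iSup (fun n => (Finset.measurable_fun_sum _ fun j _ => hF j).pow_const _)]
  · refine iSup_le fun n => ?_
    rw [← lnorm_le_iff hp0]
    exact (lnorm_sum_le hp _ hF).trans (ENNReal.sum_le_tsum _)
  · intro m n hmn a
    dsimp only
    refine ENNReal.rpow_le_rpow (Finset.sum_le_sum_of_subset ?_) hp0.le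
    exact Finset.range_mono hmn

/-- The `L^q` norm of a sum of functions supported in disjoint sets. -/
lemma lintegral_tsum_indicator_rpow (hq : 0 < q) {D : ℕ → Set α} (hD : ∀ n, MeasurableSet (D n))
    (hdis : Pairwise (Function.onFun Disjoint D)) {F : ℕ → α → ℝ≥0∞} (hF : ∀ i, Measurable (F i)) :
    ∫⁻ a, (∑' n, (D n).indicator (F n) a) ^ q ∂μ = ∑' n, ∫⁻ a in D n, F n a ^ q ∂μ := by
  have h : ∀ a, (∑' n, (D n).indicator (F n) a) ^ q
      = ∑' n, (D n).indicator (fun a => F n a ^ q) a := by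
    intro a
    by_cases ha : ∃ n, a ∈ D n
    · obtain ⟨n, hn⟩ := ha
      have hne : ∀ m, m ≠ n → a ∉ D m := fun m hm hm' =>
        Set.disjoint_left.1 (hdis hm) hm' hn
      rw [tsum_eq_single n (fun m hm => by simp [hne m hm]),
        tsum_eq_single n (fun m hm => by simp [hne m hm])]
      simp [hn]
    · push Not at ha
      simp [ha, hq]
  simp_rw [h]
  rw [lintegral_tsum (fun n => (((hF n).pow_const _).indicator (hD n)).aemeasurable)]
  congr 1
  ext n
  rw [lintegral_indicator (hD n)]

lemma tsum_rpow_le_rpow_tsum {ι : Type*} {r : ℝ} (hr : 1 ≤ r) (b : ι → ℝ≥0∞) :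
    ∑' i, b i ^ r ≤ (∑' i, b i) ^ r := by
  have h : ∀ a : ℝ≥0∞, a ^ r = a * a ^ (r - 1) := by
    intro a
    nth_rw 2 [← ENNReal.rpow_one a]
    rw [← ENNReal.rpow_add_of_nonneg _ _ (by norm_num) (by linarith)]
    ring_nf
  rw [h, ← ENNReal.tsum_mul_right]
  refine ENNReal.tsum_le_tsum fun i => ?_
  rw [h]
  exact mul_le_mul' le_rfl (ENNReal.rpow_le_rpow (ENNReal.le_tsum i) (by linarith))

/-- Hölder's inequality on a set of finite measure. -/
lemma setLIntegral_le_measure_mul_lnorm (hp : 1 ≤ p) (hf : Measurable f) (s : Set α) :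
    ∫⁻ a in s, f a ∂μ ≤ μ s ^ (1 - 1 / p) * lnorm p (μ.restrict s) f := by
  rcases hp.eq_or_lt with rfl | hp1
  · simp [lnorm]
  have hpq := Real.HolderConjugate.conjExponent hp1
  have := ENNReal.lintegral_mul_le_Lp_mul_Lq (μ.restrict s) hpq hf.aemeasurable
    (measurable_const (a := (1 : ℝ≥0∞))).aemeasurable
  simp only [Pi.mul_apply, mul_one, ENNReal.one_rpow, lintegral_const, one_mul,
    MeasurableSet.univ, Measure.restrict_apply, univ_inter] at this
  refine this.trans_eq ?_
  rw [mul_comm, lnorm]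
  congr 2
  have : p - 1 ≠ 0 := by linarith
  rw [Real.conjExponent]
  field_simp

lemma setLIntegral_rpow_le (hp : 1 ≤ p) (hf : Measurable f) (s : Set α) :
    (∫⁻ a in s, f a ∂μ) ^ p ≤ μ s ^ (p - 1) * ∫⁻ a in s, f a ^ p ∂μ := by
  have hp0 : 0 < p := lt_of_lt_of_le one_pos hp
  calc _ ≤ (μ s ^ (1 - 1 / p) * lnorm p (μ.restrict s) f) ^ p := by
        gcongr
        exact setLIntegral_le_measure_mul_lnorm hp hf s
    _ = _ := by
        rw [ENNReal.mul_rpow_of_nonneg _ _ hp0.le, lnorm_rpow hp0, ← ENNReal.rpow_mul]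
        congr 2
        field_simp

end RadialMaximal

namespace RadialMaximal

/-! ### Averages over intervals -/

lemma setLIntegral_Icc_eq (h : ℝ → ℝ≥0∞) (δ u : ℝ) :
    ∫⁻ s in Icc (u - δ) (u + δ), h s = ∫⁻ s, h s * (Icc (s - δ) (s + δ)).indicator 1 u := by
  rw [← lintegral_indicator measurableSet_Icc]
  congr 1
  ext s
  have : s ∈ Icc (u - δ) (u + δ) ↔ u ∈ Icc (s - δ) (s + δ) := by
    simp only [mem_Icc]; constructor <;> rintro ⟨h1, h2⟩ <;> constructor <;> linarith
  by_cases hs : s ∈ Icc (u - δ) (u + δ)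
  · simp [indicator_of_mem hs, indicator_of_mem (this.1 hs)]
  · simp [indicator_of_notMem hs, indicator_of_notMem (mt this.2 hs)]

lemma measurable_interval_kernel {h : ℝ → ℝ≥0∞} (hh : Measurable h) (δ : ℝ) :
    Measurable (fun z : ℝ × ℝ => h z.2 * (Icc (z.2 - δ) (z.2 + δ)).indicator 1 z.1) := by
  refine (hh.comp measurable_snd).mul ?_
  have : (fun z : ℝ × ℝ => (Icc (z.2 - δ) (z.2 + δ)).indicator (1 : ℝ → ℝ≥0∞) z.1)
      = ({z : ℝ × ℝ | z.2 - δ ≤ z.1 ∧ z.1 ≤ z.2 + δ}).indicator 1 := by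
    ext z; simp [indicator, mem_Icc]
  rw [this]
  refine measurable_const.indicator ?_
  exact (measurableSet_le (f := fun z : ℝ × ℝ => z.2 - δ) (g := fun z => z.1)
    (by fun_prop) (by fun_prop)).inter
    (measurableSet_le (f := fun z : ℝ × ℝ => z.1) (g := fun z => z.2 + δ)
    (by fun_prop) (by fun_prop))

lemma measurable_setLIntegral_Icc {h : ℝ → ℝ≥0∞} (hh : Measurable h) (δ : ℝ) :
    Measurable (fun u : ℝ => ∫⁻ s in Icc (u - δ) (u + δ), h s) := by
  simp_rw [setLIntegral_Icc_eq]
  exact (measurable_interval_kernel hh δ).lintegral_prod_right'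

lemma lintegral_setLIntegral_Icc {h : ℝ → ℝ≥0∞} (hh : Measurable h) (δ : ℝ) :
    ∫⁻ u, ∫⁻ s in Icc (u - δ) (u + δ), h s = ENNReal.ofReal (2 * δ) * ∫⁻ s, h s := by
  simp_rw [setLIntegral_Icc_eq]
  rw [lintegral_lintegral_swap (measurable_interval_kernel hh δ).aemeasurable]
  have : ∀ s, ∫⁻ u, h s * (Icc (s - δ) (s + δ)).indicator 1 u = ENNReal.ofReal (2 * δ) * h s := by
    intro s
    rw [lintegral_const_mul _ (measurable_one.indicator measurableSet_Icc),
      lintegral_indicator_one measurableSet_Icc, Real.volume_Icc, mul_comm]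
    congr 2; ring
  simp_rw [this]
  rw [lintegral_const_mul _ hh]

/-- Young's inequality for convolution with the indicator function of an interval. -/
lemma lintegral_setLIntegral_Icc_rpow_le {h : ℝ → ℝ≥0∞} (hh : Measurable h) {p q δ : ℝ}
    (hp : 1 ≤ p) (hpq : p ≤ q) :
    ∫⁻ u, (∫⁻ s in Icc (u - δ) (u + δ), h s) ^ q ≤
      ENNReal.ofReal (2 * δ) ^ (q + 1 - q / p) * (∫⁻ s, h s ^ p) ^ (q / p) := by
  have hp0 : 0 < p := lt_of_lt_of_le one_pos hp
  set L := ENNReal.ofReal (2 * δ)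
  set S := ∫⁻ s, h s ^ p
  have hqp : 0 ≤ q / p - 1 := by
    rw [sub_nonneg, le_div_iff₀ hp0]; linarith
  -- The power is split as `q = p (q/p - 1) + p`. Hölder bounds both factors, the first uniformly in
  -- `u`, and only the second is integrated by Fubini.
  have key : ∀ u, (∫⁻ s in Icc (u - δ) (u + δ), h s) ^ q ≤
      (L ^ (p - 1) * S) ^ (q / p - 1) * L ^ (p - 1) * ∫⁻ s in Icc (u - δ) (u + δ), h s ^ p := by
    intro u
    have h1 := setLIntegral_rpow_le (μ := volume) hp hh (Icc (u - δ) (u + δ))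
    have hv : volume (Icc (u - δ) (u + δ)) = L := by
      rw [Real.volume_Icc]; congr 1; ring
    rw [hv] at h1
    have e : (∫⁻ s in Icc (u - δ) (u + δ), h s) ^ q =
        ((∫⁻ s in Icc (u - δ) (u + δ), h s) ^ p) ^ (q / p - 1) *
        (∫⁻ s in Icc (u - δ) (u + δ), h s) ^ p := by
      rw [← ENNReal.rpow_mul, ← ENNReal.rpow_add_of_nonneg _ _ (by positivity) hp0.le]
      congr 1; field_simp; ring
    rw [e, mul_assoc]
    refine mul_le_mul' (ENNReal.rpow_le_rpow (h1.trans ?_) hqp) h1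
    gcongr
    exact setLIntegral_le_lintegral _ _
  refine (lintegral_mono key).trans ?_
  rw [lintegral_const_mul _ (measurable_setLIntegral_Icc (hh.pow_const _) δ),
    lintegral_setLIntegral_Icc (hh.pow_const _) δ]
  rw [ENNReal.mul_rpow_of_nonneg _ _ hqp, ← ENNReal.rpow_mul]
  have eS : S ^ (q / p) = S ^ (q / p - 1) * S := by
    nth_rw 3 [← ENNReal.rpow_one S]
    rw [← ENNReal.rpow_add_of_nonneg _ _ hqp zero_le_one]; ring_nf
  have eL : L ^ (q + 1 - q / p) = L ^ ((p - 1) * (q / p - 1)) * L ^ (p - 1) * L := by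
    nth_rw 4 [← ENNReal.rpow_one L]
    rw [← ENNReal.rpow_add_of_nonneg _ _ (mul_nonneg (by linarith) hqp) (by linarith),
      ← ENNReal.rpow_add_of_nonneg _ _ (add_nonneg (mul_nonneg (by linarith) hqp) (by linarith))
        zero_le_one]
    congr 1; field_simp; ring
  rw [eS, eL]
  exact le_of_eq (by ring)

/-- The integral of `h` over the interval of length `10 / 2 ^ k` centred at `u`. -/
noncomputable def avg (k : ℕ) (h : ℝ → ℝ≥0∞) (u : ℝ) : ℝ≥0∞ :=
  ∫⁻ s in Icc (u - 5 / 2 ^ k) (u + 5 / 2 ^ k), h s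

lemma measurable_avg (k : ℕ) {h : ℝ → ℝ≥0∞} (hh : Measurable h) : Measurable (avg k h) :=
  measurable_setLIntegral_Icc hh _

lemma ofReal_ten_div (k : ℕ) : ENNReal.ofReal (2 * (5 / 2 ^ k)) = 10 * pw (-k) := by
  have : (2 * (5 / 2 ^ k) : ℝ) = 10 * 2 ^ (-(k : ℝ)) := by
    rw [Real.rpow_neg (by norm_num), Real.rpow_natCast]; ring
  rw [this, ENNReal.ofReal_mul (by norm_num), ofReal_two_rpow]; simp

lemma lintegral_comp_affine (f : ℝ → ℝ≥0∞) {σ : ℝ} (hσ : |σ| = 1) (c : ℝ) :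
    ∫⁻ r, f (σ * r + c) = ∫⁻ r, f r := by
  rcases (abs_eq zero_le_one).1 hσ with rfl | rfl
  · simpa using lintegral_add_right_eq_self f c
  · have := lintegral_sub_left_eq_self (μ := volume) f c
    rw [← this]; congr 1; ext r; ring_nf

/-- The maximal function over the translates `σ₁ r + σ₂ j / 2 ^ k`, `j ∈ Z`, of the averages at
scale `2 ^ (-k)`. -/
noncomputable def vmax (Z : Finset ℤ) (σ₁ σ₂ : ℝ) (k : ℕ) (h : ℝ → ℝ≥0∞) (r : ℝ) : ℝ≥0∞ :=
  ⨆ j ∈ Z, avg k h (σ₁ * r + σ₂ * (j / 2 ^ k))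

lemma measurable_vmax (Z : Finset ℤ) (σ₁ σ₂ : ℝ) (k : ℕ) {h : ℝ → ℝ≥0∞} (hh : Measurable h) :
    Measurable (vmax Z σ₁ σ₂ k h) := by
  unfold vmax
  refine Measurable.iSup fun j => Measurable.iSup fun _ => ?_
  exact (measurable_avg k hh).comp (by fun_prop)

lemma biSup_rpow_le_sum {ι : Type*} (Z : Finset ι) (a : ι → ℝ≥0∞) {q : ℝ} (hq : 0 < q) :
    (⨆ j ∈ Z, a j) ^ q ≤ ∑ j ∈ Z, a j ^ q := by
  have h : ⨆ j ∈ Z, a j ≤ (∑ j ∈ Z, a j ^ q) ^ (1 / q) := by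
    refine iSup₂_le fun j hj => ?_
    calc a j = (a j ^ q) ^ (1 / q) := by
          rw [← ENNReal.rpow_mul, mul_one_div_cancel hq.ne', ENNReal.rpow_one]
      _ ≤ _ := by
          gcongr
          exact Finset.single_le_sum (f := fun j => a j ^ q) (fun _ _ => zero_le) hj
  calc _ ≤ ((∑ j ∈ Z, a j ^ q) ^ (1 / q)) ^ q := by gcongr
    _ = _ := by rw [← ENNReal.rpow_mul, one_div_mul_cancel hq.ne', ENNReal.rpow_one]

/-- The supremum is at most the `ℓ^q` sum over the grid. For `r ∈ R` the `j`-th translate sees `h`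
only on `B j`. Since `p ≤ q`, its contribution is linear in the `L^p` mass of `h` on `B j`, and
these masses add up to at most `n` times the total. With `B j` the whole line this uses the number
of grid points (Minkowski), with `B j` a neighbourhood of a grid point their local number (Assouad).
-/
lemma lintegral_vmax_rpow_le (Z : Finset ℤ) {σ₁ : ℝ} (σ₂ : ℝ) (hσ₁ : |σ₁| = 1) (k : ℕ)
    {h : ℝ → ℝ≥0∞} (hh : Measurable h) {p q : ℝ} (hp : 1 ≤ p) (hpq : p ≤ q) {R : Set ℝ}
    (hR : MeasurableSet R) (B : ℤ → Set ℝ) (hB : ∀ j, MeasurableSet (B j)) {n : ℝ≥0∞}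
    (hRB : ∀ j ∈ Z, ∀ r ∈ R, Icc (σ₁ * r + σ₂ * (j / 2 ^ k) - 5 / 2 ^ k)
      (σ₁ * r + σ₂ * (j / 2 ^ k) + 5 / 2 ^ k) ⊆ B j)
    (hn : ∀ s, ∑ j ∈ Z, (B j).indicator 1 s ≤ n) :
    ∫⁻ r in R, vmax Z σ₁ σ₂ k h r ^ q ≤
      n * (10 * pw (-k)) ^ (q + 1 - q / p) * (∫⁻ s, h s ^ p) ^ (q / p) := by
  have hp0 : 0 < p := lt_of_lt_of_le one_pos hp
  have hq0 : 0 < q := hp0.trans_le hpq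
  have hqp : 0 ≤ q / p - 1 := by
    rw [sub_nonneg, le_div_iff₀ hp0]; linarith
  set L := (10 * pw (-k)) ^ (q + 1 - q / p)
  set S := ∫⁻ s, h s ^ p
  have h1 : ∀ j ∈ Z, ∫⁻ r in R, avg k h (σ₁ * r + σ₂ * (j / 2 ^ k)) ^ q ≤
      L * (S ^ (q / p - 1) * ∫⁻ s in B j, h s ^ p) := by
    intro j hj
    calc _ ≤ ∫⁻ r in R, avg k ((B j).indicator h) (σ₁ * r + σ₂ * (j / 2 ^ k)) ^ q := by
          refine setLIntegral_mono' hR fun r hr => ?_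
          refine ENNReal.rpow_le_rpow (le_of_eq ?_) hq0.le
          refine setLIntegral_congr_fun measurableSet_Icc fun s hs => ?_
          exact (indicator_of_mem (hRB j hj r hr hs) h).symm
      _ ≤ ∫⁻ r, avg k ((B j).indicator h) (σ₁ * r + σ₂ * (j / 2 ^ k)) ^ q :=
          setLIntegral_le_lintegral _ _
      _ = ∫⁻ r, avg k ((B j).indicator h) r ^ q :=
          lintegral_comp_affine (fun u => avg k ((B j).indicator h) u ^ q) hσ₁ _
      _ ≤ L * (∫⁻ s, (B j).indicator h s ^ p) ^ (q / p) := by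
          have := lintegral_setLIntegral_Icc_rpow_le (hh.indicator (hB j)) (δ := 5 / 2 ^ k) hp hpq
          rwa [ofReal_ten_div] at this
      _ = L * (∫⁻ s in B j, h s ^ p) ^ (q / p) := by
          rw [← lintegral_indicator (hB j)]
          congr 3; ext s
          by_cases hs : s ∈ B j <;> simp [hs, hp0]
      _ ≤ _ := by
          gcongr
          have e : ∀ a : ℝ≥0∞, a ^ (q / p) = a ^ (q / p - 1) * a := by
            intro a
            nth_rw 3 [← ENNReal.rpow_one a]
            rw [← ENNReal.rpow_add_of_nonneg _ _ hqp zero_le_one]; ring_nf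
          rw [e]
          gcongr
          exact setLIntegral_le_lintegral _ _
  have h2 : ∑ j ∈ Z, ∫⁻ s in B j, h s ^ p ≤ n * S := by
    simp_rw [← lintegral_indicator (hB _)]
    rw [← lintegral_finsetSum _ fun j _ => (hh.pow_const _).indicator (hB j),
      ← lintegral_const_mul _ (hh.pow_const _)]
    refine lintegral_mono fun s => ?_
    calc ∑ j ∈ Z, (B j).indicator (fun s => h s ^ p) s
        = (∑ j ∈ Z, (B j).indicator 1 s) * h s ^ p := by
          rw [Finset.sum_mul]
          refine Finset.sum_congr rfl fun j _ => ?_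
          by_cases hs : s ∈ B j <;> simp [hs]
      _ ≤ _ := by gcongr; exact hn s
  calc _ ≤ ∫⁻ r in R, ∑ j ∈ Z, avg k h (σ₁ * r + σ₂ * (j / 2 ^ k)) ^ q :=
        lintegral_mono fun r => biSup_rpow_le_sum Z _ hq0
    _ = ∑ j ∈ Z, ∫⁻ r in R, avg k h (σ₁ * r + σ₂ * (j / 2 ^ k)) ^ q :=
        lintegral_finsetSum _ fun j _ => ((measurable_avg k hh).comp (by fun_prop)).pow_const _
    _ ≤ ∑ j ∈ Z, L * (S ^ (q / p - 1) * ∫⁻ s in B j, h s ^ p) := Finset.sum_le_sum h1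
    _ = L * (S ^ (q / p - 1) * ∑ j ∈ Z, ∫⁻ s in B j, h s ^ p) := by
        rw [Finset.mul_sum, Finset.mul_sum]
    _ ≤ L * (S ^ (q / p - 1) * (n * S)) := by gcongr
    _ = n * L * (S ^ (q / p - 1) * S) := by ring
    _ = _ := by
        congr 1
        nth_rw 2 [← ENNReal.rpow_one S]
        rw [← ENNReal.rpow_add_of_nonneg _ _ hqp zero_le_one]; ring_nf

lemma lnorm_vmax_le (Z : Finset ℤ) {σ₁ : ℝ} (σ₂ : ℝ) (hσ₁ : |σ₁| = 1) (k : ℕ)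
    {h : ℝ → ℝ≥0∞} (hh : Measurable h) {p q : ℝ} (hp : 1 ≤ p) (hpq : p ≤ q) {R : Set ℝ}
    (hR : MeasurableSet R) (B : ℤ → Set ℝ) (hB : ∀ j, MeasurableSet (B j)) {n : ℝ≥0∞}
    (hRB : ∀ j ∈ Z, ∀ r ∈ R, Icc (σ₁ * r + σ₂ * (j / 2 ^ k) - 5 / 2 ^ k)
      (σ₁ * r + σ₂ * (j / 2 ^ k) + 5 / 2 ^ k) ⊆ B j)
    (hn : ∀ s, ∑ j ∈ Z, (B j).indicator 1 s ≤ n) :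
    lnorm q (volume.restrict R) (vmax Z σ₁ σ₂ k h) ≤
      10 * n ^ (1 / q) * pw (-(k * (1 + 1 / q - 1 / p))) * lnorm p volume h := by
  have hp0 : 0 < p := lt_of_lt_of_le one_pos hp
  have hq0 : 0 < q := hp0.trans_le hpq
  have hx : 1 / q ≤ 1 / p := one_div_le_one_div_of_le hp0 hpq
  have hx1 : 1 / p ≤ 1 := by rw [div_le_one hp0]; exact hp
  have hy : 0 < 1 / q := by positivity
  have e : (q + 1 - q / p) * (1 / q) = 1 + 1 / q - 1 / p := by field_simp
  unfold lnorm
  refine (ENNReal.rpow_le_rpow (lintegral_vmax_rpow_le Z σ₂ hσ₁ k hh hp hpq hR B hB hRB hn)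
    hy.le).trans ?_
  rw [ENNReal.mul_rpow_of_nonneg _ _ hy.le, ENNReal.mul_rpow_of_nonneg _ _ hy.le,
    ← ENNReal.rpow_mul, ← ENNReal.rpow_mul, e, ENNReal.mul_rpow_of_nonneg _ _ (by linarith),
    pw_rpow]
  have e2 : q / p * (1 / q) = 1 / p := by field_simp
  rw [e2, neg_mul]
  have h10 : (10 : ℝ≥0∞) ^ (1 + 1 / q - 1 / p) ≤ 10 := by
    nth_rw 2 [← ENNReal.rpow_one 10]
    exact ENNReal.rpow_le_rpow_of_exponent_le (by norm_num) (by linarith)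
  calc _ ≤ n ^ (1 / q) * (10 * pw (-(↑k * (1 + 1 / q - 1 / p)))) * (∫⁻ s, h s ^ p) ^ (1 / p) := by
        gcongr
    _ = _ := by ring

lemma avg_le (k : ℕ) {h : ℝ → ℝ≥0∞} (hh : Measurable h) {p : ℝ} (hp : 1 ≤ p) (u : ℝ) :
    avg k h u ≤ 10 * pw (-(k * (1 - 1 / p))) * lnorm p volume h := by
  have hp0 : 0 < p := lt_of_lt_of_le one_pos hp
  have hx1 : 1 / p ≤ 1 := by rw [div_le_one hp0]; exact hp
  have hx0 : 0 < 1 / p := by positivity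
  refine (setLIntegral_le_measure_mul_lnorm hp hh _).trans ?_
  gcongr ?_ * ?_
  · have : volume (Icc (u - 5 / 2 ^ k) (u + 5 / 2 ^ k)) = 10 * pw (-k) := by
      rw [Real.volume_Icc, ← ofReal_ten_div]; congr 1; ring
    rw [this, ENNReal.mul_rpow_of_nonneg _ _ (by linarith), pw_rpow, neg_mul]
    gcongr
    nth_rw 2 [← ENNReal.rpow_one 10]
    exact ENNReal.rpow_le_rpow_of_exponent_le (by norm_num) (by linarith)
  · exact lnorm_mono_measure hp0 Measure.restrict_le_self

lemma vmax_le (Z : Finset ℤ) (σ₁ σ₂ : ℝ) (k : ℕ) {h : ℝ → ℝ≥0∞} (hh : Measurable h) {p : ℝ}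
    (hp : 1 ≤ p) (r : ℝ) :
    vmax Z σ₁ σ₂ k h r ≤ 10 * pw (-(k * (1 - 1 / p))) * lnorm p volume h :=
  iSup₂_le fun _ _ => avg_le k hh hp _

end RadialMaximal

namespace RadialMaximal

/-! ### The radial measure -/

/-- The measure `r dr` on `(0, ∞)`. -/
noncomputable def radM : Measure ℝ :=
  (volume.restrict (Ioi (0 : ℝ))).withDensity fun r => ENNReal.ofReal r

lemma lintegral_radM {f : ℝ → ℝ≥0∞} (hf : Measurable f) :
    ∫⁻ r, f r ∂radM = ∫⁻ r in Ioi (0 : ℝ), ENNReal.ofReal r * f r := by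
  rw [radM, lintegral_withDensity_eq_lintegral_mul _ ENNReal.measurable_ofReal hf]
  rfl

lemma setLIntegral_radM {f : ℝ → ℝ≥0∞} (hf : Measurable f) {R : Set ℝ} (hR : MeasurableSet R) :
    ∫⁻ r in R, f r ∂radM = ∫⁻ r in Ioi (0 : ℝ) ∩ R, ENNReal.ofReal r * f r := by
  rw [← lintegral_indicator hR, lintegral_radM (hf.indicator hR), inter_comm,
    ← setLIntegral_indicator hR]
  congr 1
  ext r
  by_cases hr : r ∈ R <;> simp [hr]

lemma radM_absolutelyContinuous : radM ≪ volume :=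
  (withDensity_absolutelyContinuous _ _).trans Measure.restrict_le_self.absolutelyContinuous

lemma lnorm_radM_le {q : ℝ} (hq : 0 < q) {f : ℝ → ℝ≥0∞} (hf : Measurable f) {R : Set ℝ}
    (hR : MeasurableSet R) {c : ℝ≥0∞} (hc : ∀ r ∈ R, ENNReal.ofReal r ≤ c) :
    lnorm q (radM.restrict R) f ≤ c ^ (1 / q) * lnorm q (volume.restrict R) f := by
  rw [lnorm_le_iff hq, setLIntegral_radM (hf.pow_const _) hR,
    ENNReal.mul_rpow_of_nonneg _ _ hq.le, lnorm_rpow hq, ← ENNReal.rpow_mul,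
    one_div_mul_cancel hq.ne', ENNReal.rpow_one]
  calc _ ≤ ∫⁻ r in Ioi (0 : ℝ) ∩ R, c * f r ^ q :=
        setLIntegral_mono' (measurableSet_Ioi.inter hR) fun r hr => by gcongr; exact hc r hr.2
    _ ≤ ∫⁻ r in R, c * f r ^ q := lintegral_mono_set inter_subset_right
    _ = _ := lintegral_const_mul _ (hf.pow_const _)

lemma lnorm_le_lnorm_radM {p : ℝ} (hp : 0 < p) {f : ℝ → ℝ≥0∞} (hf : Measurable f) {R : Set ℝ}
    (hfR : ∀ r, r ∉ R → f r = 0) {c : ℝ≥0∞}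
    (hc : ∀ r ∈ R, 0 < r ∧ 1 ≤ c * ENNReal.ofReal r) :
    lnorm p volume f ≤ c ^ (1 / p) * lnorm p radM f := by
  have hfp : ∀ r, r ∉ R → f r ^ p = 0 := fun r hr => by rw [hfR r hr, ENNReal.zero_rpow_of_pos hp]
  rw [lnorm_le_iff hp, ENNReal.mul_rpow_of_nonneg _ _ hp.le, lnorm_rpow hp, ← ENNReal.rpow_mul,
    one_div_mul_cancel hp.ne', ENNReal.rpow_one, lintegral_radM (hf.pow_const _),
    ← lintegral_const_mul _ (by fun_prop), ← lintegral_indicator measurableSet_Ioi]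
  refine lintegral_mono fun r => ?_
  by_cases hr : r ∈ R
  · rw [indicator_of_mem (show r ∈ Ioi (0 : ℝ) from (hc r hr).1), ← mul_assoc]
    exact le_mul_of_one_le_left (zero_le) (hc r hr).2
  · rw [hfp r hr]; exact zero_le

/-! ### The counting hypothesis and its direct consequences -/

lemma lnorm_vmax_le_card {Z : Finset ℤ} {β : ℝ} {C₀ : ℝ≥0∞} {k : ℕ}
    (hZ : (Z.card : ℝ≥0∞) ≤ C₀ * pw (β * k)) {σ₁ : ℝ} (σ₂ : ℝ) (hσ₁ : |σ₁| = 1)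
    {h : ℝ → ℝ≥0∞} (hh : Measurable h) {p q : ℝ} (hp : 1 ≤ p) (hpq : p ≤ q) :
    lnorm q volume (vmax Z σ₁ σ₂ k h) ≤
      10 * C₀ ^ (1 / q) * pw (-(k * (1 + (1 - β) * (1 / q) - 1 / p))) * lnorm p volume h := by
  have hq0 : 0 < q := by linarith
  have := lnorm_vmax_le Z σ₂ hσ₁ k hh hp hpq MeasurableSet.univ (fun _ => univ)
    (fun _ => MeasurableSet.univ) (n := C₀ * pw (β * k)) (fun _ _ _ _ => subset_univ _)
    (fun s => by simpa using hZ)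
  rw [Measure.restrict_univ] at this
  refine this.trans (le_of_eq ?_)
  rw [ENNReal.mul_rpow_of_nonneg _ _ (by positivity), pw_rpow]
  have e : -(k * (1 + (1 - β) * (1 / q) - 1 / p)) = β * k * (1 / q) + -(k * (1 + 1 / q - 1 / p)) := by
    ring
  rw [e, pw_add]
  ring

/-! ### The part of the maximal function away from the origin -/

/-- The maximal fractional integral of order `1/2`, dyadically decomposed. -/
noncomputable def farMax (Z : ℕ → Finset ℤ) (σ₁ σ₂ : ℝ) (h : ℝ → ℝ≥0∞) (r : ℝ) : ℝ≥0∞ :=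
  ∑' k : ℕ, pw (k / 2) * vmax (Z k) σ₁ σ₂ k h r

lemma measurable_farMax (Z : ℕ → Finset ℤ) (σ₁ σ₂ : ℝ) {h : ℝ → ℝ≥0∞} (hh : Measurable h) :
    Measurable (farMax Z σ₁ σ₂ h) :=
  Measurable.tsum fun _ => (measurable_vmax _ _ _ _ hh).const_mul _

/-- Scale `2^(-k)` contributes `2^(k/2)` from the kernel and `2^(-k(1 + (1-β)/q - 1/p))` from the
grid maximal function; `hε` makes the resulting geometric series converge. -/
lemma lnorm_farMax_le {Z : ℕ → Finset ℤ} {β : ℝ} {C₀ : ℝ≥0∞} (hC₀ : C₀ ≠ ∞)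
    (hZ : ∀ k, ((Z k).card : ℝ≥0∞) ≤ C₀ * pw (β * k)) {p q : ℝ} (hp : 1 ≤ p) (hpq : p ≤ q)
    (hε : 1 / p - (1 - β) * (1 / q) < 1 / 2) :
    ∃ C : ℝ≥0∞, C ≠ ∞ ∧ ∀ (σ₁ σ₂ : ℝ) (_ : |σ₁| = 1) (h : ℝ → ℝ≥0∞) (_ : Measurable h),
      lnorm q volume (farMax Z σ₁ σ₂ h) ≤ C * lnorm p volume h := by
  have hq0 : 0 < q := by linarith
  set ε := 1 / 2 - (1 / p - (1 - β) * (1 / q)) with hεdef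
  have hε0 : 0 < ε := by linarith
  refine ⟨10 * C₀ ^ (1 / q) * ∑' k : ℕ, pw (-(ε * k)), ?_, fun σ₁ σ₂ hσ₁ h hh => ?_⟩
  · refine ENNReal.mul_ne_top (ENNReal.mul_ne_top (by norm_num) ?_) (tsum_pw_lt_top hε0).ne
    exact ENNReal.rpow_ne_top_of_nonneg (by positivity) hC₀
  · refine (lnorm_tsum_le (hp.trans hpq) fun k => (measurable_vmax _ _ _ _ hh).const_mul _).trans ?_
    rw [← ENNReal.tsum_mul_left, ← ENNReal.tsum_mul_right]
    refine ENNReal.tsum_le_tsum fun k => ?_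
    rw [lnorm_const_mul hq0 _ (measurable_vmax _ _ _ _ hh)]
    calc _ ≤ pw (k / 2) * (10 * C₀ ^ (1 / q) * pw (-(k * (1 + (1 - β) * (1 / q) - 1 / p)))
            * lnorm p volume h) := by
          gcongr
          exact lnorm_vmax_le_card (hZ k) σ₂ hσ₁ hh hp hpq
      _ = 10 * C₀ ^ (1 / q) * (pw (k / 2) * pw (-(k * (1 + (1 - β) * (1 / q) - 1 / p))))
            * lnorm p volume h := by ring
      _ = _ := by
          rw [← pw_add]
          congr 3
          rw [hεdef]; ring

/-- The weights are moved through the averages: `r^(1/q)` outside becomes `s^(1/p)` inside, because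
`r ≤ 8 s` on the interval of integration, `s ≥ 1` and `1/q ≤ 1/p`. -/
lemma lnorm_radM_farMax_le {Z : ℕ → Finset ℤ} {β : ℝ} {C₀ : ℝ≥0∞} (hC₀ : C₀ ≠ ∞)
    (hZ : ∀ k, ((Z k).card : ℝ≥0∞) ≤ C₀ * pw (β * k))
    (hZ2 : ∀ k, ∀ j ∈ Z k, |(j : ℝ) / 2 ^ k| ≤ 2) {p q : ℝ} (hp : 1 ≤ p) (hpq : p ≤ q)
    (hε : 1 / p - (1 - β) * (1 / q) < 1 / 2) :
    ∃ C : ℝ≥0∞, C ≠ ∞ ∧ ∀ (σ₁ σ₂ : ℝ) (_ : |σ₁| = 1) (_ : |σ₂| = 1) (g : ℝ → ℝ≥0∞)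
      (_ : Measurable g),
      lnorm q radM (farMax Z σ₁ σ₂ ((Ici 1).indicator g)) ≤ C * lnorm p radM g := by
  obtain ⟨C, hC, H⟩ := lnorm_farMax_le hC₀ hZ hp hpq hε
  have hp0 : 0 < p := by linarith
  have hq0 : 0 < q := by linarith
  have hyx : 1 / q ≤ 1 / p := one_div_le_one_div_of_le hp0 hpq
  have hx1 : 1 / p ≤ 1 := by rw [div_le_one hp0]; exact hp
  refine ⟨8 * C, ENNReal.mul_ne_top (by norm_num) hC, fun σ₁ σ₂ hσ₁ hσ₂ g hg => ?_⟩
  set h : ℝ → ℝ≥0∞ := (Ici 1).indicator fun s => ENNReal.ofReal s ^ (1 / p) * g s with hh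
  have hhm : Measurable h :=
    ((ENNReal.measurable_ofReal.pow_const _).mul hg).indicator measurableSet_Ici
  have hgm : Measurable ((Ici 1).indicator g) := hg.indicator measurableSet_Ici
  have key : ∀ k, ∀ r : ℝ, 0 < r → ENNReal.ofReal r ^ (1 / q) *
      vmax (Z k) σ₁ σ₂ k ((Ici 1).indicator g) r ≤ 8 * vmax (Z k) σ₁ σ₂ k h r := by
    intro k r hr
    unfold vmax
    rw [ENNReal.mul_iSup]
    refine iSup_le fun j => ?_
    rw [ENNReal.mul_iSup]
    refine iSup_le fun hj => ?_
    refine le_trans ?_ (mul_le_mul_right (le_iSup₂_of_le j hj le_rfl) _)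
    unfold avg
    rw [← lintegral_const_mul _ hgm, ← lintegral_const_mul _ hhm]
    refine setLIntegral_mono' measurableSet_Icc fun s hs => ?_
    rw [hh]
    by_cases h1 : s ∈ Ici (1 : ℝ)
    · simp only [indicator_of_mem h1]
      rw [← mul_assoc]
      gcongr
      have h1' : (1 : ℝ) ≤ s := h1
      have h5 : (5 : ℝ) / 2 ^ k ≤ 5 := div_le_self (by norm_num) (one_le_pow₀ (by norm_num))
      have hj2 : |σ₂ * ((j : ℝ) / 2 ^ k)| ≤ 2 := by
        rw [abs_mul, hσ₂, one_mul]; exact hZ2 k j hj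
      have hr8 : r ≤ 8 * s := by
        have := abs_le.1 hj2
        rcases (abs_eq zero_le_one).1 hσ₁ with rfl | rfl
        · linarith [hs.1, hs.2]
        · linarith [hs.1, hs.2]
      calc ENNReal.ofReal r ^ (1 / q) ≤ ENNReal.ofReal (8 * s) ^ (1 / q) := by
            gcongr
        _ ≤ ENNReal.ofReal (8 * s) ^ (1 / p) := by
            refine ENNReal.rpow_le_rpow_of_exponent_le ?_ hyx
            rw [ENNReal.one_le_ofReal]; linarith
        _ = 8 ^ (1 / p) * ENNReal.ofReal s ^ (1 / p) := by
            rw [ENNReal.ofReal_mul (by norm_num), ENNReal.mul_rpow_of_nonneg _ _ (by positivity)]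
            simp
        _ ≤ 8 * ENNReal.ofReal s ^ (1 / p) := by
            gcongr
            nth_rw 2 [← ENNReal.rpow_one 8]
            exact ENNReal.rpow_le_rpow_of_exponent_le (by norm_num) hx1
    · simp [indicator_of_notMem h1]
  have key2 : ∀ r : ℝ, 0 < r → ENNReal.ofReal r ^ (1 / q) *
      farMax Z σ₁ σ₂ ((Ici 1).indicator g) r ≤ 8 * farMax Z σ₁ σ₂ h r := by
    intro r hr
    unfold farMax
    rw [← ENNReal.tsum_mul_left, ← ENNReal.tsum_mul_left]
    refine ENNReal.tsum_le_tsum fun k => ?_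
    calc _ = pw (k / 2) * (ENNReal.ofReal r ^ (1 / q) *
          vmax (Z k) σ₁ σ₂ k ((Ici 1).indicator g) r) := by ring
      _ ≤ pw (k / 2) * (8 * vmax (Z k) σ₁ σ₂ k h r) := mul_le_mul' le_rfl (key k r hr)
      _ = _ := by ring
  have hF := measurable_farMax Z σ₁ σ₂ hgm
  have hFh := measurable_farMax Z σ₁ σ₂ hhm
  calc lnorm q radM (farMax Z σ₁ σ₂ ((Ici 1).indicator g))
      ≤ lnorm q volume (fun r => 8 * farMax Z σ₁ σ₂ h r) := by
        unfold lnorm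
        rw [lintegral_radM (hF.pow_const _)]
        refine ENNReal.rpow_le_rpow ?_ (by positivity)
        refine (setLIntegral_mono' (g := fun r => (8 * farMax Z σ₁ σ₂ h r) ^ q)
          measurableSet_Ioi fun r hr => ?_).trans (setLIntegral_le_lintegral _ _)
        calc _ = (ENNReal.ofReal r ^ (1 / q) * farMax Z σ₁ σ₂ ((Ici 1).indicator g) r) ^ q := by
              rw [ENNReal.mul_rpow_of_nonneg _ _ hq0.le, ← ENNReal.rpow_mul,
                one_div_mul_cancel hq0.ne', ENNReal.rpow_one]
          _ ≤ _ := ENNReal.rpow_le_rpow (key2 r hr) hq0.le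
    _ = 8 * lnorm q volume (farMax Z σ₁ σ₂ h) := lnorm_const_mul hq0 _ hFh
    _ ≤ 8 * (C * lnorm p volume h) := by gcongr; exact H σ₁ σ₂ hσ₁ h hhm
    _ ≤ 8 * C * lnorm p radM g := by
        rw [mul_assoc]
        gcongr
        unfold lnorm
        rw [lintegral_radM (hg.pow_const _), ← lintegral_indicator measurableSet_Ioi]
        gcongr with s
        rw [hh]
        by_cases h1 : s ∈ Ici (1 : ℝ)
        · have h0 : s ∈ Ioi (0 : ℝ) := lt_of_lt_of_le (one_pos (α := ℝ)) h1
          rw [indicator_of_mem h1, indicator_of_mem h0, ENNReal.mul_rpow_of_nonneg _ _ hp0.le,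
            ← ENNReal.rpow_mul, one_div_mul_cancel hp0.ne', ENNReal.rpow_one]
        · simp [indicator_of_notMem h1, hp0]

end RadialMaximal

namespace RadialMaximal

/-! ### The part of the input near the origin -/

/-- The dyadic interval `[2 ^ (-m - 1), 2 ^ (-m))`. -/
def dyadicIco (m : ℕ) : Set ℝ := Ico (1 / 2 ^ (m + 1)) (1 / 2 ^ m)

lemma measurableSet_dyadicIco (m : ℕ) : MeasurableSet (dyadicIco m) := measurableSet_Ico

lemma pairwise_disjoint_dyadicIco : Pairwise (Function.onFun Disjoint dyadicIco) := by
  have h : ∀ m n, m < n → Disjoint (dyadicIco m) (dyadicIco n) := by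
    intro m n hmn
    refine Set.disjoint_left.2 fun x hx hx' => ?_
    have : (1 : ℝ) / 2 ^ n ≤ 1 / 2 ^ (m + 1) :=
      one_div_le_one_div_of_le (by positivity) (pow_le_pow_right₀ (by norm_num) hmn)
    linarith [hx.1, hx'.2]
  intro m n hmn
  rcases hmn.lt_or_gt with hlt | hlt
  · exact h m n hlt
  · exact (h n m hlt).symm

lemma tsum_lnorm_dyadic_rpow_le {μ : Measure ℝ} {g : ℝ → ℝ≥0∞} {p : ℝ} (hp : 0 < p) :
    ∑' m, lnorm p μ ((dyadicIco m).indicator g) ^ p ≤ lnorm p μ g ^ p := by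
  rw [lnorm_rpow hp]
  have : ∀ m, lnorm p μ ((dyadicIco m).indicator g) ^ p = ∫⁻ a in dyadicIco m, g a ^ p ∂μ := by
    intro m
    rw [lnorm_rpow hp, ← lintegral_indicator (measurableSet_dyadicIco m)]
    congr 1; ext s
    by_cases hs : s ∈ dyadicIco m <;> simp [hs, hp]
  simp_rw [this]
  rw [← lintegral_iUnion measurableSet_dyadicIco pairwise_disjoint_dyadicIco]
  exact setLIntegral_le_lintegral _ _

/-- Disjointness gives the `ℓ^p` sum and `p ≤ q` passes to `ℓ^q`. On the critical line this replaces
the missing decay in `m`. -/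
lemma tsum_lnorm_dyadic_le {μ : Measure ℝ} {g : ℝ → ℝ≥0∞} {p q : ℝ}
    (hp : 0 < p) (hpq : p ≤ q) :
    (∑' m, lnorm p μ ((dyadicIco m).indicator g) ^ q) ^ (1 / q) ≤ lnorm p μ g := by
  have hq : 0 < q := hp.trans_le hpq
  rw [one_div, ENNReal.rpow_inv_le_iff hq]
  calc ∑' m, lnorm p μ ((dyadicIco m).indicator g) ^ q
      = ∑' m, (lnorm p μ ((dyadicIco m).indicator g) ^ p) ^ (q / p) := by
        congr 1; ext m
        rw [← ENNReal.rpow_mul]; congr 1; field_simp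
    _ ≤ (∑' m, lnorm p μ ((dyadicIco m).indicator g) ^ p) ^ (q / p) :=
        tsum_rpow_le_rpow_tsum (by rwa [le_div_iff₀ hp, one_mul]) _
    _ ≤ (lnorm p μ g ^ p) ^ (q / p) := by
        gcongr
        exact tsum_lnorm_dyadic_rpow_le hp
    _ = _ := by rw [← ENNReal.rpow_mul]; congr 1; field_simp

/-- One dyadic piece of `nearMax`. -/
noncomputable def nearPiece (Z : ℕ → Finset ℤ) (σ₁ σ₂ : ℝ) (g : ℝ → ℝ≥0∞) (m n : ℕ) (r : ℝ) :
    ℝ≥0∞ :=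
  pw (n / 2) * vmax (Z (m + n)) σ₁ σ₂ (m + n) ((dyadicIco m).indicator g) r

/-- The maximal function for the inputs near the origin; `S m` is the set of radii at distance at
most `2 ^ (-m)` from the dilation set. -/
noncomputable def nearMax (Z : ℕ → Finset ℤ) (S : ℕ → Set ℝ) (σ₁ σ₂ : ℝ) (g : ℝ → ℝ≥0∞) (r : ℝ) :
    ℝ≥0∞ :=
  ∑' m : ℕ, (S m).indicator (fun r => ∑' n : ℕ, nearPiece Z σ₁ σ₂ g m n r) r

variable {Z : ℕ → Finset ℤ} {S : ℕ → Set ℝ} {β : ℝ} {C₀ C₁ : ℝ≥0∞} {p q σ₁ σ₂ : ℝ} {g : ℝ → ℝ≥0∞}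

lemma measurable_nearPiece (hg : Measurable g) (m n : ℕ) :
    Measurable (nearPiece Z σ₁ σ₂ g m n) :=
  (measurable_vmax _ _ _ _ (hg.indicator (measurableSet_dyadicIco m))).const_mul _

lemma measurable_nearMax (hS : ∀ m, MeasurableSet (S m)) (hg : Measurable g) :
    Measurable (nearMax Z S σ₁ σ₂ g) :=
  Measurable.tsum fun m =>
    (Measurable.tsum fun n => measurable_nearPiece hg m n).indicator (hS m)

lemma lnorm_dyadic_le (hp : 1 ≤ p) (hg : Measurable g) (m : ℕ) :
    lnorm p volume ((dyadicIco m).indicator g) ≤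
      2 * pw (m * (1 / p)) * lnorm p radM ((dyadicIco m).indicator g) := by
  have hp0 : 0 < p := by linarith
  have hx1 : 1 / p ≤ 1 := by rw [div_le_one hp0]; exact hp
  refine (lnorm_le_lnorm_radM hp0 (hg.indicator (measurableSet_dyadicIco m)) (R := dyadicIco m)
    (c := 2 * pw m) (fun r hr => indicator_of_notMem hr _) fun r hr => ?_).trans ?_
  · have h0 : (0 : ℝ) < 1 / 2 ^ (m + 1) := by positivity
    refine ⟨h0.trans_le hr.1, ?_⟩
    have h1 : (2 : ℝ≥0∞) * pw m = ENNReal.ofReal (2 ^ (m + 1)) := by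
      rw [pw_nat, ENNReal.ofReal_pow (by norm_num)]
      simp [pow_succ, mul_comm]
    rw [h1, ← ENNReal.ofReal_mul (by positivity), ENNReal.one_le_ofReal]
    calc (1 : ℝ) = 2 ^ (m + 1) * (1 / 2 ^ (m + 1)) := by field_simp
      _ ≤ _ := by gcongr; exact hr.1
  · rw [ENNReal.mul_rpow_of_nonneg _ _ (by positivity), pw_rpow]
    gcongr
    nth_rw 2 [← ENNReal.rpow_one 2]
    exact ENNReal.rpow_le_rpow_of_exponent_le (by norm_num) hx1

/-- The exponents collect to `m (2/p - 1 - (1-β)/q)` plus a multiple of `n`. By `hcrit` the first is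
nonpositive and is dropped. -/
lemma lnorm_nearPiece_le (hZ : ∀ k, ((Z k).card : ℝ≥0∞) ≤ C₀ * pw (β * k)) (hσ₁ : |σ₁| = 1)
    (hp : 1 ≤ p) (hpq : p ≤ q) (hcrit : 2 * (1 / p) - 1 ≤ (1 - β) * (1 / q)) (hg : Measurable g)
    (m n : ℕ) :
    lnorm q volume (nearPiece Z σ₁ σ₂ g m n) ≤
      20 * C₀ ^ (1 / q) * pw (-((1 / 2 - (1 / p - (1 - β) * (1 / q))) * n)) *
        lnorm p radM ((dyadicIco m).indicator g) := by
  have hq0 : 0 < q := by linarith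
  have hgm := hg.indicator (measurableSet_dyadicIco m)
  unfold nearPiece
  rw [lnorm_const_mul hq0 _ (measurable_vmax _ _ _ _ hgm)]
  calc _ ≤ pw (n / 2) * (10 * C₀ ^ (1 / q) *
        pw (-(((m + n : ℕ) : ℝ) * (1 + (1 - β) * (1 / q) - 1 / p))) *
        (2 * pw (m * (1 / p)) * lnorm p radM ((dyadicIco m).indicator g))) := by
        refine mul_le_mul' le_rfl ((lnorm_vmax_le_card (hZ _) σ₂ hσ₁ hgm hp hpq).trans ?_)
        exact mul_le_mul' le_rfl (lnorm_dyadic_le hp hg m)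
    _ = 20 * C₀ ^ (1 / q) * (pw (n / 2) * pw (-(((m + n : ℕ) : ℝ) *
          (1 + (1 - β) * (1 / q) - 1 / p))) * pw (m * (1 / p))) *
          lnorm p radM ((dyadicIco m).indicator g) := by
        rw [show (20 : ℝ≥0∞) = 10 * 2 by norm_num]; ring
    _ ≤ _ := by
        rw [← pw_add, ← pw_add]
        gcongr
        refine pw_mono ?_
        push_cast
        have : (m : ℝ) * (2 * (1 / p) - 1 - (1 - β) * (1 / q)) ≤ 0 :=
          mul_nonpos_of_nonneg_of_nonpos (Nat.cast_nonneg m) (by linarith)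
        linarith

/-- A pointwise bound for use on small sets. It grows in `n`, but over a set of measure
`2^(-(1-β)(m+l))` the growth in `m` cancels and decay in `l` is gained. -/
lemma nearPiece_le (hp : 1 ≤ p) (hcrit : 2 * (1 / p) - 1 ≤ (1 - β) * (1 / q)) (hg : Measurable g)
    (m n : ℕ) (r : ℝ) :
    nearPiece Z σ₁ σ₂ g m n r ≤ 20 * pw (n / 2 + m * ((1 - β) * (1 / q))) *
        lnorm p radM ((dyadicIco m).indicator g) := by
  have hp0 : 0 < p := by linarith
  have hx1 : 1 / p ≤ 1 := by rw [div_le_one hp0]; exact hp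
  have hgm := hg.indicator (measurableSet_dyadicIco m)
  unfold nearPiece
  calc _ ≤ pw (n / 2) * (10 * pw (-(((m + n : ℕ) : ℝ) * (1 - 1 / p))) *
        (2 * pw (m * (1 / p)) * lnorm p radM ((dyadicIco m).indicator g))) := by
        refine mul_le_mul' le_rfl ((vmax_le _ _ _ _ hgm hp r).trans ?_)
        exact mul_le_mul' le_rfl (lnorm_dyadic_le hp hg m)
    _ = 20 * (pw (n / 2) * pw (-(((m + n : ℕ) : ℝ) * (1 - 1 / p))) * pw (m * (1 / p))) *
          lnorm p radM ((dyadicIco m).indicator g) := by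
        rw [show (20 : ℝ≥0∞) = 10 * 2 by norm_num]; ring
    _ ≤ _ := by
        rw [← pw_add, ← pw_add]
        gcongr
        refine pw_mono ?_
        push_cast
        have h1 : (m : ℝ) * (2 * (1 / p) - 1 - (1 - β) * (1 / q)) ≤ 0 :=
          mul_nonpos_of_nonneg_of_nonpos (Nat.cast_nonneg m) (by linarith)
        have h2 : 0 ≤ (n : ℝ) * (1 - 1 / p) := mul_nonneg (Nat.cast_nonneg n) (by linarith)
        linarith

lemma lnorm_nearPiece_restrict_le (hq : 0 < q) (hp : 1 ≤ p)
    (hcrit : 2 * (1 / p) - 1 ≤ (1 - β) * (1 / q)) (hg : Measurable g) (m n l : ℕ) {D : Set ℝ}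
    (hD : volume D ≤ C₁ * pw (-((1 - β) * (m + l : ℕ)))) :
    lnorm q (volume.restrict D) (nearPiece Z σ₁ σ₂ g m n) ≤
      20 * C₁ ^ (1 / q) * pw (n / 2 - (1 - β) * (1 / q) * l) *
        lnorm p radM ((dyadicIco m).indicator g) := by
  set b := lnorm p radM ((dyadicIco m).indicator g)
  calc _ ≤ lnorm q (volume.restrict D)
        (fun _ => 20 * pw (n / 2 + m * ((1 - β) * (1 / q))) * b) :=
        lnorm_mono hq fun r => nearPiece_le hp hcrit hg m n r
    _ = 20 * pw (n / 2 + m * ((1 - β) * (1 / q))) * b * volume D ^ (1 / q) := by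
        unfold lnorm
        rw [lintegral_const, Measure.restrict_apply_univ,
          ENNReal.mul_rpow_of_nonneg _ _ (by positivity), ← ENNReal.rpow_mul,
          mul_one_div_cancel hq.ne', ENNReal.rpow_one]
    _ ≤ 20 * pw (n / 2 + m * ((1 - β) * (1 / q))) * b *
          (C₁ * pw (-((1 - β) * (m + l : ℕ)))) ^ (1 / q) := by gcongr
    _ = 20 * C₁ ^ (1 / q) * (pw (n / 2 + m * ((1 - β) * (1 / q))) *
          pw (-((1 - β) * (m + l : ℕ)) * (1 / q))) * b := by
        rw [ENNReal.mul_rpow_of_nonneg _ _ (by positivity), pw_rpow]; ring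
    _ = _ := by
        rw [← pw_add]
        congr 3
        push_cast
        ring

/-- The annuli between consecutive neighbourhoods of the dilation set. -/
lemma pairwise_disjoint_sdiff_succ (hS : Antitone S) (l : ℕ) :
    Pairwise (Function.onFun Disjoint fun m => S (m + l) \ S (m + l + 1)) := by
  have h : ∀ m n, m < n → Disjoint (S (m + l) \ S (m + l + 1)) (S (n + l) \ S (n + l + 1)) := by
    intro m n hmn
    refine Set.disjoint_left.2 fun x hx hx' => hx.2 (hS (by omega) hx'.1)
  intro m n hmn
  rcases hmn.lt_or_gt with hlt | hlt
  · exact h m n hlt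
  · exact (h n m hlt).symm

/-- As `β < 1`, the measures of the `S m` are summable, so their intersection cannot have positive
measure. -/
lemma ae_exists_notMem (hβ : β < 1) (hC₁ : C₁ ≠ ∞)
    (hvol : ∀ m : ℕ, volume (S m) ≤ C₁ * pw (-((1 - β) * m))) :
    ∀ᵐ r : ℝ, ∃ m, r ∉ S m := by
  have h0 : volume (⋂ m, S m) = 0 := by
    by_contra hne
    have hle : ∀ m : ℕ, volume (⋂ m, S m) ≤ C₁ * pw (-((1 - β) * m)) := fun m =>
      (measure_mono (iInter_subset _ m)).trans (hvol m)
    have hsum : ∑' m : ℕ, volume (⋂ m, S m) ≤ C₁ * ∑' m : ℕ, pw (-((1 - β) * m)) := by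
      rw [← ENNReal.tsum_mul_left]
      exact ENNReal.tsum_le_tsum hle
    rw [ENNReal.tsum_const_eq_top_of_ne_zero hne] at hsum
    exact ENNReal.mul_ne_top hC₁ (tsum_pw_lt_top (by linarith)).ne (top_le_iff.1 hsum)
  rw [ae_iff]
  convert h0 using 2
  ext r
  simp

/-- Each `S m` is cut into the annuli `S (m+l) \ S (m+l+1)`. For fixed `l` these are disjoint as `m`
varies, so the `q`-th powers of the norms add up, and `p ≤ q` sums the dyadic pieces of `g`. The
sums over `l` and `n` converge by interpolating between the `L^p → L^q` bound, which decays in `n`,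
and the pointwise bound, which decays in `l`. -/
lemma lnorm_nearMax_le (hβ : β < 1) (hC₀ : C₀ ≠ ∞) (hC₁ : C₁ ≠ ∞)
    (hZ : ∀ k, ((Z k).card : ℝ≥0∞) ≤ C₀ * pw (β * k)) (hSm : ∀ m, MeasurableSet (S m))
    (hS : Antitone S) (hvol : ∀ m : ℕ, volume (S m) ≤ C₁ * pw (-((1 - β) * m)))
    (hp : 1 ≤ p) (hpq : p ≤ q) (hcrit : 2 * (1 / p) - 1 ≤ (1 - β) * (1 / q))
    (hε : 1 / p - (1 - β) * (1 / q) < 1 / 2) :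
    ∃ C : ℝ≥0∞, C ≠ ∞ ∧ ∀ (σ₁ σ₂ : ℝ) (_ : |σ₁| = 1) (g : ℝ → ℝ≥0∞) (_ : Measurable g),
      lnorm q volume (nearMax Z S σ₁ σ₂ g) ≤ C * lnorm p radM g := by
  have hq0 : 0 < q := by linarith
  have hq1 : 1 ≤ q := by linarith
  have hp0 : 0 < p := by linarith
  set ε := 1 / 2 - (1 / p - (1 - β) * (1 / q)) with hεdef
  have hε0 : 0 < ε := by linarith
  set c := (1 - β) * (1 / q) with hc
  have hc0 : 0 < c := mul_pos (by linarith) (by positivity)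
  -- The weight solves `ε(1-τ) = τ`: the first bound then decays like `2^(-τn)`, the second costs
  -- `2^(τn/2)`, and `2^(-τn/2)` is left.
  set τ := ε / (ε + 1) with hτ
  have hτ0 : 0 < τ := by positivity
  have hτ1 : τ ≤ 1 := by rw [hτ, div_le_one (by positivity)]; linarith
  have hτε : ε * (1 - τ) = τ := by rw [hτ]; field_simp; ring
  set K := 20 * (C₀ ^ (1 / q) + C₁ ^ (1 / q)) with hK
  have hKtop : K ≠ ∞ := by
    refine ENNReal.mul_ne_top (by norm_num) (ENNReal.add_ne_top.2 ⟨?_, ?_⟩) <;>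
    exact ENNReal.rpow_ne_top_of_nonneg (by positivity) ‹_›
  refine ⟨K * ((∑' l : ℕ, pw (-(c * τ * l))) * ∑' n : ℕ, pw (-(τ / 2 * n))), ?_,
    fun σ₁ σ₂ hσ₁ g hg => ?_⟩
  · exact ENNReal.mul_ne_top hKtop (ENNReal.mul_ne_top (tsum_pw_lt_top (by positivity)).ne
      (tsum_pw_lt_top (by positivity)).ne)
  set b : ℕ → ℝ≥0∞ := fun m => lnorm p radM ((dyadicIco m).indicator g) with hb
  set D : ℕ → ℕ → Set ℝ := fun l m => S (m + l) \ S (m + l + 1) with hD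
  have hDm : ∀ l m, MeasurableSet (D l m) := fun l m => (hSm _).diff (hSm _)
  have hpiece : ∀ l n m, lnorm q (volume.restrict (D l m)) (nearPiece Z σ₁ σ₂ g m n) ≤
      K * (pw (-(c * τ * l)) * pw (-(τ / 2 * n))) * b m := by
    intro l n m
    have h1 : lnorm q (volume.restrict (D l m)) (nearPiece Z σ₁ σ₂ g m n) ≤
        K * pw (-(ε * n)) * b m := by
      refine (lnorm_mono_measure hq0 Measure.restrict_le_self).trans
        ((lnorm_nearPiece_le hZ hσ₁ hp hpq hcrit hg m n).trans ?_)
      rw [hK]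
      gcongr
      exact le_self_add
    have h2 : lnorm q (volume.restrict (D l m)) (nearPiece Z σ₁ σ₂ g m n) ≤
        K * pw (n / 2 - c * l) * b m := by
      refine (lnorm_nearPiece_restrict_le hq0 hp hcrit hg m n l
        ((measure_mono sdiff_subset).trans (hvol _))).trans ?_
      rw [hK]
      gcongr
      exact le_add_self
    have h3 : lnorm q (volume.restrict (D l m)) (nearPiece Z σ₁ σ₂ g m n) ≤
        K * b m * min (pw (-(ε * n))) (pw (n / 2 - c * l)) := by
      rcases min_choice (pw (-(ε * n))) (pw (n / 2 - c * l)) with h | h <;> rw [h]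
      · exact h1.trans_eq (by ring)
      · exact h2.trans_eq (by ring)
    refine h3.trans ((mul_le_mul' le_rfl ?_).trans_eq (mul_right_comm _ _ _))
    refine (min_le_rpow_mul_rpow _ _ hτ0.le hτ1).trans (le_of_eq ?_)
    rw [pw_rpow, pw_rpow, ← pw_add, ← pw_add]
    congr 1
    calc -(ε * ↑n) * (1 - τ) + (↑n / 2 - c * ↑l) * τ
        = -(ε * (1 - τ) * n) + (↑n / 2 - c * ↑l) * τ := by ring
      _ = _ := by rw [hτε]; ring
  set F : ℕ → ℕ → ℝ → ℝ≥0∞ := fun l n r =>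
    ∑' m, (D l m).indicator (nearPiece Z σ₁ σ₂ g m n) r with hF
  have hFm : ∀ l n, Measurable (F l n) := fun l n =>
    Measurable.tsum fun m => (measurable_nearPiece hg m n).indicator (hDm l m)
  have hFle : ∀ l n, lnorm q volume (F l n) ≤
      K * (pw (-(c * τ * l)) * pw (-(τ / 2 * n))) * lnorm p radM g := by
    intro l n
    set A := K * (pw (-(c * τ * l)) * pw (-(τ / 2 * n)))
    unfold lnorm
    rw [lintegral_tsum_indicator_rpow hq0 (hDm l) (pairwise_disjoint_sdiff_succ hS l)
      (fun m => measurable_nearPiece hg m n)]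
    calc _ ≤ (∑' m, (A * b m) ^ q) ^ (1 / q) := by
          gcongr with m
          rw [← lnorm_le_iff hq0]
          exact hpiece l n m
      _ = A * (∑' m, b m ^ q) ^ (1 / q) := by
          simp_rw [ENNReal.mul_rpow_of_nonneg _ _ hq0.le]
          rw [ENNReal.tsum_mul_left, ENNReal.mul_rpow_of_nonneg _ _ (by positivity),
            ← ENNReal.rpow_mul, mul_one_div_cancel hq0.ne', ENNReal.rpow_one]
      _ ≤ _ := by
          gcongr
          exact tsum_lnorm_dyadic_le hp0 hpq
  -- Almost every `r` eventually leaves the decreasing sets, so a point of `S m` lies in the annulus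
  -- of the last set that contains it.
  have hdom : ∀ᵐ r : ℝ, nearMax Z S σ₁ σ₂ g r ≤ ∑' l, ∑' n, F l n r := by
    filter_upwards [ae_exists_notMem hβ hC₁ hvol] with r hr
    have e1 : ∀ l, ∑' n, F l n r =
        ∑' m, (D l m).indicator (fun r => ∑' n, nearPiece Z σ₁ σ₂ g m n r) r := by
      intro l
      simp only [hF]
      rw [ENNReal.tsum_comm]
      congr 1; ext m
      by_cases hm : r ∈ D l m <;> simp [hm]
    simp_rw [e1]
    rw [ENNReal.tsum_comm]
    refine ENNReal.tsum_le_tsum fun m => ?_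
    by_cases hm : r ∈ S m
    · obtain ⟨N, hN, hN'⟩ : ∃ N, r ∈ S (m + N) ∧ r ∉ S (m + N + 1) := by
        by_contra hcon
        push Not at hcon
        obtain ⟨M, hM⟩ := hr
        have : ∀ N, r ∈ S (m + N) := by
          intro N
          induction N with
          | zero => exact hm
          | succ N ih => exact hcon N ih
        exact hM (hS (Nat.le_add_left M m) (this M))
      refine le_trans ?_ (ENNReal.le_tsum N)
      rw [indicator_of_mem hm, indicator_of_mem (show r ∈ D N m from ⟨hN, hN'⟩)]
    · simp [hm]
  calc lnorm q volume (nearMax Z S σ₁ σ₂ g)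
      ≤ lnorm q volume (fun r => ∑' l, ∑' n, F l n r) := lnorm_mono_ae hq0 hdom
    _ ≤ ∑' l, lnorm q volume (fun r => ∑' n, F l n r) :=
        lnorm_tsum_le hq1 fun l => Measurable.tsum fun n => hFm l n
    _ ≤ ∑' l, ∑' n, lnorm q volume (F l n) :=
        ENNReal.tsum_le_tsum fun l => lnorm_tsum_le hq1 fun n => hFm l n
    _ ≤ ∑' l : ℕ, ∑' n : ℕ, K * (pw (-(c * τ * l)) * pw (-(τ / 2 * n))) * lnorm p radM g :=
        ENNReal.tsum_le_tsum fun l => ENNReal.tsum_le_tsum fun n => hFle l n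
    _ = _ := by
        simp_rw [ENNReal.tsum_mul_right, ENNReal.tsum_mul_left, ENNReal.tsum_mul_right]

lemma lnorm_radM_nearMax_le (hβ : β < 1) (hC₀ : C₀ ≠ ∞) (hC₁ : C₁ ≠ ∞)
    (hZ : ∀ k, ((Z k).card : ℝ≥0∞) ≤ C₀ * pw (β * k)) (hSm : ∀ m, MeasurableSet (S m))
    (hS : Antitone S) (hS4 : S 0 ⊆ Iic 4)
    (hvol : ∀ m : ℕ, volume (S m) ≤ C₁ * pw (-((1 - β) * m)))
    (hp : 1 ≤ p) (hpq : p ≤ q) (hcrit : 2 * (1 / p) - 1 ≤ (1 - β) * (1 / q))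
    (hε : 1 / p - (1 - β) * (1 / q) < 1 / 2) :
    ∃ C : ℝ≥0∞, C ≠ ∞ ∧ ∀ (σ₁ σ₂ : ℝ) (_ : |σ₁| = 1) (g : ℝ → ℝ≥0∞) (_ : Measurable g),
      lnorm q radM (nearMax Z S σ₁ σ₂ g) ≤ C * lnorm p radM g := by
  obtain ⟨C, hC, H⟩ := lnorm_nearMax_le hβ hC₀ hC₁ hZ hSm hS hvol hp hpq hcrit hε
  have hq0 : 0 < q := by linarith
  refine ⟨4 ^ (1 / q) * C, ENNReal.mul_ne_top
    (ENNReal.rpow_ne_top_of_nonneg (by positivity) (by norm_num)) hC, fun σ₁ σ₂ hσ₁ g hg => ?_⟩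
  have hm := measurable_nearMax (Z := Z) (σ₁ := σ₁) (σ₂ := σ₂) hSm hg
  have h0 : ∀ r, r ∉ Iic (4 : ℝ) → nearMax Z S σ₁ σ₂ g r = 0 := by
    intro r hr
    refine ENNReal.tsum_eq_zero.2 fun m => indicator_of_notMem (fun hrm => hr ?_) _
    exact hS4 (hS (Nat.zero_le m) hrm)
  have e : lnorm q radM (nearMax Z S σ₁ σ₂ g) =
      lnorm q (radM.restrict (Iic 4)) (nearMax Z S σ₁ σ₂ g) := by
    unfold lnorm
    rw [← lintegral_indicator measurableSet_Iic]
    congr 2; ext r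
    by_cases hr : r ∈ Iic (4 : ℝ)
    · simp [indicator_of_mem hr]
    · simp [indicator_of_notMem hr, h0 r hr, hq0]
  rw [e, mul_assoc]
  refine (lnorm_radM_le hq0 hm measurableSet_Iic (c := 4) fun r hr => ?_).trans ?_
  · exact ENNReal.ofReal_le_of_le_toReal (by simpa using hr)
  · gcongr
    exact (lnorm_mono_measure hq0 Measure.restrict_le_self).trans (H σ₁ σ₂ hσ₁ g hg)

end RadialMaximal

namespace RadialMaximal

/-! ### Geometric sums -/

/-- Read backwards from its last term, the sum is part of a geometric series. -/
lemma sum_range_pw_le (a : ℝ) (N : ℕ) :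
    ∑ m ∈ Finset.range (N + 1), pw (a * m) ≤ (∑' n : ℕ, pw (-(a * n))) * pw (a * N) := by
  rw [← Finset.sum_range_reflect, ← ENNReal.tsum_mul_right]
  refine le_trans (Finset.sum_le_sum fun i hi => ?_) (ENNReal.sum_le_tsum (Finset.range (N + 1)))
  rw [Finset.mem_range] at hi
  rw [← pw_add]
  refine pw_mono (le_of_eq ?_)
  rw [show N + 1 - 1 - i = N - i by omega, Nat.cast_sub (by omega)]
  ring

/-- The two-sided geometric series is bounded uniformly in its centre. -/
lemma tsum_pw_abs_le {a : ℝ} (ha : 0 < a) (u : ℝ) :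
    ∑' n : ℕ, pw (-(a * |n - u|)) ≤ 2 * ∑' n : ℕ, pw (-(a * n)) := by
  -- Below `N` the terms increase and are compared with the last one; from `N` on they decrease
  -- geometrically.
  set N := ⌈u⌉₊ with hN
  set S := ∑' n : ℕ, pw (-(a * n))
  have hsplit := Summable.sum_add_tsum_nat_add' (f := fun n : ℕ => pw (-(a * |(n : ℝ) - u|)))
    (k := N) ENNReal.summable
  rw [← hsplit, two_mul]
  refine add_le_add ?_ ?_
  · rcases Nat.eq_zero_or_pos N with h0 | hpos
    · simp [h0]
    obtain ⟨M, hM⟩ : ∃ M, N = M + 1 := ⟨N - 1, by omega⟩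
    have hMu : (M : ℝ) < u := Nat.lt_ceil.1 (by omega)
    calc ∑ n ∈ Finset.range N, pw (-(a * |n - u|))
        ≤ ∑ n ∈ Finset.range (M + 1), pw (-(a * M)) * pw (a * n) := by
          rw [hM]
          refine Finset.sum_le_sum fun n hn => ?_
          rw [Finset.mem_range] at hn
          have hnM : (n : ℝ) ≤ M := by exact_mod_cast Nat.lt_succ_iff.1 hn
          rw [← pw_add]
          refine pw_mono ?_
          rw [abs_of_nonpos (by linarith)]
          nlinarith
      _ ≤ pw (-(a * M)) * (S * pw (a * M)) := by
          rw [← Finset.mul_sum]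
          exact mul_le_mul' le_rfl (sum_range_pw_le a M)
      _ = S := by
          rw [mul_left_comm, pw_neg_mul, mul_one]
  · refine ENNReal.tsum_le_tsum fun n => pw_mono ?_
    have h1 : u ≤ N := Nat.le_ceil u
    push_cast
    rw [abs_of_nonneg (by have : (0:ℝ) ≤ n := Nat.cast_nonneg n; linarith)]
    nlinarith

lemma exists_pw_eq {B : ℝ≥0∞} (h0 : B ≠ 0) (h1 : B ≠ ∞) : ∃ b, B = pw b := by
  have hpos : 0 < B.toReal := ENNReal.toReal_pos h0 h1
  refine ⟨Real.logb 2 B.toReal, ?_⟩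
  rw [← ofReal_two_rpow, Real.rpow_logb (by norm_num) (by norm_num) hpos, ENNReal.ofReal_toReal h1]

/-! ### Interpolation -/

variable {α : Type*} [MeasurableSpace α] {μ : Measure α}

lemma tsum_pw_indicator_lt_le {Λ a : ℝ} (ha : 0 < a) (hΛ : 0 < Λ) (t : ℝ≥0∞) :
    ∑' m : ℕ, {t | pw (Λ * m) < t}.indicator (fun _ => pw (a * m)) t ≤
      (∑' n : ℕ, pw (-(a * n))) * t ^ (a / Λ) := by
  rw [ENNReal.tsum_eq_iSup_nat]
  refine iSup_le fun N => ?_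
  induction N with
  | zero => simp
  | succ N ih =>
    by_cases h : pw (Λ * N) < t
    · calc _ ≤ ∑ m ∈ Finset.range (N + 1), pw (a * m) :=
            Finset.sum_le_sum fun m _ => indicator_le_self _ (fun _ => pw (a * m)) t
        _ ≤ (∑' n : ℕ, pw (-(a * n))) * pw (a * N) := sum_range_pw_le a N
        _ = (∑' n : ℕ, pw (-(a * n))) * pw (Λ * N) ^ (a / Λ) := by
            rw [pw_rpow]; congr 2; field_simp
        _ ≤ _ := mul_le_mul' le_rfl (ENNReal.rpow_le_rpow h.le (by positivity))
    · rw [Finset.sum_range_succ, indicator_of_notMem (by simpa using h), add_zero]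
      exact ih

lemma tsum_pw_indicator_ge_le {Λ a : ℝ} (ha : 0 < a) (hΛ : 0 < Λ) (t : ℝ≥0∞) :
    ∑' m : ℕ, {t | t ≤ pw (Λ * m)}.indicator (fun _ => pw (-(a * m))) t ≤
      (∑' n : ℕ, pw (-(a * n))) * t ^ (-(a / Λ)) := by
  by_cases h : ∃ m : ℕ, t ≤ pw (Λ * m)
  · classical
    set m₀ := Nat.find h
    have hm₀ : t ≤ pw (Λ * m₀) := Nat.find_spec h
    have hsupp : Function.support (fun m : ℕ =>
        {t | t ≤ pw (Λ * m)}.indicator (fun _ => pw (-(a * m))) t) ⊆ range (· + m₀) := by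
      intro m hm
      have : t ≤ pw (Λ * m) := by
        by_contra hcon
        exact hm (indicator_of_notMem (by simpa using hcon) _)
      exact ⟨m - m₀, Nat.sub_add_cancel (Nat.find_min' h this)⟩
    rw [← (add_left_injective m₀).tsum_eq hsupp]
    calc _ ≤ ∑' i : ℕ, pw (-(a * i)) * pw (-(a * m₀)) := by
          refine ENNReal.tsum_le_tsum fun i => (indicator_le_self _ _ _).trans (le_of_eq ?_)
          rw [← pw_add]; push_cast; congr 1; ring
      _ = (∑' i : ℕ, pw (-(a * i))) * pw (Λ * m₀) ^ (-(a / Λ)) := by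
          rw [ENNReal.tsum_mul_right, pw_rpow]; congr 2; field_simp
      _ ≤ _ := by
          refine mul_le_mul' le_rfl ?_
          rw [ENNReal.rpow_neg, ENNReal.rpow_neg]
          gcongr
  · push Not at h
    have : ∀ m : ℕ, {t | t ≤ pw (Λ * m)}.indicator (fun _ => pw (-(a * m))) t = 0 := fun m =>
      indicator_of_notMem (by simpa using h m) _
    simp [this]

/-- A sequence of subadditive homogeneous functionals `N m` satisfying `L^{p₀}` bounds that grow
geometrically and `L^{p₁}` bounds that decay geometrically is square-function bounded
from `L^p` to `ℓ^q` at the intermediate exponent `p`, provided that `p₁ ≤ q`. -/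
lemma tsum_rpow_le_of_geometric_bounds {N : ℕ → (α → ℝ≥0∞) → ℝ≥0∞} {A : ℝ≥0∞} (hA : A ≠ ∞)
    {p₀ p p₁ q δ η : ℝ} (hp₀ : 0 < p₀) (hp : 0 < p) (hp₁ : 0 < p₁) (hη : 0 < η) (hδ : 0 < δ)
    (h₀ : 1 / p₀ = 1 / p + η) (h₁ : 1 / p₁ = 1 / p - η) (hq : p₁ ≤ q) (hq1 : 1 ≤ q)
    (hadd : ∀ m f g, Measurable f → Measurable g → N m (fun a => f a + g a) ≤ N m f + N m g)
    (hmul : ∀ m f (c : ℝ≥0∞), c ≠ ∞ → Measurable f → N m (fun a => c * f a) ≤ c * N m f)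
    (hN₀ : ∀ m f, Measurable f → N m f ≤ A * pw (δ * m) * lnorm p₀ μ f)
    (hN₁ : ∀ m f, Measurable f → N m f ≤ A * pw (-(δ * m)) * lnorm p₁ μ f) :
    ∃ C : ℝ≥0∞, C ≠ ∞ ∧ ∀ f, Measurable f → ∑' m, N m f ^ q ≤ C * lnorm p μ f ^ q := by
  have hq0 : 0 < q := by linarith
  have e₀ : p₀ * (p * η) = p - p₀ := by field_simp at h₀; linarith
  have e₁ : p₁ * (p * η) = p₁ - p := by field_simp at h₁; linarith
  have hlt₀ : p₀ < p := by have : 0 < p₀ * (p * η) := by positivity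
                           linarith
  have hlt₁ : p < p₁ := by have : 0 < p₁ * (p * η) := by positivity
                           linarith
  -- `f` is cut at height `2^(Λm)`. For `∫ f^p = 1` this `Λ` makes the `p₀`-mass above at most
  -- `2^(-δ p₀ m)` and the `p₁`-mass below at most `2^(δ p₁ m)`, which balances the factors `2^(±
  -- δm)` of the two bounds.
  set Λ := δ / (p * η) with hΛdef
  have hΛ : 0 < Λ := by positivity
  have f₀ : Λ * (p - p₀) = δ * p₀ := by rw [← e₀, hΛdef]; field_simp
  have f₁ : Λ * (p₁ - p) = δ * p₁ := by rw [← e₁, hΛdef]; field_simp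
  set S₀ := ∑' n : ℕ, pw (-(δ * p₀ * n))
  set S₁ := ∑' n : ℕ, pw (-(δ * p₁ * n))
  have hS₀ : S₀ ≠ ∞ := (tsum_pw_lt_top (by positivity)).ne
  have hS₁ : S₁ ≠ ∞ := (tsum_pw_lt_top (by positivity)).ne
  set C := (2 : ℝ≥0∞) ^ (q - 1) * A ^ q * (S₀ + S₁) with hC
  have hCtop : C ≠ ∞ := by
    refine ENNReal.mul_ne_top (ENNReal.mul_ne_top ?_ ?_) (ENNReal.add_ne_top.2 ⟨hS₀, hS₁⟩)
    · exact ENNReal.rpow_ne_top_of_nonneg (by linarith) (by norm_num)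
    · exact ENNReal.rpow_ne_top_of_nonneg hq0.le hA
  -- the normalized case
  have key : ∀ f, Measurable f → ∫⁻ a, f a ^ p ∂μ = 1 → ∑' m, N m f ^ q ≤ C := by
    intro f hf hf1
    set X : ℕ → ℝ≥0∞ := fun m => ∫⁻ a, {a | pw (Λ * m) < f a}.indicator (fun a => f a ^ p₀) a ∂μ
    set Y : ℕ → ℝ≥0∞ := fun m => ∫⁻ a, {a | f a ≤ pw (Λ * m)}.indicator (fun a => f a ^ p₁) a ∂μ
    have hmeas₀ : ∀ m : ℕ, MeasurableSet {a | pw (Λ * m) < f a} := fun m =>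
      measurableSet_lt measurable_const hf
    have hmeas₁ : ∀ m : ℕ, MeasurableSet {a | f a ≤ pw (Λ * m)} := fun m =>
      measurableSet_le hf measurable_const
    have hX : ∀ m : ℕ, X m ≤ pw (-(δ * p₀ * m)) := by
      intro m
      calc X m ≤ ∫⁻ a, pw (-(δ * p₀ * m)) * f a ^ p ∂μ := by
            refine lintegral_mono fun a => ?_
            by_cases ha : pw (Λ * m) < f a
            · rw [indicator_of_mem (by exact ha)]
              by_cases htop : f a = ∞
              · rw [htop, ENNReal.top_rpow_of_pos hp, ENNReal.mul_top (pw_ne_zero _)]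
                exact le_top
              have hne : f a ≠ 0 := (zero_le.trans_lt ha).ne'
              calc f a ^ p₀ = f a ^ (p₀ - p) * f a ^ p := by
                    rw [← ENNReal.rpow_add _ _ hne htop]; ring_nf
                _ ≤ pw (Λ * m) ^ (p₀ - p) * f a ^ p := by
                    gcongr ?_ * _
                    rw [show p₀ - p = -(p - p₀) by ring, ENNReal.rpow_neg, ENNReal.rpow_neg]
                    gcongr
                _ = _ := by
                    rw [pw_rpow]; congr 2; rw [← f₀]; ring
            · rw [indicator_of_notMem (by exact ha)]; exact zero_le
        _ = _ := by rw [lintegral_const_mul _ (hf.pow_const _), hf1, mul_one]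
    have hY : ∀ m : ℕ, Y m ≤ pw (δ * p₁ * m) := by
      intro m
      calc Y m ≤ ∫⁻ a, pw (δ * p₁ * m) * f a ^ p ∂μ := by
            refine lintegral_mono fun a => ?_
            by_cases ha : f a ≤ pw (Λ * m)
            · rw [indicator_of_mem (by exact ha)]
              calc f a ^ p₁ = f a ^ (p₁ - p) * f a ^ p := by
                    rw [← ENNReal.rpow_add_of_nonneg _ _ (by linarith) hp.le]; ring_nf
                _ ≤ pw (Λ * m) ^ (p₁ - p) * f a ^ p := by
                    gcongr ?_ * _
                    exact ENNReal.rpow_le_rpow ha (by linarith)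
                _ = _ := by
                    rw [pw_rpow]; congr 2; rw [← f₁]; ring
            · rw [indicator_of_notMem (by exact ha)]; exact zero_le
        _ = _ := by rw [lintegral_const_mul _ (hf.pow_const _), hf1, mul_one]
    have hsplit : ∀ m : ℕ, N m f ^ q ≤ (2 : ℝ≥0∞) ^ (q - 1) * A ^ q *
        (pw (δ * p₀ * m) * X m + pw (-(δ * p₁ * m)) * Y m) := by
      intro m
      set f₀ := {a | pw (Λ * m) < f a}.indicator f
      set f₁ := {a | f a ≤ pw (Λ * m)}.indicator f
      have hf₀ : Measurable f₀ := hf.indicator (hmeas₀ m)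
      have hf₁ : Measurable f₁ := hf.indicator (hmeas₁ m)
      have hfsum : f = fun a => f₀ a + f₁ a := by
        ext a
        rcases lt_or_ge (pw (Λ * m)) (f a) with h | h
        · simp [f₀, f₁, h, h.not_ge]
        · simp [f₀, f₁, h, h.not_gt]
      have hl₀ : lnorm p₀ μ f₀ = X m ^ (1 / p₀) := by
        unfold lnorm
        congr 2; ext a
        by_cases ha : pw (Λ * m) < f a <;> simp [f₀, ha, hp₀]
      have hl₁ : lnorm p₁ μ f₁ = Y m ^ (1 / p₁) := by
        unfold lnorm
        congr 2; ext a
        by_cases ha : f a ≤ pw (Λ * m)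
        · simp [f₁, ha]
        · simp [f₁, ha, hp₁]
      have hb : N m f ≤ A * (pw (δ * m) * X m ^ (1 / p₀) + pw (-(δ * m)) * Y m ^ (1 / p₁)) := by
        calc N m f ≤ N m f₀ + N m f₁ := by
              nth_rw 1 [hfsum]; exact hadd m f₀ f₁ hf₀ hf₁
          _ ≤ _ := add_le_add (hN₀ m f₀ hf₀) (hN₁ m f₁ hf₁)
          _ = _ := by rw [hl₀, hl₁]; ring
      -- Since `p₀` and `p₁` are at most `q`, all but one power of `X m` and `Y m` can be bounded by
      -- `hX` and `hY`. The remaining power is linear, so the sum over `m` moves under the integral,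
      -- where it is geometric.
      have hpow : ∀ (Q : ℝ≥0∞) (r : ℝ), 0 < r → r ≤ q → Q ^ (q / r) = Q ^ (q / r - 1) * Q := by
        intro Q r hr hrq
        nth_rw 3 [← ENNReal.rpow_one Q]
        rw [← ENNReal.rpow_add_of_nonneg _ _ _ zero_le_one]
        · ring_nf
        · rw [sub_nonneg, le_div_iff₀ hr]; linarith
      have hterm₀ : (pw (δ * m) * X m ^ (1 / p₀)) ^ q ≤ pw (δ * p₀ * m) * X m := by
        rw [ENNReal.mul_rpow_of_nonneg _ _ hq0.le, ← ENNReal.rpow_mul,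
          show 1 / p₀ * q = q / p₀ by ring, hpow _ _ hp₀ (by linarith), ← mul_assoc, pw_rpow]
        gcongr
        calc _ ≤ pw (δ * m * q) * pw (-(δ * p₀ * m)) ^ (q / p₀ - 1) := by
              gcongr
              · rw [sub_nonneg, le_div_iff₀ hp₀]; linarith
              · exact hX m
          _ = _ := by
              rw [pw_rpow, ← pw_add]; congr 1; field_simp; ring
      have hterm₁ : (pw (-(δ * m)) * Y m ^ (1 / p₁)) ^ q ≤ pw (-(δ * p₁ * m)) * Y m := by
        rw [ENNReal.mul_rpow_of_nonneg _ _ hq0.le, ← ENNReal.rpow_mul,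
          show 1 / p₁ * q = q / p₁ by ring, hpow _ _ hp₁ hq, ← mul_assoc, pw_rpow]
        gcongr
        calc _ ≤ pw (-(δ * m) * q) * pw (δ * p₁ * m) ^ (q / p₁ - 1) := by
              gcongr
              · rw [sub_nonneg, le_div_iff₀ hp₁]; linarith
              · exact hY m
          _ = _ := by
              rw [pw_rpow, ← pw_add]; congr 1; field_simp; ring
      calc N m f ^ q ≤ (A * (pw (δ * m) * X m ^ (1 / p₀) + pw (-(δ * m)) * Y m ^ (1 / p₁))) ^ q := by
            gcongr
        _ = A ^ q * (pw (δ * m) * X m ^ (1 / p₀) + pw (-(δ * m)) * Y m ^ (1 / p₁)) ^ q :=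
            ENNReal.mul_rpow_of_nonneg _ _ hq0.le
        _ ≤ A ^ q * ((2 : ℝ≥0∞) ^ (q - 1) * ((pw (δ * m) * X m ^ (1 / p₀)) ^ q +
              (pw (-(δ * m)) * Y m ^ (1 / p₁)) ^ q)) := by
            gcongr
            exact ENNReal.rpow_add_le_mul_rpow_add_rpow _ _ hq1
        _ ≤ A ^ q * ((2 : ℝ≥0∞) ^ (q - 1) * (pw (δ * p₀ * m) * X m + pw (-(δ * p₁ * m)) * Y m)) := by
            gcongr
        _ = _ := by ring
    have hsumX : ∑' m : ℕ, pw (δ * p₀ * m) * X m ≤ S₀ := by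
      have e : ∀ m : ℕ, pw (δ * p₀ * m) * X m = ∫⁻ a, f a ^ p₀ *
          {t | pw (Λ * m) < t}.indicator (fun _ => pw (δ * p₀ * m)) (f a) ∂μ := by
        intro m
        rw [← lintegral_const_mul _ ((hf.pow_const _).indicator (hmeas₀ m))]
        congr 1; ext a
        by_cases ha : pw (Λ * m) < f a <;> simp [ha, mul_comm]
      simp_rw [e]
      have hm : ∀ m : ℕ, Measurable fun a => f a ^ p₀ *
          {t | pw (Λ * m) < t}.indicator (fun _ => pw (δ * p₀ * m)) (f a) := fun m =>
        (hf.pow_const _).mul ((measurable_const.indicator measurableSet_Ioi).comp hf)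
      rw [← lintegral_tsum fun m => (hm m).aemeasurable]
      calc _ ≤ ∫⁻ a, S₀ * f a ^ p ∂μ := by
            refine lintegral_mono fun a => ?_
            rw [ENNReal.tsum_mul_left]
            calc _ ≤ f a ^ p₀ * (S₀ * f a ^ (δ * p₀ / Λ)) := by
                  gcongr
                  exact tsum_pw_indicator_lt_le (by positivity) hΛ _
              _ = S₀ * f a ^ p := by
                  rw [← f₀, mul_div_cancel_left₀ _ hΛ.ne', mul_left_comm,
                    ← ENNReal.rpow_add_of_nonneg _ _ hp₀.le (by linarith)]
                  ring_nf
        _ = S₀ := by rw [lintegral_const_mul _ (hf.pow_const _), hf1, mul_one]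
    have hsumY : ∑' m : ℕ, pw (-(δ * p₁ * m)) * Y m ≤ S₁ := by
      have e : ∀ m : ℕ, pw (-(δ * p₁ * m)) * Y m = ∫⁻ a, f a ^ p₁ *
          {t | t ≤ pw (Λ * m)}.indicator (fun _ => pw (-(δ * p₁ * m))) (f a) ∂μ := by
        intro m
        rw [← lintegral_const_mul _ ((hf.pow_const _).indicator (hmeas₁ m))]
        congr 1; ext a
        by_cases ha : f a ≤ pw (Λ * m)
        · simp [ha, mul_comm]
        · simp [ha]
      simp_rw [e]
      have hm : ∀ m : ℕ, Measurable fun a => f a ^ p₁ *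
          {t | t ≤ pw (Λ * m)}.indicator (fun _ => pw (-(δ * p₁ * m))) (f a) := fun m =>
        (hf.pow_const _).mul ((measurable_const.indicator measurableSet_Iic).comp hf)
      rw [← lintegral_tsum fun m => (hm m).aemeasurable]
      calc _ ≤ ∫⁻ a, S₁ * f a ^ p ∂μ := by
            refine lintegral_mono_ae ?_
            have hfin : ∀ᵐ a ∂μ, f a ^ p < ∞ :=
              ae_lt_top (hf.pow_const _) (by rw [hf1]; norm_num)
            filter_upwards [hfin] with a ha
            rw [ENNReal.tsum_mul_left]
            by_cases h0 : f a = 0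
            · simp [h0, hp₁]
            have htop : f a ≠ ∞ := fun h => by
              rw [h, ENNReal.top_rpow_of_pos hp] at ha; exact lt_irrefl _ ha
            calc _ ≤ f a ^ p₁ * (S₁ * f a ^ (-(δ * p₁ / Λ))) := by
                  gcongr
                  exact tsum_pw_indicator_ge_le (by positivity) hΛ _
              _ = S₁ * f a ^ p := by
                  rw [← f₁, mul_div_cancel_left₀ _ hΛ.ne', mul_left_comm,
                    ← ENNReal.rpow_add _ _ h0 htop]
                  ring_nf
        _ = S₁ := by rw [lintegral_const_mul _ (hf.pow_const _), hf1, mul_one]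
    calc ∑' m, N m f ^ q ≤ ∑' m : ℕ, (2 : ℝ≥0∞) ^ (q - 1) * A ^ q *
          (pw (δ * p₀ * m) * X m + pw (-(δ * p₁ * m)) * Y m) := ENNReal.tsum_le_tsum hsplit
      _ = (2 : ℝ≥0∞) ^ (q - 1) * A ^ q * (∑' m : ℕ, pw (δ * p₀ * m) * X m +
          ∑' m : ℕ, pw (-(δ * p₁ * m)) * Y m) := by
          rw [ENNReal.tsum_mul_left, ENNReal.tsum_add]
      _ ≤ C := by
          rw [hC]
          gcongr
  -- Adding 1 makes the constant nonzero, so that the bound is trivial when the norm of `f` is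
  -- infinite.
  refine ⟨C + 1, ENNReal.add_ne_top.2 ⟨hCtop, by norm_num⟩, fun f hf => ?_⟩
  set L := lnorm p μ f with hL
  by_cases hLtop : L = ∞
  · rw [hLtop, ENNReal.top_rpow_of_pos hq0, ENNReal.mul_top (by simp)]
    exact le_top
  by_cases hL0 : L = 0
  · have hz : ∀ᵐ a ∂μ, f a = 0 := by
      have h1 : ∫⁻ a, f a ^ p ∂μ = 0 := by
        rw [← lnorm_rpow hp, ← hL, hL0, ENNReal.zero_rpow_of_pos hp]
      rw [lintegral_eq_zero_iff (hf.pow_const _)] at h1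
      filter_upwards [h1] with a ha
      simpa [hp, hp.not_gt] using ha
    have hz₀ : lnorm p₀ μ f = 0 := by
      rw [← le_zero_iff, ← lnorm_zero (μ := μ) hp₀]
      exact lnorm_mono_ae hp₀ (hz.mono fun a ha => ha.le)
    have : ∀ m, N m f ^ q = 0 := by
      intro m
      have := hN₀ m f hf
      rw [hz₀, mul_zero, nonpos_iff_eq_zero] at this
      rw [this, ENNReal.zero_rpow_of_pos hq0]
    simp [this]
  have hfL : f = fun a => L * (L⁻¹ * f a) := by
    ext a
    rw [← mul_assoc, ENNReal.mul_inv_cancel hL0 hLtop, one_mul]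
  have h1 := key (fun a => L⁻¹ * f a) (hf.const_mul _) (by
    rw [← lnorm_rpow hp, lnorm_const_mul hp _ hf, ← hL, ENNReal.inv_mul_cancel hL0 hLtop,
      ENNReal.one_rpow])
  calc ∑' m, N m f ^ q ≤ ∑' m, L ^ q * N m (fun a => L⁻¹ * f a) ^ q := by
        refine ENNReal.tsum_le_tsum fun m => ?_
        rw [← ENNReal.mul_rpow_of_nonneg _ _ hq0.le]
        refine ENNReal.rpow_le_rpow ?_ hq0.le
        nth_rw 1 [hfL]
        exact hmul m _ L hLtop (hf.const_mul _)
    _ ≤ L ^ q * C := by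
        rw [ENNReal.tsum_mul_left]; gcongr
    _ ≤ (C + 1) * L ^ q := by
        rw [mul_comm]; gcongr; exact le_self_add

end RadialMaximal

namespace RadialMaximal

/-! ### The part of the maximal function near the origin -/

/-- One dyadic piece of `smallMax`. -/
noncomputable def smallPiece (Z : ℕ → Finset ℤ) (σ : ℝ) (h : ℝ → ℝ≥0∞) (m n : ℕ) (r : ℝ) : ℝ≥0∞ :=
  pw (m + n / 2) * vmax (Z (m + n)) σ 1 (m + n) h r

/-- The maximal function at the radii near the origin. -/
noncomputable def smallMax (Z : ℕ → Finset ℤ) (σ : ℝ) (h : ℝ → ℝ≥0∞) (r : ℝ) : ℝ≥0∞ :=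
  ∑' m : ℕ, (dyadicIco m).indicator (fun r => ∑' n : ℕ, smallPiece Z σ h m n r) r

/-- The exponent of the `L^p → L^q` bound for `smallPiece`, where `x = 1 / p` and `y = 1 / q`. -/
noncomputable def smallExp (β γ x y : ℝ) (m n : ℕ) : ℝ :=
  m * (x - 2 * y) + n * (x - y - 1 / 2) + y * min (β * (m + n)) (γ * n)

variable {Z : ℕ → Finset ℤ} {β γ : ℝ} {C₀ : ℝ≥0∞} {p q σ : ℝ} {h : ℝ → ℝ≥0∞}

lemma measurable_smallPiece (hh : Measurable h) (m n : ℕ) : Measurable (smallPiece Z σ h m n) :=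
  (measurable_vmax _ _ _ _ hh).const_mul _

lemma measurable_smallMax (hh : Measurable h) : Measurable (smallMax Z σ h) :=
  Measurable.tsum fun m => (Measurable.tsum fun n => measurable_smallPiece hh m n).indicator
    (measurableSet_dyadicIco m)

/-- The weight `r ≤ 2^(-m)` gives `2^(-m/q)`. The grid points are counted either all together, or
only near a given input: as `r ≤ 2^(-m)`, the averaging interval stays within `(5 + 1)/2^m` of its
grid point. The better count produces the minimum in `smallExp`. -/
lemma lnorm_smallPiece_le (hC₀ : 1 ≤ C₀)
    (hZ : ∀ k, ((Z k).card : ℝ≥0∞) ≤ C₀ * pw (β * k))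
    (hZ' : ∀ (m n : ℕ) (s : ℝ), ∑ j ∈ Z (m + n),
      {s : ℝ | |s - (j : ℝ) / 2 ^ (m + n)| ≤ 6 / 2 ^ m}.indicator 1 s ≤ C₀ * pw (γ * n))
    (hσ : |σ| = 1) (hp : 1 ≤ p) (hpq : p ≤ q) (hh : Measurable h) (m n : ℕ) :
    lnorm q (radM.restrict (dyadicIco m)) (smallPiece Z σ h m n) ≤
      10 * C₀ * pw (smallExp β γ (1 / p) (1 / q) m n) * lnorm p volume h := by
  have hq0 : 0 < q := by linarith
  have hy1 : 1 / q ≤ 1 := by rw [div_le_one hq0]; linarith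
  have hCy : C₀ ^ (1 / q) ≤ C₀ := by
    nth_rw 2 [← ENNReal.rpow_one C₀]
    exact ENNReal.rpow_le_rpow_of_exponent_le hC₀ hy1
  have hv := measurable_vmax (Z (m + n)) σ 1 (m + n) hh
  have hvmax : lnorm q (volume.restrict (dyadicIco m)) (vmax (Z (m + n)) σ 1 (m + n) h) ≤
      10 * (C₀ * pw (min (β * (m + n)) (γ * n))) ^ (1 / q) *
        pw (-((m + n : ℕ) * (1 + 1 / q - 1 / p))) * lnorm p volume h := by
    rcases min_choice (β * ((m : ℝ) + n)) (γ * n) with hm | hm <;> rw [hm]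
    · refine lnorm_vmax_le _ 1 hσ _ hh hp hpq (measurableSet_dyadicIco m) (fun _ => univ)
        (fun _ => MeasurableSet.univ) (fun _ _ _ _ => subset_univ _) (fun s => ?_)
      simpa using hZ (m + n)
    · refine lnorm_vmax_le _ 1 hσ _ hh hp hpq (measurableSet_dyadicIco m)
        (fun j => {s : ℝ | |s - (j : ℝ) / 2 ^ (m + n)| ≤ 6 / 2 ^ m})
        (fun j => ?_) (fun j _ r hr s hs => ?_) (fun s => hZ' m n s)
      · exact measurableSet_le (by fun_prop) measurable_const
      · have h1 : (5 : ℝ) / 2 ^ (m + n) ≤ 5 / 2 ^ m := by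
          gcongr
          · norm_num
          · omega
        have h2 : |σ * r| ≤ 1 / 2 ^ m := by
          have h0 : (0 : ℝ) ≤ r := le_trans (by positivity) hr.1
          rw [abs_mul, hσ, one_mul, abs_of_nonneg h0]; exact hr.2.le
        have h3 : (6 : ℝ) / 2 ^ m = 5 / 2 ^ m + 1 / 2 ^ m := by ring
        have := abs_le.1 h2
        rw [mem_ofPred_eq, abs_le]
        constructor <;> linarith [hs.1, hs.2]
  have hmeas : Measurable (smallPiece Z σ h m n) := measurable_smallPiece hh m n
  calc lnorm q (radM.restrict (dyadicIco m)) (smallPiece Z σ h m n)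
      ≤ pw (-m) ^ (1 / q) * lnorm q (volume.restrict (dyadicIco m)) (smallPiece Z σ h m n) := by
        refine lnorm_radM_le hq0 hmeas (measurableSet_dyadicIco m) fun r hr => ?_
        rw [← ofReal_two_rpow, Real.rpow_neg (by norm_num), Real.rpow_natCast, ← one_div]
        exact ENNReal.ofReal_le_ofReal hr.2.le
    _ = pw (-m * (1 / q)) * (pw (m + n / 2) *
          lnorm q (volume.restrict (dyadicIco m)) (vmax (Z (m + n)) σ 1 (m + n) h)) := by
        rw [pw_rpow, ← lnorm_const_mul hq0 _ hv]; rfl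
    _ ≤ pw (-m * (1 / q)) * (pw (m + n / 2) *
          (10 * (C₀ * pw (min (β * (m + n)) (γ * n))) ^ (1 / q) *
        pw (-((m + n : ℕ) * (1 + 1 / q - 1 / p))) * lnorm p volume h)) := by gcongr
    _ = 10 * C₀ ^ (1 / q) * (pw (-m * (1 / q)) * pw (m + n / 2) *
          pw (min (β * (m + n)) (γ * n) * (1 / q)) *
          pw (-((m + n : ℕ) * (1 + 1 / q - 1 / p)))) * lnorm p volume h := by
        rw [ENNReal.mul_rpow_of_nonneg _ _ (by positivity), pw_rpow]; ring
    _ ≤ _ := by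
        rw [← pw_add, ← pw_add, ← pw_add]
        gcongr
        refine pw_mono (le_of_eq ?_)
        unfold smallExp
        push_cast
        ring

lemma lnorm_radM_smallMax_rpow (hq : 0 < q) (hh : Measurable h) :
    lnorm q radM (smallMax Z σ h) ^ q = ∑' m, lnorm q (radM.restrict (dyadicIco m))
      (fun r => ∑' n : ℕ, smallPiece Z σ h m n r) ^ q := by
  rw [lnorm_rpow hq]
  unfold smallMax
  rw [lintegral_tsum_indicator_rpow hq measurableSet_dyadicIco pairwise_disjoint_dyadicIco
    fun m => Measurable.tsum fun n => measurable_smallPiece hh m n]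
  simp_rw [lnorm_rpow hq]

lemma lnorm_smallMax_le_of_le (hC₀ : 1 ≤ C₀) (hC₀' : C₀ ≠ ∞)
    (hZ : ∀ k, ((Z k).card : ℝ≥0∞) ≤ C₀ * pw (β * k))
    (hZ' : ∀ (m n : ℕ) (s : ℝ), ∑ j ∈ Z (m + n),
      {s : ℝ | |s - (j : ℝ) / 2 ^ (m + n)| ≤ 6 / 2 ^ m}.indicator 1 s ≤ C₀ * pw (γ * n))
    (hp : 1 ≤ p) (hpq : p ≤ q) {ε : ℝ} (hε : 0 < ε)
    (hexp : ∀ m n : ℕ, smallExp β γ (1 / p) (1 / q) m n ≤ -(ε * (m + n))) :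
    ∃ C : ℝ≥0∞, C ≠ ∞ ∧ ∀ (σ : ℝ) (_ : |σ| = 1) (h : ℝ → ℝ≥0∞) (_ : Measurable h),
      lnorm q radM (smallMax Z σ h) ≤ C * lnorm p volume h := by
  have hq0 : 0 < q := by linarith
  have hq1 : 1 ≤ q := by linarith
  set S := ∑' n : ℕ, pw (-(ε * n))
  have hS : S ≠ ∞ := (tsum_pw_lt_top hε).ne
  refine ⟨10 * C₀ * S * S, ENNReal.mul_ne_top (ENNReal.mul_ne_top
    (ENNReal.mul_ne_top (by norm_num) hC₀') hS) hS, fun σ hσ h hh => ?_⟩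
  rw [← ENNReal.rpow_le_rpow_iff hq0, lnorm_radM_smallMax_rpow hq0 hh]
  refine (tsum_rpow_le_rpow_tsum hq1 _).trans ?_
  gcongr
  calc _ ≤ ∑' m : ℕ, ∑' n : ℕ, lnorm q (radM.restrict (dyadicIco m)) (smallPiece Z σ h m n) :=
        ENNReal.tsum_le_tsum fun m => lnorm_tsum_le hq1 fun n => measurable_smallPiece hh m n
    _ ≤ ∑' m : ℕ, ∑' n : ℕ, 10 * C₀ * (pw (-(ε * m)) * pw (-(ε * n))) * lnorm p volume h := by
        refine ENNReal.tsum_le_tsum fun m => ENNReal.tsum_le_tsum fun n => ?_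
        refine (lnorm_smallPiece_le hC₀ hZ hZ' hσ hp hpq hh m n).trans ?_
        rw [← pw_add]
        gcongr
        exact pw_mono ((hexp m n).trans_eq (by ring))
    _ = _ := by
        simp_rw [ENNReal.tsum_mul_right, ENNReal.tsum_mul_left, ENNReal.tsum_mul_right]
        ring

lemma vmax_add_le (Z : Finset ℤ) (σ₁ σ₂ : ℝ) (k : ℕ) {f g : ℝ → ℝ≥0∞} (hf : Measurable f) (r : ℝ) :
    vmax Z σ₁ σ₂ k (fun a => f a + g a) r ≤ vmax Z σ₁ σ₂ k f r + vmax Z σ₁ σ₂ k g r := by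
  refine iSup₂_le fun j hj => ?_
  rw [avg, lintegral_add_left hf]
  exact add_le_add (le_iSup₂_of_le j hj le_rfl) (le_iSup₂_of_le j hj le_rfl)

lemma vmax_const_mul (Z : Finset ℤ) (σ₁ σ₂ : ℝ) (k : ℕ) {f : ℝ → ℝ≥0∞} (hf : Measurable f)
    (c : ℝ≥0∞) (r : ℝ) :
    vmax Z σ₁ σ₂ k (fun a => c * f a) r = c * vmax Z σ₁ σ₂ k f r := by
  simp_rw [vmax, ENNReal.mul_iSup, avg, lintegral_const_mul _ hf]

/-- `smallExp` is affine in `1/p` with slope `m + n`. Moving `1/p` by `η` adds `η(κ+1)m + η(n -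
κm)`. Half of the decay off the ray absorbs the second term; the first is growth or decay in `m`
according to the sign of `η`. -/
lemma lnorm_tsum_smallPiece_le (hC₀ : 1 ≤ C₀)
    (hZ : ∀ k, ((Z k).card : ℝ≥0∞) ≤ C₀ * pw (β * k))
    (hZ' : ∀ (m n : ℕ) (s : ℝ), ∑ j ∈ Z (m + n),
      {s : ℝ | |s - (j : ℝ) / 2 ^ (m + n)| ≤ 6 / 2 ^ m}.indicator 1 s ≤ C₀ * pw (γ * n))
    (hσ : |σ| = 1) {p' : ℝ} (hp' : 1 ≤ p') (hpq' : p' ≤ q) {ε κ η : ℝ} (hε : 0 < ε)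
    (hη : |η| ≤ ε / 2) (hpp : 1 / p' = 1 / p + η)
    (hexp : ∀ m n : ℕ, smallExp β γ (1 / p) (1 / q) m n ≤ -(ε * |(n : ℝ) - κ * m|))
    (hh : Measurable h) (m : ℕ) :
    lnorm q (radM.restrict (dyadicIco m)) (fun r => ∑' n : ℕ, smallPiece Z σ h m n r) ≤
      10 * C₀ * (2 * ∑' n : ℕ, pw (-(ε / 2 * n))) * pw (η * (κ + 1) * m) * lnorm p' volume h := by
  have hq1 : 1 ≤ q := by linarith
  refine (lnorm_tsum_le hq1 fun n => measurable_smallPiece hh m n).trans ?_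
  calc _ ≤ ∑' n : ℕ, 10 * C₀ * (pw (-(ε / 2 * |(n : ℝ) - κ * m|)) * pw (η * (κ + 1) * m)) *
          lnorm p' volume h := by
        refine ENNReal.tsum_le_tsum fun n => ?_
        refine (lnorm_smallPiece_le hC₀ hZ hZ' hσ hp' hpq' hh m n).trans ?_
        rw [← pw_add]
        gcongr
        refine pw_mono ?_
        have e : smallExp β γ (1 / p') (1 / q) m n =
            smallExp β γ (1 / p) (1 / q) m n + η * (m + n) := by
          rw [hpp]; unfold smallExp; ring
        have h1 : η * (n - κ * m) ≤ ε / 2 * |(n : ℝ) - κ * m| :=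
          calc η * (n - κ * m) ≤ |η * (n - κ * m)| := le_abs_self _
            _ = |η| * |(n : ℝ) - κ * m| := abs_mul _ _
            _ ≤ _ := by gcongr
        rw [e]
        linarith [hexp m n]
    _ = 10 * C₀ * ((∑' n : ℕ, pw (-(ε / 2 * |(n : ℝ) - κ * m|))) * pw (η * (κ + 1) * m)) *
          lnorm p' volume h := by
        simp_rw [ENNReal.tsum_mul_right, ENNReal.tsum_mul_left, ENNReal.tsum_mul_right]
    _ ≤ 10 * C₀ * ((2 * ∑' n : ℕ, pw (-(ε / 2 * n))) * pw (η * (κ + 1) * m)) *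
          lnorm p' volume h := by
        gcongr
        exact tsum_pw_abs_le (by positivity) _
    _ = _ := by ring

/-- There need be no decay along the ray, and all `m` act on the same `h`, so no orthogonality of
the inputs helps. Perturbing `p` in both directions at fixed `q` gives growth and decay in `m`,
between which `tsum_rpow_le_of_geometric_bounds` interpolates. The strict inequalities `1 < p < q`
leave room for both perturbed exponents in `[1, q]`. -/
lemma lnorm_smallMax_le_of_ray (hC₀ : 1 ≤ C₀) (hC₀' : C₀ ≠ ∞)
    (hZ : ∀ k, ((Z k).card : ℝ≥0∞) ≤ C₀ * pw (β * k))
    (hZ' : ∀ (m n : ℕ) (s : ℝ), ∑ j ∈ Z (m + n),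
      {s : ℝ | |s - (j : ℝ) / 2 ^ (m + n)| ≤ 6 / 2 ^ m}.indicator 1 s ≤ C₀ * pw (γ * n))
    (hp : 1 < p) (hpq : p < q) {ε κ : ℝ} (hε : 0 < ε) (hκ : 0 ≤ κ)
    (hexp : ∀ m n : ℕ, smallExp β γ (1 / p) (1 / q) m n ≤ -(ε * |(n : ℝ) - κ * m|)) :
    ∃ C : ℝ≥0∞, C ≠ ∞ ∧ ∀ (σ : ℝ) (_ : |σ| = 1) (h : ℝ → ℝ≥0∞) (_ : Measurable h),
      lnorm q radM (smallMax Z σ h) ≤ C * lnorm p volume h := by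
  have hp0 : 0 < p := by linarith
  have hq0 : 0 < q := by linarith
  have hq1 : 1 ≤ q := by linarith
  have hx1 : 1 / p < 1 := by rw [div_lt_one hp0]; exact hp
  have hxy : 1 / q < 1 / p := one_div_lt_one_div_of_lt hp0 hpq
  have hy0 : 0 < 1 / q := by positivity
  set η := min (ε / 2) (min (1 - 1 / p) (1 / p - 1 / q)) with hη
  have hη0 : 0 < η := lt_min (by positivity) (lt_min (by linarith) (by linarith))
  have hη1 : η ≤ ε / 2 := min_le_left _ _
  have hη2 : η ≤ 1 - 1 / p := (min_le_right _ _).trans (min_le_left _ _)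
  have hη3 : η ≤ 1 / p - 1 / q := (min_le_right _ _).trans (min_le_right _ _)
  set p₀ := 1 / (1 / p + η) with hp₀
  set p₁ := 1 / (1 / p - η) with hp₁
  have hx0 : 0 < 1 / p := by positivity
  have i₀ : 1 / p₀ = 1 / p + η := by rw [hp₀, one_div_one_div]
  have i₁ : 1 / p₁ = 1 / p - η := by rw [hp₁, one_div_one_div]
  have hp₀1 : 1 ≤ p₀ := by rw [hp₀, le_div_iff₀ (by linarith)]; linarith
  have hp₁q : p₁ ≤ q := by
    have := one_div_le_one_div_of_le hy0 (show 1 / q ≤ 1 / p - η by linarith)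
    rwa [one_div_one_div] at this
  have hp₁1 : 1 ≤ p₁ := by rw [hp₁, le_div_iff₀ (by linarith)]; linarith
  have hp₀q : p₀ ≤ q := by
    have := one_div_le_one_div_of_le hy0 (show 1 / q ≤ 1 / p + η by linarith)
    rwa [one_div_one_div] at this
  set A := 10 * C₀ * (2 * ∑' n : ℕ, pw (-(ε / 2 * n)))
  have hA : A ≠ ∞ := ENNReal.mul_ne_top (ENNReal.mul_ne_top (by norm_num) hC₀')
    (ENNReal.mul_ne_top (by norm_num) (tsum_pw_lt_top (by positivity)).ne)
  have main : ∀ σ : ℝ, |σ| = 1 → ∃ C : ℝ≥0∞, C ≠ ∞ ∧ ∀ h : ℝ → ℝ≥0∞, Measurable h →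
      ∑' m, lnorm q (radM.restrict (dyadicIco m)) (fun r => ∑' n : ℕ, smallPiece Z σ h m n r) ^ q
        ≤ C * lnorm p volume h ^ q := by
    intro σ hσ
    refine tsum_rpow_le_of_geometric_bounds (A := A) (δ := η * (κ + 1)) (η := η) hA
      (by linarith) hp0 (by linarith) hη0 (by positivity) i₀ i₁ hp₁q hq1 ?_ ?_ ?_ ?_
    · intro m f g hf hg
      refine le_trans (lnorm_mono hq0 fun r => ?_) (lnorm_add_le hq1
        (Measurable.tsum fun n => measurable_smallPiece hf m n)
        (Measurable.tsum fun n => measurable_smallPiece hg m n))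
      rw [← ENNReal.tsum_add]
      refine ENNReal.tsum_le_tsum fun n => ?_
      unfold smallPiece
      rw [← mul_add]
      gcongr
      exact vmax_add_le _ _ _ _ hf _
    · intro m f c _ hf
      rw [← lnorm_const_mul hq0 _ (Measurable.tsum fun n => measurable_smallPiece hf m n)]
      refine lnorm_mono hq0 fun r => ?_
      rw [← ENNReal.tsum_mul_left]
      refine ENNReal.tsum_le_tsum fun n => ?_
      unfold smallPiece
      rw [vmax_const_mul _ _ _ _ hf, mul_left_comm]
    · intro m f hf
      exact lnorm_tsum_smallPiece_le hC₀ hZ hZ' hσ hp₀1 hp₀q hε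
        (by rwa [abs_of_pos hη0]) i₀ hexp hf m
    · intro m f hf
      have := lnorm_tsum_smallPiece_le hC₀ hZ hZ' hσ hp₁1 hp₁q hε (η := -η)
        (by rwa [abs_neg, abs_of_pos hη0]) (by rw [i₁]; ring) hexp hf m
      simpa only [neg_mul] using this
  obtain ⟨C, hC, H⟩ := main 1 (by simp)
  obtain ⟨C', hC', H'⟩ := main (-1) (by simp)
  refine ⟨(C + C') ^ (1 / q), ENNReal.rpow_ne_top_of_nonneg (by positivity)
    (ENNReal.add_ne_top.2 ⟨hC, hC'⟩), fun σ hσ h hh => ?_⟩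
  rw [← ENNReal.rpow_le_rpow_iff hq0, lnorm_radM_smallMax_rpow hq0 hh,
    ENNReal.mul_rpow_of_nonneg _ _ hq0.le, ← ENNReal.rpow_mul, one_div_mul_cancel hq0.ne',
    ENNReal.rpow_one]
  rcases (abs_eq zero_le_one).1 hσ with rfl | rfl
  · refine (H h hh).trans ?_
    gcongr
    exact le_self_add
  · refine (H' h hh).trans ?_
    gcongr
    exact le_add_self

/-! ### The restricted weak type endpoint -/

lemma exists_sign_mul_eq_neg_abs (η u : ℝ) : ∃ a, |a| = |η| ∧ a * u = -(|η| * |u|) := by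
  rcases le_total 0 u with h | h
  · exact ⟨-|η|, by simp, by rw [abs_of_nonneg h]; ring⟩
  · exact ⟨|η|, by simp, by rw [abs_of_nonpos h]; ring⟩

/-- By `h1` and `h2` the exponent coming from the Assouad count vanishes for all `m` and `n`. With
`|F| = 2^f` and `|G| = 2^g`, the piece is tested against `G` by Hölder at `1/p' = x + a`, `1/q' = y
- b`, where `|a| = |b| = η`. This changes the exponent by `a(m+n+f) + b(2m + (1-γ)n + g)`, and the
signs of `a` and `b` are chosen to make both terms nonpositive. -/
lemma setLIntegral_smallPiece_le (hC₀ : 1 ≤ C₀)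
    (hZ : ∀ k, ((Z k).card : ℝ≥0∞) ≤ C₀ * pw (β * k))
    (hZ' : ∀ (m n : ℕ) (s : ℝ), ∑ j ∈ Z (m + n),
      {s : ℝ | |s - (j : ℝ) / 2 ^ (m + n)| ≤ 6 / 2 ^ m}.indicator 1 s ≤ C₀ * pw (γ * n))
    {x y η : ℝ} (hη : 0 < η) (hη1 : η ≤ 1 - x) (hη2 : 4 * η ≤ y)
    (h1 : x = 2 * y) (h2 : x - (1 - γ) * y = 1 / 2)
    (hσ : |σ| = 1) {F G : Set ℝ} (hF : MeasurableSet F) {f g : ℝ}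
    (hFf : volume F = pw f) (hGg : radM G = pw g) (m n : ℕ) :
    ∫⁻ r in dyadicIco m ∩ G, smallPiece Z σ (F.indicator 1) m n r ∂radM ≤
      10 * C₀ * (pw (-(η * |((m + n : ℕ) : ℝ) + f|)) *
        pw (-(η * |(1 + γ) * m + ((1 - γ) * (m + n : ℕ) + g)|))) *
        (volume F ^ x * radM G ^ (1 - y)) := by
  obtain ⟨a, ha, ha'⟩ := exists_sign_mul_eq_neg_abs η (((m + n : ℕ) : ℝ) + f)
  obtain ⟨b, hb, hb'⟩ := exists_sign_mul_eq_neg_abs η ((1 + γ) * m + ((1 - γ) * (m + n : ℕ) + g))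
  rw [abs_of_pos hη] at ha ha' hb hb'
  have ha1 := abs_le.1 ha.le
  have hb1 := abs_le.1 hb.le
  set p' := 1 / (x + a) with hp'
  set q' := 1 / (y - b) with hq'
  have i₀ : 1 / p' = x + a := by rw [hp', one_div_one_div]
  have i₁ : 1 / q' = y - b := by rw [hq', one_div_one_div]
  have hp'1 : 1 ≤ p' := by rw [hp', le_div_iff₀ (by linarith)]; linarith
  have hpq' : p' ≤ q' := one_div_le_one_div_of_le (by linarith) (by linarith)
  have hind : Measurable (F.indicator (1 : ℝ → ℝ≥0∞)) := measurable_one.indicator hF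
  have hmeas := measurable_smallPiece (Z := Z) (σ := σ) hind m n
  have hlF : lnorm p' volume (F.indicator 1) = volume F ^ (1 / p') := by
    unfold lnorm
    rw [← lintegral_indicator_one hF]
    congr 2
    ext s
    by_cases hs : s ∈ F
    · simp [hs]
    · simp [hs]; linarith
  calc ∫⁻ r in dyadicIco m ∩ G, smallPiece Z σ (F.indicator 1) m n r ∂radM
      = ∫⁻ r in G, smallPiece Z σ (F.indicator 1) m n r ∂(radM.restrict (dyadicIco m)) := by
        rw [Measure.restrict_restrict₀' (measurableSet_dyadicIco m).nullMeasurableSet, inter_comm]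
    _ ≤ (radM.restrict (dyadicIco m)) G ^ (1 - 1 / q') *
          lnorm q' ((radM.restrict (dyadicIco m)).restrict G)
            (smallPiece Z σ (F.indicator 1) m n) :=
        setLIntegral_le_measure_mul_lnorm (hp'1.trans hpq') hmeas G
    _ ≤ radM G ^ (1 - 1 / q') * (10 * C₀ * pw (smallExp β γ (1 / p') (1 / q') m n) *
          volume F ^ (1 / p')) := by
        refine mul_le_mul' (ENNReal.rpow_le_rpow (Measure.restrict_le_self _) ?_) ?_
        · rw [i₁]; linarith
        · rw [← hlF]
          exact (lnorm_mono_measure (by linarith) Measure.restrict_le_self).trans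
            (lnorm_smallPiece_le hC₀ hZ hZ' hσ hp'1 hpq' hind m n)
    _ = 10 * C₀ * (pw (g * (1 - 1 / q')) * pw (smallExp β γ (1 / p') (1 / q') m n) *
          pw (f * (1 / p'))) := by
        rw [hFf, hGg, pw_rpow, pw_rpow]; ring
    _ ≤ 10 * C₀ * (pw (-(η * |((m + n : ℕ) : ℝ) + f|)) *
        pw (-(η * |(1 + γ) * m + ((1 - γ) * (m + n : ℕ) + g)|)) *
        pw (f * x) * pw (g * (1 - y))) := by
        refine mul_le_mul' le_rfl ?_
        simp_rw [← pw_add]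
        refine pw_mono ?_
        rw [← ha', ← hb', i₀, i₁]
        unfold smallExp
        have hmin : (y - b) * min (β * ((m : ℝ) + n)) (γ * n) ≤ (y - b) * (γ * n) :=
          mul_le_mul_of_nonneg_left (min_le_right _ _) (by linarith)
        push_cast
        have e1 : (m : ℝ) * (x + a - 2 * (y - b)) = m * (a + 2 * b) := by rw [h1]; ring
        have e2 : (n : ℝ) * (x + a - (y - b) - 1 / 2) + (y - b) * (γ * n) =
            n * (a + (1 - γ) * b) := by rw [← h2]; ring
        nlinarith [hmin, e1, e2]
    _ = _ := by
        rw [hFf, hGg, pw_rpow, pw_rpow]; ring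

lemma setLIntegral_smallMax_indicator_le (hC₀ : 1 ≤ C₀) (hC₀' : C₀ ≠ ∞)
    (hZ : ∀ k, ((Z k).card : ℝ≥0∞) ≤ C₀ * pw (β * k))
    (hZ' : ∀ (m n : ℕ) (s : ℝ), ∑ j ∈ Z (m + n),
      {s : ℝ | |s - (j : ℝ) / 2 ^ (m + n)| ≤ 6 / 2 ^ m}.indicator 1 s ≤ C₀ * pw (γ * n))
    (hγ : 0 ≤ γ) {x y : ℝ} (hy : 0 < y) (hx : x < 1)
    (h1 : x = 2 * y) (h2 : x - (1 - γ) * y = 1 / 2) :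
    ∃ C : ℝ≥0∞, C ≠ ∞ ∧ ∀ (σ : ℝ) (_ : |σ| = 1) (F G : Set ℝ) (_ : MeasurableSet F)
      (_ : MeasurableSet G) (_ : volume F ≠ ∞) (_ : radM G ≠ ∞),
      ∫⁻ r in G, smallMax Z σ (F.indicator 1) r ∂radM ≤ C * (volume F ^ x * radM G ^ (1 - y)) := by
  -- `η ≤ 1 - x` ensures `p' ≥ 1`; `4η ≤ y`, with `x = 2y`, ensures `0 < 1/q' ≤ 1/p'`.
  set η := min (1 - x) (y / 4)
  have hη : 0 < η := lt_min (by linarith) (by linarith)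
  have hη1 : η ≤ 1 - x := min_le_left _ _
  have hη2 : 4 * η ≤ y := by have := min_le_right (1 - x) (y / 4); linarith
  set T₁ := 2 * ∑' n : ℕ, pw (-(η * n))
  set T₂ := 2 * ∑' n : ℕ, pw (-(η * (1 + γ) * n))
  have hT₁ : T₁ ≠ ∞ := ENNReal.mul_ne_top (by norm_num) (tsum_pw_lt_top hη).ne
  have hT₂ : T₂ ≠ ∞ := ENNReal.mul_ne_top (by norm_num) (tsum_pw_lt_top (by positivity)).ne
  refine ⟨10 * C₀ * (T₁ * T₂), ENNReal.mul_ne_top (ENNReal.mul_ne_top (by norm_num) hC₀')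
    (ENNReal.mul_ne_top hT₁ hT₂), fun σ hσ F G hF hG hFt hGt => ?_⟩
  by_cases hG0 : radM G = 0
  · rw [setLIntegral_measure_zero _ _ hG0]; exact zero_le
  by_cases hF0 : volume F = 0
  · have : ∀ r, smallMax Z σ (F.indicator 1) r = 0 := by
      intro r
      refine ENNReal.tsum_eq_zero.2 fun m => ?_
      have : ∀ n r, smallPiece Z σ (F.indicator 1) m n r = 0 := by
        intro n r
        unfold smallPiece vmax avg
        have : ∀ u δ : ℝ, ∫⁻ s in Icc (u - δ) (u + δ), F.indicator 1 s = 0 := by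
          intro u δ
          rw [← nonpos_iff_eq_zero, ← hF0, ← lintegral_indicator_one hF]
          exact setLIntegral_le_lintegral _ _
        simp [this]
      simp [this]
    simp [this]
  obtain ⟨f, hf⟩ := exists_pw_eq hF0 hFt
  obtain ⟨g, hg⟩ := exists_pw_eq hG0 hGt
  have hind : Measurable (F.indicator (1 : ℝ → ℝ≥0∞)) := measurable_one.indicator hF
  set W : ℕ → ℕ → ℝ≥0∞ := fun m k => pw (-(η * |(k : ℝ) + f|)) *
        pw (-(η * |(1 + γ) * m + ((1 - γ) * k + g)|)) with hW
  -- In the indices `m` and `k = m + n`, the second factor is a two-sided geometric series in `m`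
  -- with ratio exponent `η(1+γ)` and a centre depending on `k`. What remains is such a series in
  -- `k`.
  have hsumW : ∑' m : ℕ, ∑' n : ℕ, W m (m + n) ≤ T₁ * T₂ := by
    calc ∑' m : ℕ, ∑' n : ℕ, W m (m + n) ≤ ∑' m : ℕ, ∑' k : ℕ, W m k :=
          ENNReal.tsum_le_tsum fun m =>
            ENNReal.tsum_comp_le_tsum_of_injective (add_right_injective m) (W m)
      _ = ∑' k : ℕ, ∑' m : ℕ, W m k := ENNReal.tsum_comm
      _ ≤ ∑' k : ℕ, pw (-(η * |(k : ℝ) - -f|)) * T₂ := by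
          refine ENNReal.tsum_le_tsum fun k => ?_
          simp only [hW]
          rw [ENNReal.tsum_mul_left, sub_neg_eq_add]
          gcongr
          refine le_trans (le_of_eq ?_) (tsum_pw_abs_le (a := η * (1 + γ)) (by positivity)
            (-(((1 - γ) * k + g) / (1 + γ))))
          congr 1; ext m
          congr 2
          have hγ1 : 0 < 1 + γ := by linarith
          rw [mul_assoc η]
          nth_rw 2 [← abs_of_pos hγ1]
          rw [← abs_mul]
          congr 2
          field_simp
          ring
      _ ≤ T₁ * T₂ := by
          rw [ENNReal.tsum_mul_right]
          gcongr
          exact tsum_pw_abs_le hη _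
  calc ∫⁻ r in G, smallMax Z σ (F.indicator 1) r ∂radM
      = ∑' m : ℕ, ∑' n : ℕ, ∫⁻ r in dyadicIco m ∩ G, smallPiece Z σ (F.indicator 1) m n r ∂radM := by
        unfold smallMax
        rw [lintegral_tsum fun m => ((Measurable.tsum fun n =>
          measurable_smallPiece hind m n).indicator (measurableSet_dyadicIco m)).aemeasurable]
        congr 1; ext m
        rw [setLIntegral_indicator (measurableSet_dyadicIco m),
          lintegral_tsum fun n => (measurable_smallPiece hind m n).aemeasurable]
    _ ≤ ∑' m : ℕ, ∑' n : ℕ, 10 * C₀ * W m (m + n) * (volume F ^ x * radM G ^ (1 - y)) :=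
        ENNReal.tsum_le_tsum fun m => ENNReal.tsum_le_tsum fun n =>
          setLIntegral_smallPiece_le hC₀ hZ hZ' hη hη1 hη2 h1 h2 hσ hF hf hg m n
    _ = 10 * C₀ * (∑' m : ℕ, ∑' n : ℕ, W m (m + n)) * (volume F ^ x * radM G ^ (1 - y)) := by
        simp_rw [ENNReal.tsum_mul_right, ENNReal.tsum_mul_left]
    _ ≤ _ := by gcongr

end RadialMaximal

namespace RadialMaximal

/-! ### Layer cake decomposition -/

lemma lintegral_Ioi_indicator_ofReal_lt (t : ℝ≥0∞) :
    ∫⁻ s in Ioi (0 : ℝ), {s : ℝ | ENNReal.ofReal s < t}.indicator 1 s = t := by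
  have hm : MeasurableSet {s : ℝ | ENNReal.ofReal s < t} :=
    measurableSet_lt ENNReal.measurable_ofReal measurable_const
  rw [lintegral_indicator_one hm, Measure.restrict_apply hm]
  by_cases ht : t = ∞
  · have : {s : ℝ | ENNReal.ofReal s < t} ∩ Ioi 0 = Ioi 0 := by
      ext s; simp [ht]
    rw [this, Real.volume_Ioi, ht]
  · have : {s : ℝ | ENNReal.ofReal s < t} ∩ Ioi 0 = Ioo 0 t.toReal := by
      ext s
      simp only [mem_inter_iff, mem_ofPred_eq, mem_Ioi, mem_Ioo]
      constructor
      · rintro ⟨h1, h2⟩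
        exact ⟨h2, (ENNReal.ofReal_lt_iff_lt_toReal h2.le ht).1 h1⟩
      · rintro ⟨h1, h2⟩
        exact ⟨(ENNReal.ofReal_lt_iff_lt_toReal h1.le ht).2 h2, h1⟩
    rw [this, Real.volume_Ioo, sub_zero, ENNReal.ofReal_toReal ht]

/-- The superlevel set `{h > s}`. -/
def superlevel (h : ℝ → ℝ≥0∞) (s : ℝ) : Set ℝ := {v | ENNReal.ofReal s < h v}

variable {Z : ℕ → Finset ℤ} {σ σ₁ σ₂ : ℝ} {h : ℝ → ℝ≥0∞}

lemma measurableSet_superlevel (hh : Measurable h) (s : ℝ) : MeasurableSet (superlevel h s) :=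
  measurableSet_lt measurable_const hh

lemma measurable_superlevel_uncurry (hh : Measurable h) :
    Measurable fun z : ℝ × ℝ => (superlevel h z.1).indicator (1 : ℝ → ℝ≥0∞) z.2 := by
  have : (fun z : ℝ × ℝ => (superlevel h z.1).indicator (1 : ℝ → ℝ≥0∞) z.2)
      = {z : ℝ × ℝ | ENNReal.ofReal z.1 < h z.2}.indicator 1 := by
    ext z
    by_cases hz : ENNReal.ofReal z.1 < h z.2 <;> simp [superlevel, hz]
  rw [this]
  exact measurable_const.indicator (measurableSet_lt (by fun_prop) (hh.comp measurable_snd))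

lemma avg_eq_lintegral_superlevel (hh : Measurable h) (k : ℕ) (u : ℝ) :
    avg k h u = ∫⁻ s in Ioi (0 : ℝ), avg k ((superlevel h s).indicator 1) u := by
  unfold avg
  rw [lintegral_lintegral_swap (measurable_superlevel_uncurry hh).aemeasurable]
  congr 1; ext v
  nth_rw 1 [← lintegral_Ioi_indicator_ofReal_lt (h v)]
  congr 1

lemma measurable_avg_superlevel (hh : Measurable h) (k : ℕ) :
    Measurable fun z : ℝ × ℝ => avg k ((superlevel h z.1).indicator 1) z.2 := by
  have : (fun z : ℝ × ℝ => avg k ((superlevel h z.1).indicator 1) z.2) = fun z : ℝ × ℝ =>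
      ∫⁻ v, (superlevel h z.1).indicator (1 : ℝ → ℝ≥0∞) v *
        (Icc (v - 5 / 2 ^ k) (v + 5 / 2 ^ k)).indicator 1 z.2 := by
    ext z; rw [avg, setLIntegral_Icc_eq]
  rw [this]
  refine Measurable.lintegral_prod_right' (f := fun w : (ℝ × ℝ) × ℝ =>
    (superlevel h w.1.1).indicator (1 : ℝ → ℝ≥0∞) w.2 *
        (Icc (w.2 - 5 / 2 ^ k) (w.2 + 5 / 2 ^ k)).indicator 1 w.1.2) ?_
  refine Measurable.mul ((measurable_superlevel_uncurry hh).comp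
    (g := fun z : ℝ × ℝ => (superlevel h z.1).indicator (1 : ℝ → ℝ≥0∞) z.2)
    (f := fun w : (ℝ × ℝ) × ℝ => (w.1.1, w.2)) (by fun_prop)) ?_
  have := (measurable_interval_kernel (h := 1) measurable_one (5 / 2 ^ k)).comp
    (f := fun w : (ℝ × ℝ) × ℝ => (w.1.2, w.2)) (by fun_prop)
  simpa [Function.comp_def] using this

/-- The layer cake formula is exact for the averages, which are linear in `h`; the supremum costs
only an inequality. Integrating over levels thus carries bounds on indicator functions to `L^{p,1}`.
-/
lemma vmax_le_lintegral_superlevel (hh : Measurable h) (Z : Finset ℤ) (k : ℕ) (r : ℝ) :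
    vmax Z σ₁ σ₂ k h r ≤
      ∫⁻ s in Ioi (0 : ℝ), vmax Z σ₁ σ₂ k ((superlevel h s).indicator 1) r := by
  refine iSup₂_le fun j hj => ?_
  rw [avg_eq_lintegral_superlevel hh]
  exact lintegral_mono fun s => le_iSup₂_of_le j hj le_rfl

lemma measurable_vmax_superlevel (hh : Measurable h) (Z : Finset ℤ) (k : ℕ) :
    Measurable fun z : ℝ × ℝ => vmax Z σ₁ σ₂ k ((superlevel h z.1).indicator 1) z.2 := by
  unfold vmax
  refine Measurable.iSup fun j => Measurable.iSup fun _ => ?_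
  exact (measurable_avg_superlevel hh k).comp
    (f := fun z : ℝ × ℝ => (z.1, σ₁ * z.2 + σ₂ * (j / 2 ^ k))) (by fun_prop)

lemma measurable_smallMax_superlevel (hh : Measurable h) :
    Measurable fun z : ℝ × ℝ => smallMax Z σ ((superlevel h z.1).indicator 1) z.2 := by
  unfold smallMax
  refine Measurable.tsum fun m => ?_
  have : (fun z : ℝ × ℝ => (dyadicIco m).indicator
      (fun r => ∑' n : ℕ, smallPiece Z σ ((superlevel h z.1).indicator 1) m n r) z.2) =
      {z : ℝ × ℝ | z.2 ∈ dyadicIco m}.indicator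
      (fun z => ∑' n : ℕ, smallPiece Z σ ((superlevel h z.1).indicator 1) m n z.2) := by
    ext z; simp [indicator]
  rw [this]
  refine Measurable.indicator (Measurable.tsum fun n => ?_)
    (measurable_snd (measurableSet_dyadicIco m))
  exact (measurable_vmax_superlevel hh _ _).const_mul _

lemma smallMax_le_lintegral_superlevel (hh : Measurable h) (r : ℝ) :
    smallMax Z σ h r ≤ ∫⁻ s in Ioi (0 : ℝ), smallMax Z σ ((superlevel h s).indicator 1) r := by
  have hv' : ∀ k : ℕ, Measurable fun s => vmax (Z k) σ 1 k ((superlevel h s).indicator 1) r :=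
    fun k => (measurable_vmax_superlevel hh (Z k) k).comp (f := fun s : ℝ => (s, r)) (by fun_prop)
  have hv : ∀ m n : ℕ, Measurable fun s =>
      smallPiece Z σ ((superlevel h s).indicator 1) m n r := fun m n => (hv' _).const_mul _
  unfold smallMax
  rw [lintegral_tsum fun m => by
    by_cases hr : r ∈ dyadicIco m
    · simp only [indicator_of_mem hr]
      exact (Measurable.tsum fun n => hv m n).aemeasurable
    · simp only [indicator_of_notMem hr]
      exact aemeasurable_const]
  refine ENNReal.tsum_le_tsum fun m => ?_
  by_cases hr : r ∈ dyadicIco m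
  · simp only [indicator_of_mem hr]
    rw [lintegral_tsum fun n => (hv m n).aemeasurable]
    refine ENNReal.tsum_le_tsum fun n => ?_
    unfold smallPiece
    rw [lintegral_const_mul _ (hv' _)]
    gcongr
    exact vmax_le_lintegral_superlevel hh _ _ _
  · simp [indicator_of_notMem hr]

/-! ### The majorant of the radial maximal function -/

/-- A grid and a decreasing family of neighbourhoods adapted to a dilation set with finite
`β`-Minkowski and `γ`-Assouad characteristics. -/
structure DilationData (Z : ℕ → Finset ℤ) (S : ℕ → Set ℝ) (β γ : ℝ) (C₀ : ℝ≥0∞) : Prop where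
  one_le : 1 ≤ C₀
  ne_top : C₀ ≠ ∞
  card_le : ∀ k, ((Z k).card : ℝ≥0∞) ≤ C₀ * pw (β * k)
  local_card_le : ∀ (m n : ℕ) (s : ℝ), ∑ j ∈ Z (m + n),
      {s : ℝ | |s - (j : ℝ) / 2 ^ (m + n)| ≤ 6 / 2 ^ m}.indicator 1 s ≤ C₀ * pw (γ * n)
  abs_le_two : ∀ k, ∀ j ∈ Z k, |(j : ℝ) / 2 ^ k| ≤ 2
  measurableSet_nbhd : ∀ m, MeasurableSet (S m)
  antitone_nbhd : Antitone S
  nbhd_subset : S 0 ⊆ Iic 4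
  volume_nbhd_le : ∀ m : ℕ, volume (S m) ≤ C₀ * pw (-((1 - β) * m))

/-- The majorant of the maximal function for outputs away from the origin. -/
noncomputable def outerMax (Z : ℕ → Finset ℤ) (S : ℕ → Set ℝ) (g : ℝ → ℝ≥0∞) (r : ℝ) : ℝ≥0∞ :=
  farMax Z 1 1 ((Ici 1).indicator g) r + (farMax Z 1 (-1) ((Ici 1).indicator g) r +
    (farMax Z (-1) 1 ((Ici 1).indicator g) r + (nearMax Z S 1 (-1) g r + nearMax Z S (-1) 1 g r)))

/-- The majorant of the maximal function for outputs near the origin. -/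
noncomputable def innerMax (Z : ℕ → Finset ℤ) (g : ℝ → ℝ≥0∞) (r : ℝ) : ℝ≥0∞ :=
  smallMax Z 1 ((Icc (1 / 2) (5 / 2)).indicator g) r +
    smallMax Z (-1) ((Icc (1 / 2) (5 / 2)).indicator g) r

variable {S : ℕ → Set ℝ} {β γ p q : ℝ} {C₀ : ℝ≥0∞}

lemma measurable_outerMax (D : DilationData Z S β γ C₀) {g : ℝ → ℝ≥0∞} (hg : Measurable g) :
    Measurable (outerMax Z S g) := by
  have h1 := hg.indicator (measurableSet_Ici (a := (1 : ℝ)))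
  exact (measurable_farMax _ _ _ h1).add ((measurable_farMax _ _ _ h1).add
    ((measurable_farMax _ _ _ h1).add ((measurable_nearMax D.measurableSet_nbhd hg).add
    (measurable_nearMax D.measurableSet_nbhd hg))))

lemma measurable_innerMax {g : ℝ → ℝ≥0∞} (hg : Measurable g) : Measurable (innerMax Z g) :=
  (measurable_smallMax (hg.indicator measurableSet_Icc)).add
    (measurable_smallMax (hg.indicator measurableSet_Icc))

lemma lnorm_outerMax_le (D : DilationData Z S β γ C₀) (hβ : β < 1) (hp : 1 ≤ p) (hpq : p ≤ q)
    (hcrit : 2 * (1 / p) - 1 ≤ (1 - β) * (1 / q)) (hε : 1 / p - (1 - β) * (1 / q) < 1 / 2) :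
    ∃ C : ℝ≥0∞, C ≠ ∞ ∧ ∀ g : ℝ → ℝ≥0∞, Measurable g →
      lnorm q radM (outerMax Z S g) ≤ C * lnorm p radM g := by
  obtain ⟨C₁, hC₁, H₁⟩ := lnorm_radM_farMax_le D.ne_top D.card_le D.abs_le_two hp hpq hε
  obtain ⟨C₂, hC₂, H₂⟩ := lnorm_radM_nearMax_le hβ D.ne_top D.ne_top D.card_le
    D.measurableSet_nbhd D.antitone_nbhd D.nbhd_subset D.volume_nbhd_le hp hpq hcrit hε
  have hq1 : 1 ≤ q := by linarith
  refine ⟨C₁ + (C₁ + (C₁ + (C₂ + C₂))), by simp [hC₁, hC₂], fun g hg => ?_⟩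
  have h1 := hg.indicator (measurableSet_Ici (a := (1 : ℝ)))
  have mf : ∀ σ₁ σ₂, Measurable (farMax Z σ₁ σ₂ ((Ici 1).indicator g)) := fun _ _ =>
    measurable_farMax _ _ _ h1
  have mn : ∀ σ₁ σ₂, Measurable (nearMax Z S σ₁ σ₂ g) := fun _ _ =>
    measurable_nearMax D.measurableSet_nbhd hg
  simp only [add_mul]
  refine (lnorm_add_le hq1 (mf _ _) ((mf _ _).add ((mf _ _).add ((mn _ _).add (mn _ _))))).trans
    (add_le_add (H₁ _ _ (by simp) (by simp) g hg) ?_)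
  refine (lnorm_add_le hq1 (mf _ _) ((mf _ _).add ((mn _ _).add (mn _ _)))).trans
    (add_le_add (H₁ _ _ (by simp) (by simp) g hg) ?_)
  refine (lnorm_add_le hq1 (mf _ _) ((mn _ _).add (mn _ _))).trans
    (add_le_add (H₁ _ _ (by simp) (by simp) g hg) ?_)
  exact (lnorm_add_le hq1 (mn _ _) (mn _ _)).trans
    (add_le_add (H₂ _ _ (by simp) g hg) (H₂ _ _ (by simp) g hg))

/-- The decay of the exponents that yields the strong type bound near the origin. -/
def InnerDecay (β γ p q : ℝ) : Prop :=
  (∃ ε > 0, ∀ m n : ℕ, smallExp β γ (1 / p) (1 / q) m n ≤ -(ε * (m + n))) ∨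
    (1 < p ∧ p < q ∧ ∃ ε > 0, ∃ κ ≥ 0, ∀ m n : ℕ,
      smallExp β γ (1 / p) (1 / q) m n ≤ -(ε * |(n : ℝ) - κ * m|))

lemma lnorm_indicator_Icc_le (hp : 1 ≤ p) {g : ℝ → ℝ≥0∞} (hg : Measurable g) :
    lnorm p volume ((Icc (1 / 2) (5 / 2)).indicator g) ≤ 2 * lnorm p radM g := by
  have hp0 : 0 < p := by linarith
  have hx1 : 1 / p ≤ 1 := by rw [div_le_one hp0]; exact hp
  refine (lnorm_le_lnorm_radM hp0 (hg.indicator measurableSet_Icc) (R := Icc (1 / 2) (5 / 2))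
    (c := 2) (fun r hr => indicator_of_notMem hr _) fun r hr => ?_).trans ?_
  · refine ⟨by linarith [hr.1], ?_⟩
    rw [show (2 : ℝ≥0∞) = ENNReal.ofReal 2 by simp, ← ENNReal.ofReal_mul (by norm_num),
      ENNReal.one_le_ofReal]
    linarith [hr.1]
  · gcongr ?_ * ?_
    · nth_rw 2 [← ENNReal.rpow_one 2]
      exact ENNReal.rpow_le_rpow_of_exponent_le (by norm_num) hx1
    · exact lnorm_mono hp0 fun a => indicator_le_self _ _ _

lemma lnorm_innerMax_le (D : DilationData Z S β γ C₀) (hp : 1 ≤ p) (hpq : p ≤ q)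
    (hdecay : InnerDecay β γ p q) :
    ∃ C : ℝ≥0∞, C ≠ ∞ ∧ ∀ g : ℝ → ℝ≥0∞, Measurable g →
      lnorm q radM (innerMax Z g) ≤ C * lnorm p radM g := by
  obtain ⟨C, hC, H⟩ : ∃ C : ℝ≥0∞, C ≠ ∞ ∧ ∀ (σ : ℝ) (_ : |σ| = 1) (h : ℝ → ℝ≥0∞)
      (_ : Measurable h), lnorm q radM (smallMax Z σ h) ≤ C * lnorm p volume h := by
    rcases hdecay with ⟨ε, hε, h⟩ | ⟨hp', hpq', ε, hε, κ, hκ, h⟩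
    · exact lnorm_smallMax_le_of_le D.one_le D.ne_top D.card_le D.local_card_le hp hpq hε h
    · exact lnorm_smallMax_le_of_ray D.one_le D.ne_top D.card_le D.local_card_le hp' hpq' hε hκ h
  refine ⟨C * 2 + C * 2, by simp [hC, ENNReal.mul_eq_top], fun g hg => ?_⟩
  have hm := hg.indicator (measurableSet_Icc (a := (1 / 2 : ℝ)) (b := 5 / 2))
  rw [add_mul]
  refine (lnorm_add_le (hp.trans hpq) (measurable_smallMax hm) (measurable_smallMax hm)).trans
    (add_le_add ?_ ?_) <;>
  · refine (H _ (by simp) _ hm).trans ?_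
    rw [mul_assoc]
    gcongr
    exact lnorm_indicator_Icc_le hp hg

/-- The indicator bound is applied to each superlevel set and integrated over the levels. On `[1/2,
5/2]` Lebesgue measure is at most twice `radM`. -/
lemma setLIntegral_innerMax_le (D : DilationData Z S β γ C₀) (hγ : 0 ≤ γ) {x y : ℝ} (hy : 0 < y)
    (hx : x < 1) (h1 : x = 2 * y) (h2 : x - (1 - γ) * y = 1 / 2) :
    ∃ C : ℝ≥0∞, C ≠ ∞ ∧ ∀ (g : ℝ → ℝ≥0∞) (_ : Measurable g) (G : Set ℝ) (_ : MeasurableSet G)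
      (_ : radM G ≠ ∞), ∫⁻ r in G, innerMax Z g r ∂radM ≤
        C * radM G ^ (1 - y) * ∫⁻ s in Ioi (0 : ℝ), radM (superlevel g s) ^ x := by
  obtain ⟨C, hC, H⟩ := setLIntegral_smallMax_indicator_le D.one_le D.ne_top D.card_le
    D.local_card_le hγ hy hx h1 h2
  have hx0 : 0 < x := by linarith
  have : IsFiniteMeasure (volume.restrict (Icc (1 / 2 : ℝ) (5 / 2))) := by
    constructor; simp
  refine ⟨2 * (C * 2 ^ x), ENNReal.mul_ne_top (by norm_num) (ENNReal.mul_ne_top hC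
    (ENNReal.rpow_ne_top_of_nonneg hx0.le (by norm_num))), fun g hg G hG hGt => ?_⟩
  set h := (Icc (1 / 2) (5 / 2)).indicator g with hdef
  have hh : Measurable h := hg.indicator measurableSet_Icc
  have hsub : ∀ s, superlevel h s = superlevel g s ∩ Icc (1 / 2) (5 / 2) := by
    intro s; ext v
    by_cases hv : v ∈ Icc (1 / 2 : ℝ) (5 / 2)
    · simp only [superlevel, hdef, mem_ofPred_eq, mem_inter_iff, indicator_of_mem hv, hv, and_true]
    · simp only [superlevel, hdef, mem_ofPred_eq, mem_inter_iff, indicator_of_notMem hv, hv,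
        and_false, not_lt_zero]
  have hvol : ∀ s, volume (superlevel h s) ≤ 2 * radM (superlevel g s) := by
    intro s
    have hg1 : Measurable ((superlevel g s).indicator (1 : ℝ → ℝ≥0∞)) :=
      measurable_one.indicator (measurableSet_superlevel hg s)
    have := lnorm_indicator_Icc_le (p := 1) le_rfl hg1
    have e : ∀ v, (Icc (1 / 2 : ℝ) (5 / 2)).indicator ((superlevel g s).indicator 1) v =
        (superlevel h s).indicator (1 : ℝ → ℝ≥0∞) v := by
      intro v; rw [hsub, indicator_indicator, inter_comm]
    simpa only [lnorm, ENNReal.rpow_one, div_one, e,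
      lintegral_indicator_one (measurableSet_superlevel hh s),
      lintegral_indicator_one (measurableSet_superlevel hg s)] using this
  have hfin : ∀ s, volume (superlevel h s) ≠ ∞ := by
    intro s
    refine ((measure_mono (hsub s ▸ inter_subset_right)).trans_lt ?_).ne
    rw [Real.volume_Icc]; exact ENNReal.ofReal_lt_top
  have key : ∀ σ : ℝ, |σ| = 1 → ∫⁻ r in G, smallMax Z σ h r ∂radM ≤
      C * 2 ^ x * (radM G ^ (1 - y) * ∫⁻ s in Ioi (0 : ℝ), radM (superlevel g s) ^ x) := by
    intro σ hσ
    have : SFinite radM := by unfold radM; infer_instance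
    have hms : Measurable fun s => radM (superlevel g s) ^ x := by
      refine Measurable.pow_const (Antitone.measurable fun a b hab => measure_mono fun v hv => ?_) _
      exact lt_of_le_of_lt (ENNReal.ofReal_le_ofReal hab) hv
    calc ∫⁻ r in G, smallMax Z σ h r ∂radM
        ≤ ∫⁻ r in G, (∫⁻ s in Ioi (0 : ℝ), smallMax Z σ ((superlevel h s).indicator 1) r) ∂radM :=
          lintegral_mono fun r => smallMax_le_lintegral_superlevel (Z := Z) (σ := σ) hh r
      _ = ∫⁻ s in Ioi (0 : ℝ), (∫⁻ r in G, smallMax Z σ ((superlevel h s).indicator 1) r ∂radM) := by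
          refine lintegral_lintegral_swap
            (f := fun r s => smallMax Z σ ((superlevel h s).indicator 1) r) ?_
          exact ((measurable_smallMax_superlevel hh).comp measurable_swap).aemeasurable
      _ ≤ ∫⁻ s in Ioi (0 : ℝ), C * 2 ^ x * radM G ^ (1 - y) * radM (superlevel g s) ^ x := by
          refine lintegral_mono fun s => ?_
          refine (H σ hσ _ G (measurableSet_superlevel hh s) hG (hfin s) hGt).trans ?_
          calc _ ≤ C * ((2 * radM (superlevel g s)) ^ x * radM G ^ (1 - y)) := by
                gcongr
                exact hvol s
            _ = _ := by
                rw [ENNReal.mul_rpow_of_nonneg _ _ hx0.le]; ring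
      _ = _ := by rw [lintegral_const_mul _ hms]; ring
  unfold innerMax
  rw [lintegral_add_left (measurable_smallMax hh)]
  refine (add_le_add (key 1 (by simp)) (key (-1) (by simp))).trans (le_of_eq ?_)
  ring

end RadialMaximal

namespace RadialMaximal

/-! ### The kernel of the circular means on radial functions -/

/-- The kernel of `π A_t` on radial functions. -/
noncomputable def circleKernel (r t s : ℝ) : ℝ :=
  2 * s / √((s ^ 2 - (r - t) ^ 2) * ((r + t) ^ 2 - s ^ 2))

/-- With `a = |r - t|` and `b = r + t` the radicand is `(s-a)(b-s)(s+a)(b+s)`, and `(s+a)(b+s) ≥ s²`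
disposes of the numerator. The factors `s-a` and `b-s` add up to `b - a ≥ 2μ`, so one of them is at
least `μ` and only the other is singular. -/
lemma circleKernel_le {r t s μ : ℝ} (hμ : 0 < μ) (hr : μ ≤ r) (ht : μ ≤ t) (h1 : |r - t| < s)
    (h2 : s < r + t) :
    circleKernel r t s ≤ 2 / √μ * (1 / √(s - |r - t|) + 1 / √(r + t - s)) := by
  set a := |r - t| with ha
  have ha0 : 0 ≤ a := abs_nonneg _
  have hsa : 0 < s - a := by linarith
  have hbs : 0 < r + t - s := by linarith
  have hs : 0 < s := by linarith
  have hab : 2 * μ ≤ (s - a) + (r + t - s) := by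
    have : a ≤ r + t - 2 * μ := abs_le.2 ⟨by linarith, by linarith⟩
    linarith
  have e : (s ^ 2 - (r - t) ^ 2) * ((r + t) ^ 2 - s ^ 2) =
      ((s - a) * (r + t - s)) * ((s + a) * (r + t + s)) := by
    rw [← sq_abs (r - t), ← ha]; ring
  have hP : 0 < (s - a) * (r + t - s) := mul_pos hsa hbs
  have hP' : 0 < (s + a) * (r + t + s) := mul_pos (by linarith) (by linarith)
  have hk : circleKernel r t s ≤ 2 / (√(s - a) * √(r + t - s)) := by
    unfold circleKernel
    rw [e, ← Real.sqrt_mul hsa.le, div_le_div_iff₀ (Real.sqrt_pos.2 (mul_pos hP hP'))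
      (Real.sqrt_pos.2 hP), mul_assoc]
    refine mul_le_mul_of_nonneg_left ?_ (by norm_num)
    rw [Real.sqrt_mul hP.le, mul_comm]
    refine mul_le_mul_of_nonneg_left ?_ (Real.sqrt_nonneg _)
    refine Real.le_sqrt_of_sq_le ?_
    nlinarith
  refine hk.trans ?_
  have h3 : 0 < √(s - a) := Real.sqrt_pos.2 hsa
  have h4 : 0 < √(r + t - s) := Real.sqrt_pos.2 hbs
  have h5 : 0 < √μ := Real.sqrt_pos.2 hμ
  rcases le_total μ (s - a) with h | h
  · have h6 : √μ ≤ √(s - a) := Real.sqrt_le_sqrt h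
    calc 2 / (√(s - a) * √(r + t - s)) ≤ 2 / (√μ * √(r + t - s)) := by gcongr
      _ = 2 / √μ * (0 + 1 / √(r + t - s)) := by field_simp; ring
      _ ≤ _ := by gcongr; positivity
  · have h6 : √μ ≤ √(r + t - s) := Real.sqrt_le_sqrt (by linarith)
    calc 2 / (√(s - a) * √(r + t - s)) ≤ 2 / (√(s - a) * √μ) := by gcongr
      _ = 2 / √μ * (1 / √(s - a) + 0) := by field_simp; ring
      _ ≤ _ := by gcongr; positivity

/-- For `s < 1` the endpoint `r + t` is at distance at least 1/2 from `s`, so only `|r - t|` is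
singular. One factor `√s` of the numerator is spent on `s + |r-t| ≥ s`; the other survives. -/
lemma circleKernel_le_near {r t s : ℝ} (hr : 1 / 2 ≤ r) (ht : 1 ≤ t) (h1 : |r - t| < s)
    (h2 : s < 1) : circleKernel r t s ≤ 3 * √s * (1 / √(s - |r - t|)) := by
  set a := |r - t| with ha
  have ha0 : 0 ≤ a := abs_nonneg _
  have hsa : 0 < s - a := by linarith
  have hs : 0 < s := by linarith
  have e : (s ^ 2 - (r - t) ^ 2) * ((r + t) ^ 2 - s ^ 2) =
      ((s - a) * s) * (((s + a) / s) * ((r + t - s) * (r + t + s))) := by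
    rw [← sq_abs (r - t), ← ha]; field_simp; ring
  have h3 : (2 / 3 : ℝ) ≤ √(((s + a) / s) * ((r + t - s) * (r + t + s))) := by
    refine Real.le_sqrt_of_sq_le ?_
    have h4 : 1 ≤ (s + a) / s := by rw [le_div_iff₀ hs]; linarith
    have h5 : (1 / 2 : ℝ) ≤ (r + t - s) * (r + t + s) := by nlinarith
    nlinarith
  unfold circleKernel
  rw [e, Real.sqrt_mul (by positivity) (((s + a) / s) * ((r + t - s) * (r + t + s))),
    Real.sqrt_mul hsa.le]
  have h6 : 0 < √(s - a) := Real.sqrt_pos.2 hsa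
  have h7 : 0 < √s := Real.sqrt_pos.2 hs
  calc 2 * s / (√(s - a) * √s * √(((s + a) / s) * ((r + t - s) * (r + t + s))))
      ≤ 2 * s / (√(s - a) * √s * (2 / 3)) := by gcongr
    _ = 3 * (s / √s) * (1 / √(s - a)) := by field_simp
    _ = _ := by rw [Real.div_sqrt]

/-! ### Dyadic decomposition of the singularity -/

/-- A single term suffices, the one with `2^(-n-1) < u 2^m / 4 ≤ 2^(-n)`. -/
lemma ofReal_one_div_sqrt_le_tsum {u : ℝ} (hu : 0 < u) (m : ℕ) (hum : u ≤ 4 / 2 ^ m) :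
    ENNReal.ofReal (1 / √u) ≤
      ∑' n : ℕ, pw (((m + n : ℕ) : ℝ) / 2) * (Iic (4 / 2 ^ (m + n))).indicator 1 u := by
  obtain ⟨n, hn1, hn2⟩ := exists_nat_pow_near_of_lt_one (x := u * 2 ^ m / 4) (y := 1 / 2)
    (by positivity) (by rw [div_le_one (by norm_num), ← le_div_iff₀ (by positivity)]; exact hum)
    (by norm_num) (by norm_num)
  refine le_trans ?_ (ENNReal.le_tsum n)
  have h2 : u ∈ Iic ((4 : ℝ) / 2 ^ (m + n)) := by
    rw [mem_Iic, pow_add, ← div_div, le_div_iff₀ (by positivity)]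
    rw [one_div, inv_pow, ← one_div, le_div_iff₀ (by positivity)] at hn2
    rw [le_div_iff₀ (by positivity)]
    nlinarith
  rw [indicator_of_mem h2, Pi.one_apply, mul_one, ← ofReal_two_rpow]
  refine ENNReal.ofReal_le_ofReal ?_
  have h3 : 1 / u ≤ 2 ^ (m + n) := by
    rw [div_le_iff₀ hu]
    rw [one_div, inv_pow, ← one_div, div_lt_iff₀ (by positivity), pow_succ] at hn1
    rw [pow_add]
    have : (0 : ℝ) < 2 ^ m * 2 ^ n * u := by positivity
    nlinarith
  have h4 : (2 : ℝ) ^ (((m + n : ℕ) : ℝ) / 2) = √(2 ^ (m + n)) := by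
    rw [Real.sqrt_eq_rpow, ← Real.rpow_natCast 2 (m + n), ← Real.rpow_mul (by norm_num)]
    ring_nf
  rw [h4, one_div, ← Real.sqrt_inv, ← one_div]
  exact Real.sqrt_le_sqrt h3

variable {Z : ℕ → Finset ℤ} {S : ℕ → Set ℝ} {σ₁ σ₂ t r : ℝ} {h : ℝ → ℝ≥0∞}

/-- Rounding `t` down to the grid moves the centre by at most `2^(-k)`, which enlarges the radius
`4/2^k` of the dyadic piece to the `5/2^k` in `avg`. -/
lemma lintegral_singular_le_tsum_vmax (hZt : ∀ k : ℕ, ⌊2 ^ k * t⌋ ∈ Z k) (hσ₂ : |σ₂| = 1)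
    (hh : Measurable h) (m : ℕ) {A : Set ℝ}
    (hA : ∀ s ∈ A, 0 < |s - (σ₁ * r + σ₂ * t)| ∧ |s - (σ₁ * r + σ₂ * t)| ≤ 4 / 2 ^ m)
    (hAm : MeasurableSet A) :
    ∫⁻ s in A, h s * ENNReal.ofReal (1 / √|s - (σ₁ * r + σ₂ * t)|) ≤
      ∑' n : ℕ, pw (((m + n : ℕ) : ℝ) / 2) * vmax (Z (m + n)) σ₁ σ₂ (m + n) h r := by
  set c := σ₁ * r + σ₂ * t with hc
  have hI : ∀ n : ℕ, Measurable fun s : ℝ =>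
      (Iic ((4 : ℝ) / 2 ^ (m + n))).indicator (1 : ℝ → ℝ≥0∞) |s - c| := fun n =>
    (measurable_one.indicator measurableSet_Iic).comp (by fun_prop)
  have hhI : ∀ n : ℕ, Measurable fun s : ℝ =>
      h s * (Iic ((4 : ℝ) / 2 ^ (m + n))).indicator (1 : ℝ → ℝ≥0∞) |s - c| := fun n => hh.mul (hI n)
  calc _ ≤ ∫⁻ s in A, ∑' n : ℕ, pw (((m + n : ℕ) : ℝ) / 2) *
          (h s * (Iic (4 / 2 ^ (m + n))).indicator 1 |s - c|) := by
        refine setLIntegral_mono' hAm fun s hs => ?_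
        calc _ ≤ h s * ∑' n : ℕ, pw (((m + n : ℕ) : ℝ) / 2) *
              (Iic (4 / 2 ^ (m + n))).indicator 1 |s - c| := by
              gcongr
              exact ofReal_one_div_sqrt_le_tsum (hA s hs).1 m (hA s hs).2
          _ = _ := by
              rw [← ENNReal.tsum_mul_left]
              congr 1; ext n; ring
    _ ≤ ∫⁻ s, ∑' n : ℕ, pw (((m + n : ℕ) : ℝ) / 2) *
          (h s * (Iic (4 / 2 ^ (m + n))).indicator 1 |s - c|) := setLIntegral_le_lintegral _ _
    _ = ∑' n : ℕ, pw (((m + n : ℕ) : ℝ) / 2) *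
          ∫⁻ s, h s * (Iic (4 / 2 ^ (m + n))).indicator 1 |s - c| := by
        rw [lintegral_tsum fun n => ((hhI n).const_mul _).aemeasurable]
        congr 1; ext n
        exact lintegral_const_mul _ (hhI n)
    _ ≤ _ := by
        refine ENNReal.tsum_le_tsum fun n => mul_le_mul' le_rfl ?_
        set k := m + n
        refine le_trans ?_ (le_iSup₂_of_le _ (hZt k) le_rfl)
        unfold avg
        rw [← lintegral_indicator measurableSet_Icc]
        refine lintegral_mono fun s => ?_
        by_cases hs : |s - c| ∈ Iic ((4 : ℝ) / 2 ^ k)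
        · rw [indicator_of_mem hs, Pi.one_apply, mul_one, indicator_of_mem]
          have h1 : |σ₂ * (t - ⌊2 ^ k * t⌋ / 2 ^ k)| ≤ 1 / 2 ^ k := by
            rw [abs_mul, hσ₂, one_mul]
            have h2 := Int.floor_le (2 ^ k * t)
            have h3 := Int.lt_floor_add_one (2 ^ k * t)
            have e : t - ⌊2 ^ k * t⌋ / 2 ^ k = (2 ^ k * t - ⌊2 ^ k * t⌋) / 2 ^ k := by
              field_simp
            rw [e, abs_of_nonneg (div_nonneg (by linarith) (by positivity))]
            gcongr
            linarith
          have h2 := abs_le.1 h1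
          have h3 := abs_le.1 (show |s - c| ≤ 4 / 2 ^ k from hs)
          have h5 : (5 : ℝ) / 2 ^ k = 4 / 2 ^ k + 1 / 2 ^ k := by ring
          rw [hc] at h3
          constructor <;> nlinarith [h2.1, h2.2, h3.1, h3.2]
        · rw [indicator_of_notMem hs, mul_zero]; exact zero_le

/-! ### Pointwise domination -/

lemma lintegral_kernel_le_two_terms {g : ℝ → ℝ≥0∞} (hg : Measurable g) {A : Set ℝ}
    (hA : MeasurableSet A) {K k₁ k₂ : ℝ → ℝ} {c : ℝ≥0∞}
    (hk₁ : Measurable k₁)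
    (hK : ∀ s ∈ A, ENNReal.ofReal (K s) ≤
      c * (ENNReal.ofReal (k₁ s) + ENNReal.ofReal (k₂ s))) (hc : c ≠ ∞) :
    ∫⁻ s in A, g s * ENNReal.ofReal (K s) ≤ c * ((∫⁻ s in A, g s * ENNReal.ofReal (k₁ s)) +
      ∫⁻ s in A, g s * ENNReal.ofReal (k₂ s)) := by
  have hm : Measurable fun s => g s * ENNReal.ofReal (k₁ s) := hg.mul hk₁.ennreal_ofReal
  rw [← lintegral_add_left hm, ← lintegral_const_mul' _ _ hc]
  refine setLIntegral_mono' hA fun s hs => ?_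
  calc _ ≤ g s * (c * (ENNReal.ofReal (k₁ s) + ENNReal.ofReal (k₂ s))) := by gcongr; exact hK s hs
    _ = _ := by ring

lemma exists_sign_abs_eq (r t : ℝ) : ∃ σ : ℝ, (σ = 1 ∨ σ = -1) ∧ |r - t| = σ * r + -σ * t := by
  rcases le_total t r with h | h
  · exact ⟨1, Or.inl rfl, by rw [abs_of_nonneg (by linarith)]; ring⟩
  · exact ⟨-1, Or.inr rfl, by rw [abs_of_nonpos (by linarith)]; ring⟩

lemma lintegral_kernel_far_le (hZt : ∀ k : ℕ, ⌊2 ^ k * t⌋ ∈ Z k) (ht1 : 1 ≤ t) (ht2 : t ≤ 2)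
    {g : ℝ → ℝ≥0∞} (hg : Measurable g) (hr : 1 / 2 ≤ r) :
    ∫⁻ s in Ioo |r - t| (r + t) ∩ Ici 1, g s * ENNReal.ofReal (circleKernel r t s) ≤
      3 * (farMax Z 1 1 ((Ici 1).indicator g) r + (farMax Z 1 (-1) ((Ici 1).indicator g) r +
        farMax Z (-1) 1 ((Ici 1).indicator g) r)) := by
  obtain ⟨σ, hσ, hσe⟩ := exists_sign_abs_eq r t
  set A := Ioo |r - t| (r + t) ∩ Ici 1 with hAdef
  have hA : MeasurableSet A := measurableSet_Ioo.inter measurableSet_Ici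
  have hg1 : Measurable ((Ici (1 : ℝ)).indicator g) := hg.indicator measurableSet_Ici
  have hab : r + t ≤ |r - t| + 4 := by
    have := neg_le_abs (r - t); have := le_abs_self (r - t); linarith
  have hK : ∀ s ∈ A, ENNReal.ofReal (circleKernel r t s) ≤
      3 * (ENNReal.ofReal (1 / √|s - (1 * r + 1 * t)|) +
        ENNReal.ofReal (1 / √|s - (σ * r + -σ * t)|)) := by
    intro s hs
    have h1 := circleKernel_le (μ := 1 / 2) (by norm_num) hr (by linarith) hs.1.1 hs.1.2
    rw [show (3 : ℝ≥0∞) = ENNReal.ofReal 3 by simp, ← ENNReal.ofReal_add (by positivity)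
      (by positivity), ← ENNReal.ofReal_mul (by norm_num)]
    refine ENNReal.ofReal_le_ofReal (h1.trans ?_)
    have e1 : |s - (1 * r + 1 * t)| = r + t - s := by
      rw [abs_of_nonpos (by linarith [hs.1.2])]; ring
    rw [← hσe, abs_of_nonneg (by linarith [hs.1.1] : 0 ≤ s - |r - t|), e1,
      add_comm (1 / √(r + t - s))]
    refine mul_le_mul_of_nonneg_right ?_ (by positivity)
    rw [div_le_iff₀ (by positivity), ← div_le_iff₀' (by norm_num)]
    refine Real.le_sqrt_of_sq_le ?_
    norm_num
  have hconv : ∀ k : ℝ → ℝ, ∫⁻ s in A, g s * ENNReal.ofReal (k s) =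
      ∫⁻ s in A, (Ici 1).indicator g s * ENNReal.ofReal (k s) := fun k =>
    setLIntegral_congr_fun hA fun s hs => by
      rw [indicator_of_mem (show s ∈ Ici (1 : ℝ) from hs.2)]
  refine (lintegral_kernel_le_two_terms hg hA (by fun_prop) hK (by norm_num)).trans ?_
  gcongr
  · rw [hconv]
    refine (lintegral_singular_le_tsum_vmax hZt (by simp) hg1 0 (fun s hs => ?_) hA).trans_eq ?_
    · rw [one_mul, one_mul, abs_of_neg (by linarith [hs.1.2]), pow_zero]
      constructor <;> linarith [hs.1.1, hs.1.2]
    · simp only [zero_add]; rfl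
  · rw [hconv]
    refine (lintegral_singular_le_tsum_vmax hZt ?_ hg1 0 (fun s hs => ?_) hA).trans ?_
    · rcases hσ with rfl | rfl <;> simp
    · rw [← hσe, abs_of_pos (by linarith [hs.1.1] : 0 < s - |r - t|), pow_zero]
      constructor <;> linarith [hs.1.1, hs.1.2]
    · simp only [zero_add]
      rcases hσ with rfl | rfl
      · exact le_self_add
      · rw [neg_neg]; exact le_add_self

lemma sqrt_le_pw {s : ℝ} {m : ℕ} (hs : s ≤ 1 / 2 ^ m) : ENNReal.ofReal √s ≤ pw (-(m / 2)) := by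
  rw [← ofReal_two_rpow]
  refine ENNReal.ofReal_le_ofReal ?_
  have h4 : (2 : ℝ) ^ (-((m : ℝ) / 2)) = √(1 / 2 ^ m) := by
    rw [Real.sqrt_eq_rpow, one_div, ← Real.rpow_natCast 2 m, ← Real.rpow_neg (by norm_num),
      ← Real.rpow_mul (by norm_num)]
    ring_nf
  rw [h4]
  exact Real.sqrt_le_sqrt hs

lemma exists_mem_dyadicIco {s : ℝ} (h0 : 0 < s) (h1 : s < 1) : ∃ m, s ∈ dyadicIco m := by
  have hex : ∃ m : ℕ, 1 / 2 ^ (m + 1) ≤ s := by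
    obtain ⟨n, hn⟩ := exists_pow_lt_of_lt_one h0 (show (1 / 2 : ℝ) < 1 by norm_num)
    refine ⟨n, le_trans ?_ hn.le⟩
    rw [one_div_pow]
    exact one_div_le_one_div_of_le (by positivity) (pow_le_pow_right₀ (by norm_num) (by omega))
  classical
  refine ⟨Nat.find hex, Nat.find_spec hex, ?_⟩
  rcases Nat.eq_zero_or_pos (Nat.find hex) with h | h
  · rw [h]; simpa using h1
  · have := Nat.find_min hex (m := Nat.find hex - 1) (by omega)
    rw [not_le, Nat.sub_add_cancel h] at this
    exact this

lemma lintegral_kernel_near_le (hZt : ∀ k : ℕ, ⌊2 ^ k * t⌋ ∈ Z k) (ht1 : 1 ≤ t)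
    (hSt : ∀ m : ℕ, |r - t| < 1 / 2 ^ m → r ∈ S m)
    {g : ℝ → ℝ≥0∞} (hg : Measurable g) (hr : 1 / 2 ≤ r) :
    ∫⁻ s in Ioo |r - t| 1, g s * ENNReal.ofReal (circleKernel r t s) ≤
      3 * (nearMax Z S 1 (-1) g r + nearMax Z S (-1) 1 g r) := by
  obtain ⟨σ, hσ, hσe⟩ := exists_sign_abs_eq r t
  set a := |r - t| with ha
  have ha0 : 0 ≤ a := abs_nonneg _
  have hmain : ∫⁻ s in Ioo a 1, g s * ENNReal.ofReal (circleKernel r t s) ≤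
      3 * nearMax Z S σ (-σ) g r := by
    calc _ ≤ ∫⁻ s in ⋃ m, (dyadicIco m ∩ Ioi a), g s * ENNReal.ofReal (circleKernel r t s) := by
          refine lintegral_mono_set fun s hs => ?_
          obtain ⟨m, hm⟩ := exists_mem_dyadicIco (ha0.trans_lt hs.1) hs.2
          exact mem_iUnion.2 ⟨m, hm, hs.1⟩
      _ ≤ ∑' m, ∫⁻ s in dyadicIco m ∩ Ioi a, g s * ENNReal.ofReal (circleKernel r t s) :=
          lintegral_iUnion_le _ _
      _ ≤ ∑' m, 3 * (S m).indicator (fun r => ∑' n : ℕ, nearPiece Z σ (-σ) g m n r) r := by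
          refine ENNReal.tsum_le_tsum fun m => ?_
          by_cases hm : a < 1 / 2 ^ m
          swap
          · have : dyadicIco m ∩ Ioi a = ∅ := by
              ext s; simp only [mem_inter_iff, mem_Ioi, mem_empty_iff_false, iff_false, not_and]
              intro hs hs'
              exact hm (lt_trans hs' hs.2)
            rw [this]; simp
          rw [indicator_of_mem (hSt m hm)]
          have hgm := hg.indicator (measurableSet_dyadicIco m)
          have hAm : MeasurableSet (dyadicIco m ∩ Ioi a) :=
            (measurableSet_dyadicIco m).inter measurableSet_Ioi
          calc _ ≤ ∫⁻ s in dyadicIco m ∩ Ioi a, 3 * pw (-(m / 2)) *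
                ((dyadicIco m).indicator g s * ENNReal.ofReal (1 / √|s - (σ * r + -σ * t)|)) := by
                refine setLIntegral_mono' hAm fun s hs => ?_
                have hs1 : s < 1 := hs.1.2.trans_le (by
                  rw [div_le_one (by positivity)]; exact one_le_pow₀ (by norm_num))
                have hsa : a < s := hs.2
                have h1 := circleKernel_le_near hr ht1 hs.2 hs1
                rw [indicator_of_mem hs.1, ← hσe, abs_of_pos (by linarith : 0 < s - a)]
                calc _ ≤ g s * ENNReal.ofReal (3 * √s * (1 / √(s - a))) := by gcongr
                  _ = g s * (3 * ENNReal.ofReal √s * ENNReal.ofReal (1 / √(s - a))) := by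
                      rw [ENNReal.ofReal_mul (by positivity), ENNReal.ofReal_mul (by norm_num)]
                      simp
                  _ ≤ g s * (3 * pw (-(m / 2)) * ENNReal.ofReal (1 / √(s - a))) := by
                      gcongr
                      exact sqrt_le_pw hs.1.2.le
                  _ = _ := by ring
            _ = 3 * pw (-(m / 2)) * ∫⁻ s in dyadicIco m ∩ Ioi a,
                (dyadicIco m).indicator g s * ENNReal.ofReal (1 / √|s - (σ * r + -σ * t)|) :=
                lintegral_const_mul' _ _ (ENNReal.mul_ne_top (by norm_num) (pw_ne_top _))
            _ ≤ 3 * pw (-(m / 2)) * ∑' n : ℕ, pw (((m + n : ℕ) : ℝ) / 2) *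
                vmax (Z (m + n)) σ (-σ) (m + n) ((dyadicIco m).indicator g) r := by
                gcongr
                refine lintegral_singular_le_tsum_vmax hZt ?_ hgm m (fun s hs => ?_) hAm
                · rcases hσ with rfl | rfl <;> simp
                · have hsa : a < s := hs.2
                  rw [← hσe, abs_of_pos (by linarith : 0 < s - a)]
                  refine ⟨by linarith, ?_⟩
                  have : (1 : ℝ) / 2 ^ m ≤ 4 / 2 ^ m := by gcongr; norm_num
                  linarith [hs.1.2]
            -- The factor `2^(-m/2)` from `√s` turns the singular factor `2^((m+n)/2)` into the
            -- `2^(n/2)` of `nearPiece`.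
            _ = _ := by
                rw [mul_assoc, ← ENNReal.tsum_mul_left]
                congr 2; ext n
                unfold nearPiece
                rw [← mul_assoc, ← pw_add]
                congr 2
                push_cast; ring
      _ = _ := by rw [ENNReal.tsum_mul_left]; rfl
  refine hmain.trans ?_
  gcongr
  rcases hσ with rfl | rfl
  · exact le_self_add
  · rw [neg_neg]; exact le_add_self

lemma lintegral_kernel_small_le (hZt : ∀ k : ℕ, ⌊2 ^ k * t⌋ ∈ Z k) (ht1 : 1 ≤ t) (ht2 : t ≤ 2)
    {g : ℝ → ℝ≥0∞} (hg : Measurable g) (hr0 : 0 < r) (hr : r < 1 / 2) :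
    ∫⁻ s in Ioo |r - t| (r + t), g s * ENNReal.ofReal (circleKernel r t s) ≤ 3 * innerMax Z g r := by
  obtain ⟨m, hm⟩ := exists_mem_dyadicIco hr0 (by linarith)
  have hae : |r - t| = t - r := by rw [abs_of_neg (by linarith)]; ring
  set A := Ioo |r - t| (r + t) with hAdef
  have hA : MeasurableSet A := measurableSet_Ioo
  have hsub : ∀ s ∈ A, s ∈ Icc (1 / 2 : ℝ) (5 / 2) := by
    intro s hs
    rw [hAdef, hae] at hs
    exact ⟨by linarith [hs.1], by linarith [hs.2]⟩
  set h := (Icc (1 / 2 : ℝ) (5 / 2)).indicator g with hdef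
  have hh : Measurable h := hg.indicator measurableSet_Icc
  have hconv : ∀ k : ℝ → ℝ, ∫⁻ s in A, g s * ENNReal.ofReal (k s) =
      ∫⁻ s in A, h s * ENNReal.ofReal (k s) := fun k =>
    setLIntegral_congr_fun hA fun s hs => by rw [hdef, indicator_of_mem (hsub s hs)]
  have hr2 : 2 * r ≤ 4 / 2 ^ m := by
    have h1 := hm.2
    have h2 : (4 : ℝ) / 2 ^ m = 2 * (1 / 2 ^ m) + 2 * (1 / 2 ^ m) := by ring
    have h3 : (0 : ℝ) < 1 / 2 ^ m := by positivity
    linarith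
  -- From `r ≥ 2^(-m-1)` and `2√2 ≤ 3`. Multiplied by `2^((m+n)/2)` this gives the factor
  -- `2^(m+n/2)` of `smallPiece`.
  have hrm : ENNReal.ofReal (2 / √r) ≤ 3 * pw (m / 2) := by
    rw [← ofReal_two_rpow, show (3 : ℝ≥0∞) = ENNReal.ofReal 3 by simp,
      ← ENNReal.ofReal_mul (by norm_num)]
    refine ENNReal.ofReal_le_ofReal ?_
    have h4 : (2 : ℝ) ^ ((m : ℝ) / 2) = √(2 ^ m) := by
      rw [Real.sqrt_eq_rpow, ← Real.rpow_natCast 2 m, ← Real.rpow_mul (by norm_num)]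
      ring_nf
    rw [h4, div_le_iff₀ (Real.sqrt_pos.2 hr0), mul_assoc, ← Real.sqrt_mul (by positivity),
      ← div_le_iff₀' (by norm_num)]
    refine Real.le_sqrt_of_sq_le ?_
    have h1 := hm.1
    rw [pow_succ, div_le_iff₀ (by positivity)] at h1
    nlinarith
  have hK : ∀ s ∈ A, ENNReal.ofReal (circleKernel r t s) ≤
      3 * pw (m / 2) * (ENNReal.ofReal (1 / √|s - (1 * r + 1 * t)|) +
        ENNReal.ofReal (1 / √|s - (-1 * r + 1 * t)|)) := by
    intro s hs
    have h1 := circleKernel_le (μ := r) hr0 le_rfl (by linarith) hs.1 hs.2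
    refine (ENNReal.ofReal_le_ofReal h1).trans ?_
    rw [ENNReal.ofReal_mul (by positivity), ENNReal.ofReal_add (by positivity) (by positivity)]
    have e1 : |s - (1 * r + 1 * t)| = r + t - s := by
      rw [abs_of_nonpos (by linarith [hs.2])]; ring
    have e2 : |s - (-1 * r + 1 * t)| = s - |r - t| := by
      rw [hae, abs_of_nonneg (by linarith [hae ▸ hs.1])]; ring
    rw [e1, e2, add_comm (ENNReal.ofReal (1 / √(r + t - s)))]
    gcongr
  have hpiece : ∀ σ : ℝ, (σ = 1 ∨ σ = -1) →
      pw (m / 2) * ∫⁻ s in A, h s * ENNReal.ofReal (1 / √|s - (σ * r + 1 * t)|) ≤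
        smallMax Z σ h r := by
    intro σ hσ
    have h1 : ∫⁻ s in A, h s * ENNReal.ofReal (1 / √|s - (σ * r + 1 * t)|) ≤
        ∑' n : ℕ, pw (((m + n : ℕ) : ℝ) / 2) * vmax (Z (m + n)) σ 1 (m + n) h r := by
      refine lintegral_singular_le_tsum_vmax hZt (by simp) hh m (fun s hs => ?_) hA
      rw [hAdef, hae] at hs
      rcases hσ with rfl | rfl
      · rw [abs_of_neg (by linarith [hs.2])]
        constructor <;> linarith [hs.1, hs.2]
      · rw [abs_of_pos (by linarith [hs.1])]
        constructor <;> linarith [hs.1, hs.2]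
    unfold smallMax
    refine le_trans ?_ (ENNReal.le_tsum m)
    rw [indicator_of_mem hm]
    refine (mul_le_mul' le_rfl h1).trans_eq ?_
    rw [← ENNReal.tsum_mul_left]
    congr 1; ext n
    unfold smallPiece
    rw [← mul_assoc, ← pw_add]
    congr 2
    push_cast; ring
  refine (lintegral_kernel_le_two_terms hg hA (by fun_prop) hK
    (ENNReal.mul_ne_top (by norm_num) (pw_ne_top _))).trans ?_
  rw [hconv, hconv, mul_assoc, mul_add]
  unfold innerMax
  gcongr
  · exact hpiece 1 (Or.inl rfl)
  · exact hpiece (-1) (Or.inr rfl)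

/-- The majorant of the maximal function on radial functions. -/
noncomputable def totalMax (Z : ℕ → Finset ℤ) (S : ℕ → Set ℝ) (g : ℝ → ℝ≥0∞) (r : ℝ) : ℝ≥0∞ :=
  outerMax Z S g r + innerMax Z g r

lemma lintegral_kernel_le_totalMax (hZt : ∀ k : ℕ, ⌊2 ^ k * t⌋ ∈ Z k) (ht1 : 1 ≤ t) (ht2 : t ≤ 2)
    (hSt : ∀ m : ℕ, |r - t| < 1 / 2 ^ m → r ∈ S m)
    {g : ℝ → ℝ≥0∞} (hg : Measurable g) (hr0 : 0 < r) :
    ∫⁻ s in Ioo |r - t| (r + t), g s * ENNReal.ofReal (circleKernel r t s) ≤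
      3 * totalMax Z S g r := by
  unfold totalMax
  rcases lt_or_ge r (1 / 2) with hr | hr
  · refine (lintegral_kernel_small_le hZt ht1 ht2 hg hr0 hr).trans ?_
    gcongr
    exact le_add_self
  · have hsub : Ioo |r - t| (r + t) ⊆ (Ioo |r - t| (r + t) ∩ Ici 1) ∪ Ioo |r - t| 1 := by
      intro s hs
      rcases lt_or_ge s 1 with h | h
      · exact Or.inr ⟨hs.1, h⟩
      · exact Or.inl ⟨hs, h⟩
    calc _ ≤ _ := lintegral_mono_set hsub
      _ ≤ _ := lintegral_union_le _ _ _
      _ ≤ _ := add_le_add (lintegral_kernel_far_le hZt ht1 ht2 hg hr)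
          (lintegral_kernel_near_le hZt ht1 hSt hg hr)
      _ ≤ _ := by
          rw [← mul_add]
          refine mul_le_mul' le_rfl ?_
          calc _ = outerMax Z S g r := by unfold outerMax; ring
            _ ≤ _ := le_self_add

end RadialMaximal

namespace RadialMaximal

/-! ### The dyadic grid of a dilation set -/

/-- In units of `2^(-k)` the covering intervals have length 1/2, so each meets at most two grid
cells. The scale `2^(-k-1)` is below 1 even for `k = 0`, as the characteristics require. -/
lemma card_le_two_mul_coveringNumber {F : Set ℝ} {k : ℕ} {T : Finset ℤ}
    (hT : ∀ j ∈ T, ∃ t ∈ F, ⌊2 ^ k * t⌋ = j) :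
    (T.card : ℝ≥0∞) ≤ 2 * (coveringNumber F (1 / 2 ^ (k + 1)) : ℝ≥0∞) := by
  have h : (((T.card + 1) / 2 : ℕ) : ℕ∞) ≤ coveringNumber F (1 / 2 ^ (k + 1)) := by
    refine le_iInf₂ fun s hs => ?_
    have hsub : T ⊆ s.biUnion fun a => {⌊2 ^ k * a⌋, ⌊2 ^ k * a⌋ + 1} := by
      intro j hj
      obtain ⟨t, ht, rfl⟩ := hT j hj
      obtain ⟨a, ha, h1, h2⟩ := mem_iUnion₂.1 (hs ht)
      refine Finset.mem_biUnion.2 ⟨a, ha, ?_⟩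
      have e : (2 : ℝ) ^ k * (1 / 2 ^ (k + 1)) = 1 / 2 := by field_simp; ring
      have h3 : (2 : ℝ) ^ k * a ≤ 2 ^ k * t := by gcongr
      have h4 : (2 : ℝ) ^ k * t ≤ 2 ^ k * a + 1 / 2 := by
        rw [← e, ← mul_add]; gcongr
      have h5 := Int.floor_le_floor h3
      have h6 : ⌊(2 : ℝ) ^ k * t⌋ < ⌊(2 : ℝ) ^ k * a⌋ + 2 := by
        rw [Int.floor_lt]
        push_cast
        linarith [Int.lt_floor_add_one ((2 : ℝ) ^ k * a)]
      simp only [Finset.mem_insert, Finset.mem_singleton]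
      omega
    have := (Finset.card_le_card hsub).trans Finset.card_biUnion_le
    have h2 : T.card ≤ s.card * 2 := this.trans
      ((Finset.sum_le_card_nsmul _ _ 2 fun a _ => Finset.card_le_two).trans (by simp))
    exact_mod_cast (by omega : (T.card + 1) / 2 ≤ s.card)
  have h1 : (((T.card + 1) / 2 : ℕ) : ℝ≥0∞) ≤ (coveringNumber F (1 / 2 ^ (k + 1)) : ℝ≥0∞) := by
    exact_mod_cast ENat.toENNReal_le.2 h
  calc (T.card : ℝ≥0∞) ≤ ((2 * ((T.card + 1) / 2) : ℕ) : ℝ≥0∞) := by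
        exact_mod_cast (by omega)
    _ = 2 * (((T.card + 1) / 2 : ℕ) : ℝ≥0∞) := by push_cast; rfl
    _ ≤ _ := by gcongr

variable {E : Set ℝ} {β γ : ℝ}

open Classical in
/-- The left endpoints, in units of `2 ^ (-k)`, of the dyadic intervals meeting `E ⊆ [1, 2]`. -/
noncomputable def grid (E : Set ℝ) (k : ℕ) : Finset ℤ :=
  {j ∈ Finset.Icc (2 ^ k : ℤ) (2 * 2 ^ k) | ∃ t ∈ E, ⌊2 ^ k * t⌋ = j}

lemma exists_of_mem_grid {k : ℕ} {j : ℤ} (hj : j ∈ grid E k) : ∃ t ∈ E, ⌊2 ^ k * t⌋ = j := by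
  classical
  exact (Finset.mem_filter.1 hj).2

lemma floor_mem_grid (hE : E ⊆ Icc 1 2) {t : ℝ} (ht : t ∈ E) (k : ℕ) : ⌊2 ^ k * t⌋ ∈ grid E k := by
  classical
  refine Finset.mem_filter.2 ⟨Finset.mem_Icc.2 ⟨?_, ?_⟩, t, ht, rfl⟩
  · rw [Int.le_floor]; push_cast
    have := (hE ht).1
    have : (0 : ℝ) < 2 ^ k := by positivity
    nlinarith
  · have : ((⌊2 ^ k * t⌋ : ℤ) : ℝ) ≤ 2 * 2 ^ k := by
      refine (Int.floor_le _).trans ?_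
      have := (hE ht).2
      have : (0 : ℝ) < 2 ^ k := by positivity
      nlinarith
    exact_mod_cast this

lemma abs_sub_le_of_floor_eq {k : ℕ} {t : ℝ} {j : ℤ} (h : ⌊2 ^ k * t⌋ = j) :
    (j : ℝ) / 2 ^ k ≤ t ∧ t ≤ j / 2 ^ k + 1 / 2 ^ k := by
  have h2 : (0 : ℝ) < 2 ^ k := by positivity
  rw [Int.floor_eq_iff] at h
  rw [← add_div, div_le_iff₀ h2, le_div_iff₀ h2]
  constructor <;> nlinarith [h.1, h.2]

lemma coveringNumber_le_of_mul_le {a C : ℝ} {ε : ℝ≥0∞} {N : ℝ≥0∞} (ha : 0 < a)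
    (h : ENNReal.ofReal a * N ≤ ε) (hC : 1 ≤ C * a) : N ≤ ENNReal.ofReal C * ε := by
  have hC0 : 0 ≤ C := by
    by_contra hc
    push Not at hc
    nlinarith
  calc N = ENNReal.ofReal 1 * N := by simp
    _ ≤ ENNReal.ofReal (C * a) * N := by gcongr
    _ = ENNReal.ofReal C * (ENNReal.ofReal a * N) := by
        rw [ENNReal.ofReal_mul hC0, mul_assoc]
    _ ≤ _ := by gcongr

lemma ofReal_mul_two_rpow {c a : ℝ} (hc : 0 ≤ c) :
    ENNReal.ofReal (c * 2 ^ a) = ENNReal.ofReal c * pw a := by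
  rw [ENNReal.ofReal_mul hc, ofReal_two_rpow]

lemma card_grid_le (hβ1 : β ≤ 1) (k : ℕ) :
    ((grid E k).card : ℝ≥0∞) ≤
      4 * (⨆ δ ∈ Ioo (0 : ℝ) 1, minkowskiChar E β δ) * pw (β * k) := by
  set M := ⨆ δ ∈ Ioo (0 : ℝ) 1, minkowskiChar E β δ
  have h1 : minkowskiChar E β (1 / 2 ^ (k + 1)) ≤ M := by
    refine le_iSup₂_of_le (1 / 2 ^ (k + 1)) ⟨by positivity, ?_⟩ le_rfl
    rw [div_lt_one (by positivity)]
    exact one_lt_pow₀ (by norm_num) (by omega)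
  have e : ((1 : ℝ) / 2 ^ (k + 1)) ^ β = 2 ^ (-(β * (k + 1 : ℕ))) := by
    rw [one_div, Real.inv_rpow (by positivity), ← Real.rpow_natCast, ← Real.rpow_mul (by norm_num),
      ← Real.rpow_neg (by norm_num)]
    ring_nf
  have h2 : (coveringNumber E (1 / 2 ^ (k + 1)) : ℝ≥0∞) ≤
      ENNReal.ofReal (2 * 2 ^ (β * k)) * M := by
    refine coveringNumber_le_of_mul_le (by positivity) h1 ?_
    rw [e, mul_assoc, ← Real.rpow_add (by norm_num)]
    have : (2 : ℝ) ^ (-1 : ℝ) ≤ 2 ^ (β * k + -(β * ((k + 1 : ℕ) : ℝ))) := by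
      refine Real.rpow_le_rpow_of_exponent_le (by norm_num) ?_
      push_cast; linarith
    rw [Real.rpow_neg_one] at this
    linarith
  rw [ofReal_mul_two_rpow (by norm_num)] at h2
  calc _ ≤ _ := card_le_two_mul_coveringNumber fun j hj => exists_of_mem_grid hj
    _ ≤ 2 * (ENNReal.ofReal 2 * pw (β * k) * M) := by gcongr
    _ = _ := by simp only [ENNReal.ofReal_ofNat]; ring

lemma sum_grid_indicator_le (hγ1 : γ ≤ 1) (m n : ℕ) (s : ℝ) :
    ∑ j ∈ grid E (m + n),
      {s : ℝ | |s - (j : ℝ) / 2 ^ (m + n)| ≤ 6 / 2 ^ m}.indicator (1 : ℝ → ℝ≥0∞) s ≤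
      52 * (⨆ δ ∈ Ioo (0 : ℝ) 1, assouadChar E γ δ) * pw (γ * n) := by
  classical
  set A := ⨆ δ ∈ Ioo (0 : ℝ) 1, assouadChar E γ δ
  have e0 : ∑ j ∈ grid E (m + n),
      {s : ℝ | |s - (j : ℝ) / 2 ^ (m + n)| ≤ 6 / 2 ^ m}.indicator (1 : ℝ → ℝ≥0∞) s =
      (((grid E (m + n)).filter fun j : ℤ => |s - (j : ℝ) / 2 ^ (m + n)| ≤ 6 / 2 ^ m).card
        : ℝ≥0∞) := by
    rw [Finset.card_filter]
    push_cast
    refine Finset.sum_congr rfl fun j _ => ?_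
    simp [indicator_apply]
  have h0 : (0 : ℝ) < 2 ^ m := by positivity
  have h01 : (1 : ℝ) / 2 ^ (m + n) ≤ 1 / 2 ^ m :=
    one_div_le_one_div_of_le h0 (pow_le_pow_right₀ (by norm_num) (by omega))
  have h02 : (1 : ℝ) / 2 ^ (m + n + 1) ≤ 1 / 2 ^ m :=
    one_div_le_one_div_of_le h0 (pow_le_pow_right₀ (by norm_num) (by omega))
  have hpos : (0 : ℝ) < 1 / 2 ^ m := by positivity
  -- A dilation exceeds its grid point by at most `2^(-m-n) ≤ 2^(-m)`, hence 7 on the right against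
  -- 6 on the left. The interval is `26 · 2^n` times as long as the covering intervals.
  have hlen : (s + 7 * (1 / 2 ^ m)) - (s - 6 * (1 / 2 ^ m)) = (13 : ℝ) / 2 ^ m := by ring
  have h1 : ENNReal.ofReal ((1 / 2 ^ (m + n + 1) / (13 / 2 ^ m)) ^ γ) *
      (coveringNumber (E ∩ Icc (s - 6 * (1 / 2 ^ m)) (s + 7 * (1 / 2 ^ m)))
        (1 / 2 ^ (m + n + 1)) : ℝ≥0∞) ≤ A := by
    refine le_trans ?_ (le_iSup₂_of_le (1 / 2 ^ (m + n + 1)) ⟨by positivity, ?_⟩ le_rfl)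
    · rw [← hlen]
      refine le_iSup_of_le (s - 6 * (1 / 2 ^ m)) (le_iSup₂_of_le (s + 7 * (1 / 2 ^ m)) ?_ le_rfl)
      linarith
    · rw [div_lt_one (by positivity)]
      exact one_lt_pow₀ (by norm_num) (by omega)
  have e : ((1 : ℝ) / 2 ^ (m + n + 1) / (13 / 2 ^ m)) ^ γ = (26 : ℝ) ^ (-γ) * 2 ^ (-(γ * n)) := by
    have : (1 : ℝ) / 2 ^ (m + n + 1) / (13 / 2 ^ m) = (26 * 2 ^ n)⁻¹ := by
      field_simp; ring
    rw [this, Real.inv_rpow (by positivity), Real.mul_rpow (by norm_num) (by positivity),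
      mul_inv, ← Real.rpow_natCast, ← Real.rpow_mul (by norm_num), ← Real.rpow_neg (by norm_num),
      ← Real.rpow_neg (by norm_num)]
    ring_nf
  have h2 : (coveringNumber (E ∩ Icc (s - 6 * (1 / 2 ^ m)) (s + 7 * (1 / 2 ^ m)))
        (1 / 2 ^ (m + n + 1)) : ℝ≥0∞) ≤ ENNReal.ofReal (26 * 2 ^ (γ * n)) * A := by
    refine coveringNumber_le_of_mul_le (by positivity) h1 ?_
    rw [e]
    have h3 : (26 : ℝ) ^ (-1 : ℝ) ≤ 26 ^ (-γ) :=
      Real.rpow_le_rpow_of_exponent_le (by norm_num) (by linarith)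
    rw [Real.rpow_neg_one] at h3
    have h4 : (2 : ℝ) ^ (γ * n) * 2 ^ (-(γ * n)) = 1 := by
      rw [← Real.rpow_add (by norm_num)]; simp
    calc (1 : ℝ) ≤ 26 * 26 ^ (-γ) * 1 := by linarith
      _ = _ := by rw [← h4]; ring
  rw [ofReal_mul_two_rpow (by norm_num)] at h2
  rw [e0]
  calc _ ≤ _ := card_le_two_mul_coveringNumber (k := m + n)
        (F := E ∩ Icc (s - 6 * (1 / 2 ^ m)) (s + 7 * (1 / 2 ^ m))) fun j hj => ?_
    _ ≤ 2 * (ENNReal.ofReal 26 * pw (γ * n) * A) := by gcongr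
    _ = _ := by simp only [ENNReal.ofReal_ofNat]; ring
  obtain ⟨hj, hj'⟩ := Finset.mem_filter.1 hj
  obtain ⟨t, ht, rfl⟩ := exists_of_mem_grid hj
  refine ⟨t, ⟨ht, ?_⟩, rfl⟩
  obtain ⟨h3, h4⟩ := abs_sub_le_of_floor_eq (rfl : ⌊2 ^ (m + n) * t⌋ = _)
  have h5 := abs_le.1 hj'
  have e6 : (6 : ℝ) / 2 ^ m = 6 * (1 / 2 ^ m) := by ring
  rw [e6] at h5
  constructor <;> linarith [h5.1, h5.2]

/-- The `2 ^ (-m)`-neighbourhood of `E`. -/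
def gridNbhd (E : Set ℝ) (m : ℕ) : Set ℝ := Metric.thickening (1 / 2 ^ m) E

lemma mem_gridNbhd {t r : ℝ} (ht : t ∈ E) {m : ℕ} (h : |r - t| < 1 / 2 ^ m) : r ∈ gridNbhd E m :=
  Metric.mem_thickening_iff.2 ⟨t, ht, by rwa [Real.dist_eq]⟩

lemma volume_gridNbhd_le (hE : E ⊆ Icc 1 2) (hβ1 : β ≤ 1) (m : ℕ) :
    volume (gridNbhd E m) ≤
      12 * (⨆ δ ∈ Ioo (0 : ℝ) 1, minkowskiChar E β δ) * pw (-((1 - β) * m)) := by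
  have hsub : gridNbhd E m ⊆ ⋃ j ∈ grid E m,
      Icc ((j : ℝ) / 2 ^ m - 1 / 2 ^ m) (j / 2 ^ m + 2 * (1 / 2 ^ m)) := by
    intro r hr
    obtain ⟨t, ht, h⟩ := Metric.mem_thickening_iff.1 hr
    rw [Real.dist_eq] at h
    refine mem_iUnion₂.2 ⟨_, floor_mem_grid hE ht m, ?_⟩
    obtain ⟨h3, h4⟩ := abs_sub_le_of_floor_eq (rfl : ⌊2 ^ m * t⌋ = _)
    have := abs_lt.1 h
    constructor <;> linarith [this.1, this.2]
  have hv : ENNReal.ofReal (3 * (1 / 2 ^ m)) = 3 * pw (-(m : ℝ)) := by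
    rw [ENNReal.ofReal_mul (by norm_num), ← ofReal_two_rpow, Real.rpow_neg (by norm_num),
      Real.rpow_natCast]
    simp
  calc _ ≤ _ := measure_mono hsub
    _ ≤ _ := measure_biUnion_finset_le _ _
    _ = (grid E m).card * (3 * pw (-(m : ℝ))) := by
        rw [← hv, ← nsmul_eq_mul]
        refine Finset.sum_eq_card_nsmul fun j _ => ?_
        rw [Real.volume_Icc]
        congr 1; ring
    _ ≤ 4 * (⨆ δ ∈ Ioo (0 : ℝ) 1, minkowskiChar E β δ) * pw (β * m) * (3 * pw (-(m : ℝ))) :=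
        mul_le_mul' (card_grid_le hβ1 m) le_rfl
    _ = _ := by
        rw [show -((1 - β) * m) = β * m + -(m : ℝ) by ring, pw_add]
        ring

theorem exists_dilationData (hE : E ⊆ Icc 1 2) (hβ1 : β ≤ 1)
    (hγ1 : γ ≤ 1) (hM : (⨆ δ ∈ Ioo (0 : ℝ) 1, minkowskiChar E β δ) < ∞)
    (hA : (⨆ δ ∈ Ioo (0 : ℝ) 1, assouadChar E γ δ) < ∞) :
    ∃ C₀, DilationData (grid E) (gridNbhd E) β γ C₀ := by
  set M := ⨆ δ ∈ Ioo (0 : ℝ) 1, minkowskiChar E β δ with hMdef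
  set A := ⨆ δ ∈ Ioo (0 : ℝ) 1, assouadChar E γ δ with hAdef
  have hC1 : 4 * M ≤ 1 + (12 * M + 52 * A) := by
    refine le_add_left (le_add_right ?_)
    gcongr; norm_num
  have hC2 : 52 * A ≤ 1 + (12 * M + 52 * A) := le_add_left (le_add_left le_rfl)
  have hC3 : 12 * M ≤ 1 + (12 * M + 52 * A) := le_add_left (le_add_right le_rfl)
  refine ⟨1 + (12 * M + 52 * A), le_self_add, ?_, fun k => ?_, fun m n s => ?_, fun k j hj => ?_,
    fun m => Metric.isOpen_thickening.measurableSet, ?_, ?_, fun m => ?_⟩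
  · simp only [ne_eq, ENNReal.add_eq_top, ENNReal.one_ne_top, false_or, not_or]
    exact ⟨ENNReal.mul_ne_top (by norm_num) hM.ne, ENNReal.mul_ne_top (by norm_num) hA.ne⟩
  · exact (card_grid_le hβ1 k).trans (by gcongr)
  · exact (sum_grid_indicator_le hγ1 m n s).trans (by gcongr)
  · classical
    have h := Finset.mem_Icc.1 (Finset.mem_filter.1 hj).1
    have h1 : (2 : ℝ) ^ k ≤ j := by exact_mod_cast h.1
    have h2 : (j : ℝ) ≤ 2 * 2 ^ k := by exact_mod_cast h.2
    have h3 : (0 : ℝ) < 2 ^ k := by positivity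
    rw [abs_of_nonneg (div_nonneg (by linarith) h3.le), div_le_iff₀ h3]
    exact h2
  · refine antitone_nat_of_succ_le fun m => Metric.thickening_mono ?_ _
    exact one_div_le_one_div_of_le (by positivity)
      (pow_le_pow_right₀ (by norm_num) (by omega))
  · intro r hr
    obtain ⟨t, ht, h⟩ := Metric.mem_thickening_iff.1 hr
    rw [Real.dist_eq] at h
    have h1 := (hE ht).2
    have h2 := abs_lt.1 h
    norm_num at h2
    simp only [mem_Iic]
    linarith [h2.2]
  · exact (volume_gridNbhd_le hE hβ1 m).trans (by gcongr)

end RadialMaximal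

namespace RadialMaximal

/-! ### Polar coordinates -/

section Polar

variable {V : Type*} [NormedAddCommGroup V] [NormedSpace ℝ V] [MeasurableSpace V] [BorelSpace V]
  [FiniteDimensional ℝ V] [Nontrivial V] (μ : Measure V) [μ.IsAddHaarMeasure]

lemma lintegral_polar {G : V → ℝ≥0∞} (hG : Measurable G) :
    ∫⁻ x, G x ∂μ = ∫⁻ z : Metric.sphere (0 : V) 1 × Ioi (0 : ℝ), G (z.2.1 • z.1.1)
      ∂(μ.toSphere.prod (Measure.volumeIoiPow (Module.finrank ℝ V - 1))) := by
  have h := (μ.measurePreserving_homeomorphUnitSphereProd).lintegral_comp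
    (f := fun z : Metric.sphere (0 : V) 1 × Ioi (0 : ℝ) => G (z.2.1 • z.1.1))
    (hG.comp (by fun_prop))
  rw [← h]
  have e : ∀ x : ({0}ᶜ : Set V), G ((homeomorphUnitSphereProd V x).2.1 •
      (homeomorphUnitSphereProd V x).1.1) = G x := by
    intro x
    have hx0 : (x : V) ≠ 0 := x.2
    have hx : ‖(x : V)‖ ≠ 0 := norm_ne_zero_iff.2 hx0
    simp [smul_smul, hx]
  simp_rw [e]
  rw [lintegral_subtype_comap (measurableSet_singleton _).compl, restrict_compl_singleton]

lemma lintegral_volumeIoiPow (n : ℕ) {h : ℝ → ℝ≥0∞} (hh : Measurable h) :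
    ∫⁻ r : Ioi (0 : ℝ), h r ∂(Measure.volumeIoiPow n) =
      ∫⁻ r in Ioi (0 : ℝ), ENNReal.ofReal (r ^ n) * h r := by
  rw [Measure.volumeIoiPow, lintegral_withDensity_eq_lintegral_mul _ (by fun_prop) (by fun_prop)]
  exact lintegral_subtype_comap measurableSet_Ioi
    (fun r : ℝ => ENNReal.ofReal (r ^ n) * h r)

end Polar

local notation "ℝ²" => EuclideanSpace ℝ (Fin 2)

/-- The length of the unit circle. -/
noncomputable def circleLength : ℝ≥0∞ := (volume : Measure ℝ²).toSphere univ

lemma circleLength_ne_zero : circleLength ≠ 0 := by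
  rw [circleLength, Measure.measure_univ_ne_zero]
  exact Measure.toSphere_ne_zero _

lemma circleLength_ne_top : circleLength ≠ ∞ := measure_ne_top _ _

instance : IsProbabilityMeasure (sphereMeasure 2) :=
  ⟨by rw [sphereMeasure, Measure.smul_apply, smul_eq_mul]
      exact ENNReal.inv_mul_cancel circleLength_ne_zero circleLength_ne_top⟩

lemma lintegral_volumeIoiPow_plane {h : ℝ → ℝ≥0∞} (hh : Measurable h) :
    ∫⁻ r : Ioi (0 : ℝ), h r ∂(Measure.volumeIoiPow (Module.finrank ℝ ℝ² - 1)) =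
      ∫⁻ r, h r ∂radM := by
  rw [lintegral_volumeIoiPow _ hh, lintegral_radM hh]
  simp

lemma lintegral_norm {h : ℝ → ℝ≥0∞} (hh : Measurable h) :
    ∫⁻ x : ℝ², h ‖x‖ = circleLength * ∫⁻ r, h r ∂radM := by
  rw [lintegral_polar _ (G := fun x : ℝ² => h ‖x‖) (hh.comp measurable_norm),
    ← lintegral_volumeIoiPow_plane hh, circleLength, mul_comm]
  have e : ∀ z : Metric.sphere (0 : ℝ²) 1 × Ioi (0 : ℝ), ‖z.2.1 • z.1.1‖ = z.2.1 := by
    intro z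
    rw [norm_smul, norm_eq_of_mem_sphere, mul_one, Real.norm_of_nonneg (le_of_lt z.2.2)]
  simp only [e]
  rw [lintegral_prod _ (by fun_prop)]
  simp [mul_comm]

lemma exists_isometry {e : ℝ²} (he : ‖e‖ = 1) : ∃ L : ℝ² ≃ₗᵢ[ℝ] ℂ, L e = 1 := by
  set J := Complex.orthonormalBasisOneI.repr.symm
  have h1 : ‖J e‖ = 1 := by rw [LinearIsometryEquiv.norm_map, he]
  let w : Circle := ⟨J e, by simp [Submonoid.unitSphere, h1]⟩
  refine ⟨J.trans (rotation w⁻¹), ?_⟩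
  have hw : (w : ℂ) = J e := rfl
  have : (J e) ≠ 0 := by
    intro h; simp [h] at h1
  have h2 : rotation w⁻¹ (J e) = ((w⁻¹ : Circle) : ℂ) * J e := rotation_apply _ _
  rw [LinearIsometryEquiv.trans_apply, h2, Circle.coe_inv, hw, inv_mul_cancel₀ this]

/-- The function `φ(|z|) Ψ(⟨e,z⟩/|z|)` is integrated over the plane twice: in the polar coordinates
that define `toSphere`, and, after rotating `e` to 1, in those of `ℂ`. The common radial factor `I`
is positive and finite and cancels. -/
lemma lintegral_toSphere_inner {e : ℝ²} (he : ‖e‖ = 1) {Ψ : ℝ → ℝ≥0∞} (hΨ : Measurable Ψ) :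
    ∫⁻ y : Metric.sphere (0 : ℝ²) 1, Ψ (inner ℝ e (y : ℝ²)) ∂(volume : Measure ℝ²).toSphere =
      ∫⁻ θ in Ioo (-Real.pi) Real.pi, Ψ (Real.cos θ) := by
  obtain ⟨L, hL⟩ := exists_isometry he
  set φ : ℝ → ℝ≥0∞ := (Ioo (0 : ℝ) 1).indicator 1
  have hφ : Measurable φ := measurable_one.indicator measurableSet_Ioo
  set I := ∫⁻ r in Ioi (0 : ℝ), ENNReal.ofReal r * φ r with hI
  have hI1 : I = ∫⁻ r in Ioo (0 : ℝ) 1, ENNReal.ofReal r := by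
    rw [hI]
    have : ∀ r, ENNReal.ofReal r * φ r = (Ioo (0 : ℝ) 1).indicator ENNReal.ofReal r := by
      intro r
      by_cases hr : r ∈ Ioo (0 : ℝ) 1 <;> simp only [φ, hr, indicator_of_mem, indicator_of_notMem,
        not_false_eq_true, Pi.one_apply, mul_one, mul_zero]
    simp_rw [this]
    rw [setLIntegral_indicator measurableSet_Ioo, inter_eq_left.2 Ioo_subset_Ioi_self]
  have hItop : I ≠ ∞ := by
    rw [hI1]
    refine ne_top_of_le_ne_top (b := (1 : ℝ≥0∞)) (by simp) ?_
    calc _ ≤ ∫⁻ _ in Ioo (0 : ℝ) 1, 1 := by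
          refine setLIntegral_mono measurable_const fun r hr => ?_
          simpa using hr.2.le
      _ = 1 := by simp
  have hI0 : I ≠ 0 := by
    rw [hI1]
    refine (setLIntegral_pos_iff ENNReal.measurable_ofReal).2 ?_ |>.ne'
    refine lt_of_lt_of_le ?_ (measure_mono (s := Ioo (0 : ℝ) 1) ?_)
    · simp
    · intro r hr
      exact ⟨by simpa using hr.1, hr⟩
  set G : ℝ² → ℝ≥0∞ := fun z => φ ‖z‖ * Ψ (inner ℝ e z / ‖z‖)
  have hG : Measurable G := (hφ.comp measurable_norm).mul (hΨ.comp (by fun_prop))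
  have h1 : ∫⁻ z, G z = (∫⁻ y : Metric.sphere (0 : ℝ²) 1, Ψ (inner ℝ e (y : ℝ²))
      ∂(volume : Measure ℝ²).toSphere) * I := by
    rw [lintegral_polar _ hG]
    have : ∀ z : Metric.sphere (0 : ℝ²) 1 × Ioi (0 : ℝ), G (z.2.1 • z.1.1) =
        Ψ (inner ℝ e z.1.1) * φ z.2.1 := by
      intro z
      have hz : (0 : ℝ) < z.2.1 := z.2.2
      have hn : ‖z.2.1 • z.1.1‖ = z.2.1 := by
        rw [norm_smul, norm_eq_of_mem_sphere, mul_one, Real.norm_of_nonneg hz.le]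
      simp only [G]
      rw [hn, inner_smul_right, mul_div_cancel_left₀ _ hz.ne', mul_comm]
    simp_rw [this]
    rw [lintegral_prod_mul (f := fun y : Metric.sphere (0 : ℝ²) 1 => Ψ (inner ℝ e y.1))
      (g := fun r : Ioi (0 : ℝ) => φ r.1) (hΨ.comp (by fun_prop)).aemeasurable
      (hφ.comp measurable_subtype_coe).aemeasurable, lintegral_volumeIoiPow_plane hφ,
      lintegral_radM hφ]
  have h2 : ∫⁻ z, G z = I * ∫⁻ θ in Ioo (-Real.pi) Real.pi, Ψ (Real.cos θ) := by
    have e1 : ∀ z, G z = (fun w : ℂ => φ ‖w‖ * Ψ (w.re / ‖w‖)) (L z) := by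
      intro z
      have : inner ℝ e z = (L z).re := by
        rw [← L.inner_map_map, hL]; simp [Complex.inner]
      simp only [G, this, LinearIsometryEquiv.norm_map]
    simp_rw [e1]
    have hc : Measurable fun θ => Ψ (Real.cos θ) := hΨ.comp Real.measurable_cos
    have hm' : Measurable fun r => ENNReal.ofReal r * φ r := ENNReal.measurable_ofReal.mul hφ
    have hm : Measurable fun w : ℂ => φ ‖w‖ * Ψ (w.re / ‖w‖) :=
      (hφ.comp measurable_norm).mul (hΨ.comp (by fun_prop))
    rw [L.measurePreserving.lintegral_comp hm,
      ← Complex.lintegral_comp_polarCoord_symm, polarCoord_target, hI,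
      ← lintegral_prod_mul (hm' : Measurable fun r => ENNReal.ofReal r * φ r).aemeasurable
        (hc : Measurable fun θ => Ψ (Real.cos θ)).aemeasurable, Measure.prod_restrict, ← Measure.volume_eq_prod]
    refine setLIntegral_congr_fun (measurableSet_Ioi.prod measurableSet_Ioo) fun z hz => ?_
    have hr' : (0 : ℝ) < z.1 := hz.1
    have hn : ‖Complex.polarCoord.symm z‖ = z.1 := by
      rw [Complex.norm_polarCoord_symm, abs_of_pos hr']
    have hre : (Complex.polarCoord.symm z).re = z.1 * Real.cos z.2 := by
      rw [Complex.polarCoord_symm_apply]; simp [-Complex.ofReal_cos, -Complex.ofReal_sin]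
    simp only [hn, hre, smul_eq_mul]
    rw [mul_div_cancel_left₀ _ hr'.ne', mul_assoc]
  rw [h1, mul_comm] at h2
  exact (ENNReal.mul_right_inj hI0 hItop).1 h2

end RadialMaximal

namespace RadialMaximal

local notation "ℝ²" => EuclideanSpace ℝ (Fin 2)

/-! ### Circular means of radial functions -/

lemma lintegral_Ioo_cos_le (Ψ : ℝ → ℝ≥0∞) :
    ∫⁻ θ in Ioo (-Real.pi) Real.pi, Ψ (Real.cos θ) ≤
      2 * ∫⁻ θ in Ioo 0 Real.pi, Ψ (Real.cos θ) := by
  have hsub : Ioo (-Real.pi) Real.pi ⊆ (Ioo (-Real.pi) 0 ∪ Ioo 0 Real.pi) ∪ {0} := by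
    intro θ hθ
    rcases lt_trichotomy θ 0 with h | h | h
    · exact Or.inl (Or.inl ⟨hθ.1, h⟩)
    · exact Or.inr h
    · exact Or.inl (Or.inr ⟨h, hθ.2⟩)
  have hneg : ∫⁻ θ in Ioo (-Real.pi) 0, Ψ (Real.cos θ) = ∫⁻ θ in Ioo 0 Real.pi, Ψ (Real.cos θ) := by
    rw [← (Measure.measurePreserving_neg (volume : Measure ℝ)).setLIntegral_comp_preimage_emb
      (MeasurableEquiv.neg ℝ).measurableEmbedding]
    simp
  calc _ ≤ _ := lintegral_mono_set hsub
    _ ≤ _ := lintegral_union_le _ _ _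
    _ ≤ _ := add_le_add (lintegral_union_le _ _ _) le_rfl
    _ = _ := by rw [hneg, two_mul]; simp

/-- Substitute `s = √(r² + t² - 2rt cos θ)`, so that `ds/dθ = rt sin θ / s`. As `(s² -
(r-t)²)((r+t)² - s²) = (2rt sin θ)²`, the kernel is the reciprocal of this derivative. The image
need only be contained in the interval. -/
lemma lintegral_Ioo_cos_kernel_le {r t : ℝ} (hr : 0 < r) (ht : 0 < t) (g : ℝ → ℝ≥0∞) :
    ∫⁻ θ in Ioo 0 Real.pi, g √(r ^ 2 + t ^ 2 - 2 * (r * t) * Real.cos θ) ≤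
      ∫⁻ s in Ioo |r - t| (r + t), g s * ENNReal.ofReal (circleKernel r t s) := by
  set f : ℝ → ℝ := fun θ => √(r ^ 2 + t ^ 2 - 2 * (r * t) * Real.cos θ) with hf
  have hrt : 0 < r * t := mul_pos hr ht
  have hbound : ∀ θ ∈ Ioo 0 Real.pi, -1 < Real.cos θ ∧ Real.cos θ < 1 ∧ 0 < Real.sin θ := by
    intro θ hθ
    have hs := Real.sin_pos_of_mem_Ioo hθ
    have h1 := Real.sin_sq_add_cos_sq θ
    refine ⟨?_, ?_, hs⟩ <;> nlinarith [Real.neg_one_le_cos θ, Real.cos_le_one θ]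
  have hpos : ∀ θ ∈ Ioo 0 Real.pi, 0 < r ^ 2 + t ^ 2 - 2 * (r * t) * Real.cos θ := by
    intro θ hθ
    nlinarith [(hbound θ hθ).2.1, sq_nonneg (r - t)]
  have hsq : ∀ θ ∈ Ioo 0 Real.pi, f θ ^ 2 = r ^ 2 + t ^ 2 - 2 * (r * t) * Real.cos θ :=
    fun θ hθ => Real.sq_sqrt (hpos θ hθ).le
  have hfpos : ∀ θ ∈ Ioo 0 Real.pi, 0 < f θ := fun θ hθ => Real.sqrt_pos.2 (hpos θ hθ)
  have hd : ∀ θ ∈ Ioo 0 Real.pi,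
      HasDerivWithinAt f (r * t * Real.sin θ / f θ) (Ioo 0 Real.pi) θ := by
    intro θ hθ
    have h1 : HasDerivAt (fun θ => r ^ 2 + t ^ 2 - 2 * (r * t) * Real.cos θ)
        (-(2 * (r * t) * -Real.sin θ)) θ :=
      ((Real.hasDerivAt_cos θ).const_mul (2 * (r * t))).const_sub (r ^ 2 + t ^ 2)
    have h2 := (h1.sqrt (hpos θ hθ).ne').hasDerivWithinAt (s := Ioo 0 Real.pi)
    refine h2.congr_deriv ?_
    have h3 := Real.sqrt_pos.2 (hpos θ hθ)
    rw [div_eq_div_iff (by positivity) (hfpos θ hθ).ne']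
    simp only [hf]
    ring
  have hinj : InjOn f (Ioo 0 Real.pi) := by
    intro a ha b hb hab
    have h1 : f a ^ 2 = f b ^ 2 := by rw [hab]
    rw [hsq a ha, hsq b hb] at h1
    have h2 : Real.cos a = Real.cos b := by
      have : 2 * (r * t) * (Real.cos a - Real.cos b) = 0 := by linarith
      rcases mul_eq_zero.1 this with h | h <;> linarith
    exact Real.injOn_cos ⟨ha.1.le, ha.2.le⟩ ⟨hb.1.le, hb.2.le⟩ h2
  have himg : f '' Ioo 0 Real.pi ⊆ Ioo |r - t| (r + t) := by
    rintro _ ⟨θ, hθ, rfl⟩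
    obtain ⟨h1, h2, -⟩ := hbound θ hθ
    refine ⟨abs_lt_of_sq_lt_sq ?_ (hfpos θ hθ).le, lt_of_pow_lt_pow_left₀ 2 (by linarith) ?_⟩
    · rw [hsq θ hθ]; nlinarith
    · rw [hsq θ hθ]; nlinarith
  calc _ = ∫⁻ θ in Ioo 0 Real.pi, ENNReal.ofReal |r * t * Real.sin θ / f θ| *
        (g (f θ) * ENNReal.ofReal (circleKernel r t (f θ))) := by
        refine setLIntegral_congr_fun measurableSet_Ioo fun θ hθ => ?_
        obtain ⟨h1, h2, h3⟩ := hbound θ hθ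
        have h4 := hfpos θ hθ
        have e : circleKernel r t (f θ) = f θ / (r * t * Real.sin θ) := by
          have : (f θ ^ 2 - (r - t) ^ 2) * ((r + t) ^ 2 - f θ ^ 2) =
              (2 * (r * t * Real.sin θ)) ^ 2 := by
            rw [hsq θ hθ]
            have := Real.sin_sq θ
            linear_combination (-4 * (r * t) ^ 2) * this
          rw [circleKernel, this, Real.sqrt_sq (by positivity)]
          field_simp
        have h5 : 0 < r * t * Real.sin θ := mul_pos hrt h3
        rw [e, abs_of_pos (div_pos h5 h4), mul_left_comm (ENNReal.ofReal _),
          ← ENNReal.ofReal_mul (by positivity)]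
        have : r * t * Real.sin θ / f θ * (f θ / (r * t * Real.sin θ)) = 1 := by field_simp
        rw [this]; simp [hf]
    _ = ∫⁻ s in f '' Ioo 0 Real.pi, g s * ENNReal.ofReal (circleKernel r t s) :=
        (lintegral_image_eq_lintegral_abs_deriv_mul measurableSet_Ioo hd hinj
          fun s => g s * ENNReal.ofReal (circleKernel r t s)).symm
    _ ≤ _ := lintegral_mono_set himg

lemma lintegral_sphereMeasure_le {x : ℝ²} (hx : x ≠ 0) {t : ℝ} (ht : 0 < t) {g : ℝ → ℝ≥0∞}
    (hg : Measurable g) :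
    ∫⁻ y, g ‖x - t • (y : ℝ²)‖ ∂(sphereMeasure 2) ≤ circleLength⁻¹ * (2 *
      ∫⁻ s in Ioo |‖x‖ - t| (‖x‖ + t), g s * ENNReal.ofReal (circleKernel ‖x‖ t s)) := by
  have hr : 0 < ‖x‖ := norm_pos_iff.2 hx
  set r := ‖x‖ with hrdef
  set e := r⁻¹ • x with he
  have he1 : ‖e‖ = 1 := by
    rw [he, norm_smul, norm_inv, Real.norm_of_nonneg hr.le, ← hrdef, inv_mul_cancel₀ hr.ne']
  set Ψ : ℝ → ℝ≥0∞ := fun c => g √(r ^ 2 + t ^ 2 - 2 * (r * t) * c) with hΨdef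
  have hΨ : Measurable Ψ := hg.comp (by fun_prop)
  have h1 : ∀ y : Metric.sphere (0 : ℝ²) 1, g ‖x - t • (y : ℝ²)‖ = Ψ (inner ℝ e (y : ℝ²)) := by
    intro y
    have : ‖x - t • (y : ℝ²)‖ ^ 2 = r ^ 2 + t ^ 2 - 2 * (r * t) * inner ℝ e (y : ℝ²) := by
      rw [norm_sub_sq_real, norm_smul, norm_eq_of_mem_sphere, inner_smul_right, he,
        real_inner_smul_left, Real.norm_of_nonneg ht.le]
      field_simp
      ring
    simp only [Ψ]
    rw [← this, Real.sqrt_sq (norm_nonneg _)]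
  simp_rw [h1]
  rw [sphereMeasure, lintegral_smul_measure, smul_eq_mul, lintegral_toSphere_inner he1 hΨ]
  refine mul_le_mul' le_rfl ((lintegral_Ioo_cos_le Ψ).trans (mul_le_mul' le_rfl ?_))
  exact lintegral_Ioo_cos_kernel_le hr ht g

variable {E : Set ℝ}

lemma lintegral_sphereMeasure_le_totalMax (hE : E ⊆ Icc 1 2) {x : ℝ²} (hx : x ≠ 0) {t : ℝ}
    (ht : t ∈ E) {g : ℝ → ℝ≥0∞} (hg : Measurable g) :
    ∫⁻ y, g ‖x - t • (y : ℝ²)‖ ∂(sphereMeasure 2) ≤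
      circleLength⁻¹ * 6 * totalMax (grid E) (gridNbhd E) g ‖x‖ := by
  have ht1 := (hE ht).1
  calc _ ≤ _ := lintegral_sphereMeasure_le hx (by linarith) hg
    _ ≤ circleLength⁻¹ * (2 * (3 * totalMax (grid E) (gridNbhd E) g ‖x‖)) := by
        refine mul_le_mul' le_rfl (mul_le_mul' le_rfl ?_)
        exact lintegral_kernel_le_totalMax (fun k => floor_mem_grid hE ht k) ht1 (hE ht).2
          (fun m h => mem_gridNbhd ht h) hg (norm_pos_iff.2 hx)
    _ = _ := by ring

/-- By the kernel formula the law of `|x - ty|` is absolutely continuous. This holds for every `x ≠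
0` and `t > 0`, so changing a profile on a null set of radii affects no mean, even for uncountably
many `t` at once. -/
lemma ae_norm_sub_smul_notMem {N : Set ℝ} (hN : volume N = 0) {x : ℝ²} (hx : x ≠ 0) {t : ℝ}
    (ht : 0 < t) : ∀ᵐ y : Metric.sphere (0 : ℝ²) 1 ∂(sphereMeasure 2), ‖x - t • (y : ℝ²)‖ ∉ N := by
  set N' := toMeasurable volume N
  have hN' : MeasurableSet N' := measurableSet_toMeasurable _ _
  have h0 : volume N' = 0 := by rw [measure_toMeasurable, hN]
  have hm : Measurable (N'.indicator (1 : ℝ → ℝ≥0∞)) := measurable_one.indicator hN'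
  have hm2 : Measurable fun y : Metric.sphere (0 : ℝ²) 1 =>
      N'.indicator (1 : ℝ → ℝ≥0∞) ‖x - t • (y : ℝ²)‖ := hm.comp (by fun_prop)
  have h := lintegral_sphereMeasure_le hx ht hm
  have h2 : ∫⁻ s in Ioo |‖x‖ - t| (‖x‖ + t),
      N'.indicator (1 : ℝ → ℝ≥0∞) s * ENNReal.ofReal (circleKernel ‖x‖ t s) = 0 := by
    refine (lintegral_congr_ae ?_).trans lintegral_zero
    refine ae_restrict_of_ae ?_
    have : ∀ᵐ s : ℝ, s ∉ N' := measure_eq_zero_iff_ae_notMem.1 h0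
    filter_upwards [this] with s hs
    simp [hs]
  rw [h2, mul_zero, mul_zero, nonpos_iff_eq_zero, lintegral_eq_zero_iff hm2] at h
  filter_upwards [h] with y hy hyN
  have : ‖x - t • (y : ℝ²)‖ ∈ N' := subset_toMeasurable _ _ hyN
  simp [this] at hy

lemma ae_norm_notMem {N : Set ℝ} (hN : volume N = 0) : ∀ᵐ x : ℝ², ‖x‖ ∉ N := by
  set N' := toMeasurable volume N
  have hN' : MeasurableSet N' := measurableSet_toMeasurable _ _
  have h0 : volume N' = 0 := by rw [measure_toMeasurable, hN]
  have hm : Measurable (N'.indicator (1 : ℝ → ℝ≥0∞)) := measurable_one.indicator hN'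
  have hm2 : Measurable fun y : ℝ² => N'.indicator (1 : ℝ → ℝ≥0∞) ‖y‖ := hm.comp measurable_norm
  have h := lintegral_norm hm
  have h2 : ∫⁻ s, N'.indicator (1 : ℝ → ℝ≥0∞) s ∂radM = 0 := by
    rw [lintegral_indicator_one hN']
    exact radM_absolutelyContinuous h0
  rw [h2, mul_zero, lintegral_eq_zero_iff hm2] at h
  filter_upwards [h] with y hy hyN
  have : ‖y‖ ∈ N' := subset_toMeasurable _ _ hyN
  simp [this] at hy

/-- `f₀` itself need not be measurable. In polar coordinates `f` does not depend on the angle, so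
almost every section shows that `f₀` is almost everywhere strongly measurable on `(0, ∞)`; the
radius 0 is put into the exceptional set. -/
lemma IsRadial.exists_stronglyMeasurable {f : ℝ² → ℂ} (hf : IsRadial f)
    (hm : AEStronglyMeasurable f volume) :
    ∃ F : ℝ → ℂ, StronglyMeasurable F ∧ ∃ N : Set ℝ, volume N = 0 ∧
      ∀ x, ‖x‖ ∉ N → f x = F ‖x‖ := by
  obtain ⟨f₀, hf₀⟩ := hf
  set ν := Measure.volumeIoiPow (Module.finrank ℝ ℝ² - 1)
  have hP := (volume : Measure ℝ²).measurePreserving_homeomorphUnitSphereProd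
  have h1 : AEStronglyMeasurable (fun z : ({0}ᶜ : Set ℝ²) => f z)
      ((volume : Measure ℝ²).comap (↑)) := by
    have : MeasurePreserving ((↑) : ({0}ᶜ : Set ℝ²) → ℝ²) ((volume : Measure ℝ²).comap (↑))
        (volume.restrict {0}ᶜ) :=
      measurePreserving_subtype_coe (measurableSet_singleton _).compl
    exact hm.restrict.comp_measurePreserving this
  have h2 : AEStronglyMeasurable (fun z : Metric.sphere (0 : ℝ²) 1 × Ioi (0 : ℝ) => f₀ z.2)
      ((volume : Measure ℝ²).toSphere.prod ν) := by
    have := h1.comp_measurePreserving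
      (hP.symm (homeomorphUnitSphereProd ℝ²).toMeasurableEquiv)
    refine this.congr (.of_forall fun z => ?_)
    have hn : ‖((homeomorphUnitSphereProd ℝ²).symm z : ℝ²)‖ = z.2 := by
      simp [norm_smul, abs_of_pos (show (0 : ℝ) < z.2 from z.2.2)]
    show f ((homeomorphUnitSphereProd ℝ²).symm z : ℝ²) = f₀ z.2
    rw [hf₀, hn]
  have h3 := h2.prodMk_left
  have : NeZero (volume : Measure ℝ²).toSphere := ⟨Measure.toSphere_ne_zero _⟩
  obtain ⟨_, h4⟩ := h3.exists
  have h5 : AEStronglyMeasurable f₀ (volume.restrict (Ioi 0)) := by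
    have hac : (volume : Measure ℝ).comap ((↑) : Ioi (0 : ℝ) → ℝ) ≪ ν := by
      refine withDensity_absolutelyContinuous' (by fun_prop) (.of_forall fun r => ?_)
      have : (0 : ℝ) < r := r.2
      simpa using this
    have h6 := AEStronglyMeasurable.mono_ac hac h4
    have hemb := MeasurableEmbedding.subtype_coe (measurableSet_Ioi (a := (0 : ℝ)))
    have h7 := hemb.map_comap volume
    rw [Subtype.range_coe] at h7
    rw [← h7, hemb.aestronglyMeasurable_map_iff]
    exact h6
  obtain ⟨F, hF, hFe⟩ := h5
  rw [Filter.EventuallyEq, ae_restrict_iff' measurableSet_Ioi] at hFe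
  refine ⟨F, hF, {s | ¬ (s ∈ Ioi 0 → f₀ s = F s)} ∪ {0}, ?_, fun x hx => ?_⟩
  · rw [measure_union_null_iff]
    exact ⟨hFe, by simp⟩
  · simp only [mem_union, not_or, mem_ofPred_eq, not_not, mem_singleton_iff] at hx
    rw [hf₀]
    exact hx.1 (lt_of_le_of_ne (norm_nonneg _) (Ne.symm hx.2))

end RadialMaximal

namespace RadialMaximal

local notation "ℝ²" => EuclideanSpace ℝ (Fin 2)

/-! ### Existence and measurability of the maximal function -/

variable {E : Set ℝ} {β γ p q : ℝ} {C₀ : ℝ≥0∞}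

lemma measurable_totalMax {Z : ℕ → Finset ℤ} {S : ℕ → Set ℝ} (D : DilationData Z S β γ C₀)
    {g : ℝ → ℝ≥0∞} (hg : Measurable g) : Measurable (totalMax Z S g) :=
  (measurable_outerMax D hg).add (measurable_innerMax hg)

/-- The majorant of the maximal function for `E` is bounded from `L^p` to `L^q`. -/
def TotalBound (E : Set ℝ) (p q : ℝ) : Prop :=
  ∃ C : ℝ≥0∞, C ≠ ∞ ∧ ∀ g : ℝ → ℝ≥0∞, Measurable g →
    lnorm q radM (totalMax (grid E) (gridNbhd E) g) ≤ C * lnorm p radM g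

instance : IsLocallyFiniteMeasure radM :=
  IsLocallyFiniteMeasure.withDensity_ofReal continuous_id

lemma ae_norm_of_ae_radM {P : ℝ → Prop} (h : ∀ᵐ r ∂radM, P r) : ∀ᵐ x : ℝ², P ‖x‖ := by
  set N := toMeasurable radM {r | ¬ P r}
  have hN : MeasurableSet N := measurableSet_toMeasurable _ _
  have h0 : radM N = 0 := by rw [measure_toMeasurable]; exact h
  have hm : Measurable (N.indicator (1 : ℝ → ℝ≥0∞)) := measurable_one.indicator hN
  have hm2 : Measurable fun y : ℝ² => N.indicator (1 : ℝ → ℝ≥0∞) ‖y‖ := hm.comp measurable_norm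
  have h1 := lintegral_norm hm
  rw [lintegral_indicator_one hN, h0, mul_zero, lintegral_eq_zero_iff hm2] at h1
  filter_upwards [h1] with y hy
  by_contra hyN
  have : ‖y‖ ∈ N := subset_toMeasurable _ _ hyN
  simp [this] at hy

lemma ae_lt_top_of_lnorm {α : Type*} [MeasurableSpace α] {μ : Measure α} {f : α → ℝ≥0∞}
    (hp : 0 < p) (hf : Measurable f) (h : lnorm p μ f ≠ ∞) : ∀ᵐ a ∂μ, f a < ∞ := by
  have h1 : ∫⁻ a, f a ^ p ∂μ ≠ ∞ := by
    rw [← lnorm_rpow hp]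
    exact ENNReal.rpow_ne_top_of_nonneg hp.le h
  filter_upwards [ae_lt_top (hf.pow_const p) h1] with a ha
  exact (ENNReal.rpow_lt_top_iff_of_pos hp).1 ha

lemma ae_ne_zero : ∀ᵐ x : ℝ², x ≠ 0 := by
  have : (volume : Measure ℝ²) {0} = 0 := measure_singleton _
  exact measure_eq_zero_iff_ae_notMem.1 this

/-! ### The maximal function of a measurable radial profile -/

section Profile

variable {F : ℝ → ℂ}

lemma measurable_profile_comp (hF : StronglyMeasurable F) (x : ℝ²) (t : ℝ) :
    StronglyMeasurable fun y : Metric.sphere (0 : ℝ²) 1 => F ‖x - t • (y : ℝ²)‖ :=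
  hF.comp_measurable (g := fun y : Metric.sphere (0 : ℝ²) 1 => ‖x - t • (y : ℝ²)‖) (by fun_prop)

lemma lintegral_profile_le (hE : E ⊆ Icc 1 2) (hF : StronglyMeasurable F) {x : ℝ²} (hx : x ≠ 0)
    {t : ℝ} (ht : t ∈ E) :
    ∫⁻ y, ‖F ‖x - t • (y : ℝ²)‖‖ₑ ∂(sphereMeasure 2) ≤
      circleLength⁻¹ * 6 * totalMax (grid E) (gridNbhd E) (fun s => ‖F s‖ₑ) ‖x‖ :=
  lintegral_sphereMeasure_le_totalMax hE hx ht hF.measurable.enorm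

lemma integrable_profile (hE : E ⊆ Icc 1 2) (hF : StronglyMeasurable F) {x : ℝ²} (hx : x ≠ 0)
    (hfin : totalMax (grid E) (gridNbhd E) (fun s => ‖F s‖ₑ) ‖x‖ < ∞) {t : ℝ} (ht : t ∈ E) :
    Integrable (fun y : Metric.sphere (0 : ℝ²) 1 => F ‖x - t • (y : ℝ²)‖) (sphereMeasure 2) :=
  ⟨(measurable_profile_comp hF x t).aestronglyMeasurable,
    (lintegral_profile_le hE hF hx ht).trans_lt
      (ENNReal.mul_lt_top (ENNReal.mul_lt_top
        (ENNReal.inv_lt_top.2 (pos_iff_ne_zero.2 circleLength_ne_zero)) (by norm_num)) hfin)⟩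

lemma maximalFunction_profile_le (hE : E ⊆ Icc 1 2) (hF : StronglyMeasurable F) {x : ℝ²}
    (hx : x ≠ 0) : maximalFunction E (fun z : ℝ² => F ‖z‖) x ≤
      circleLength⁻¹ * 6 * totalMax (grid E) (gridNbhd E) (fun s => ‖F s‖ₑ) ‖x‖ :=
  iSup₂_le fun _ ht => (enorm_integral_le_lintegral_enorm _).trans
    (lintegral_profile_le hE hF hx ht)

lemma maximalFunction_le_add {f g : ℝ² → ℂ} {x : ℝ²} {c : ℝ≥0∞}
    (hf : ∀ t ∈ E, Integrable (fun y : Metric.sphere (0 : ℝ²) 1 => f (x - t • (y : ℝ²)))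
      (sphereMeasure 2))
    (hg : ∀ t ∈ E, Integrable (fun y : Metric.sphere (0 : ℝ²) 1 => g (x - t • (y : ℝ²)))
      (sphereMeasure 2))
    (hc : ∀ t ∈ E, ∫⁻ y : Metric.sphere (0 : ℝ²) 1,
      ‖f (x - t • (y : ℝ²)) - g (x - t • (y : ℝ²))‖ₑ ∂(sphereMeasure 2) ≤ c) :
    maximalFunction E f x ≤ maximalFunction E g x + c := by
  refine iSup₂_le fun t ht => ?_
  have e : sphericalMean t f x = sphericalMean t g x +
      ∫ y : Metric.sphere (0 : ℝ²) 1, (f (x - t • (y : ℝ²)) - g (x - t • (y : ℝ²)))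
        ∂(sphereMeasure 2) := by
    rw [integral_sub (hf t ht) (hg t ht)]
    simp only [sphericalMean]
    ring
  rw [e]
  refine (enorm_add_le _ _).trans (add_le_add ?_ ?_)
  · exact le_iSup₂_of_le t ht le_rfl
  · exact (enorm_integral_le_lintegral_enorm _).trans (hc t ht)

/-- A supremum of continuous functions, over any index set, is lower semicontinuous. -/
lemma measurable_maximalFunction_of_continuous {h : ℝ² → ℂ} (hh : Continuous h) {M : ℝ}
    (hM : ∀ x, ‖h x‖ ≤ M) : Measurable (maximalFunction E h) := by
  refine LowerSemicontinuous.measurable ?_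
  refine lowerSemicontinuous_biSup fun t _ => Continuous.lowerSemicontinuous ?_
  refine Continuous.enorm ?_
  refine continuous_of_dominated (bound := fun _ => M) (fun x => ?_) (fun x => ?_)
    (integrable_const _) ?_
  · exact (hh.comp (by fun_prop)).aestronglyMeasurable
  · exact .of_forall fun y => hM _
  · exact .of_forall fun y => hh.comp (by fun_prop)

/-- Continuous compactly supported profiles approximate `F` within `2^(-j)` in `L^p`. The error
majorants have a sum finite almost everywhere, hence tend to zero, and the maximal function is
almost everywhere the infimum over `j` of the approximating one plus its error. -/
lemma aemeasurable_maximalFunction_profile (hE : E ⊆ Icc 1 2)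
    (D : DilationData (grid E) (gridNbhd E) β γ C₀) (hp : 1 ≤ p) (hB : TotalBound E p p)
    (hF : StronglyMeasurable F) (hFp : lnorm p radM (fun s => ‖F s‖ₑ) ≠ ∞) :
    (∀ᵐ x : ℝ², totalMax (grid E) (gridNbhd E) (fun s => ‖F s‖ₑ) ‖x‖ < ∞) ∧
      AEMeasurable (maximalFunction E fun z : ℝ² => F ‖z‖) := by
  have hp0 : 0 < p := by linarith
  have hp' : ENNReal.ofReal p ≠ 0 := by simpa using hp0
  obtain ⟨C, hC, H⟩ := hB
  have hln : ∀ G : ℝ → ℂ, eLpNorm G (ENNReal.ofReal p) radM = lnorm p radM (fun s => ‖G s‖ₑ) := by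
    intro G
    rw [eLpNorm_eq_lintegral_rpow_enorm_toReal hp' ENNReal.ofReal_ne_top,
      ENNReal.toReal_ofReal hp0.le, lnorm]
  have hfin : ∀ᵐ x : ℝ², totalMax (grid E) (gridNbhd E) (fun s => ‖F s‖ₑ) ‖x‖ < ∞ :=
    ae_norm_of_ae_radM (ae_lt_top_of_lnorm hp0 (measurable_totalMax D hF.measurable.enorm)
      (ne_top_of_le_ne_top (ENNReal.mul_ne_top hC hFp) (H _ hF.measurable.enorm)))
  refine ⟨hfin, ?_⟩
  have hmem : MemLp F (ENNReal.ofReal p) radM :=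
    ⟨hF.aestronglyMeasurable, by rw [hln]; exact hFp.lt_top⟩
  have happ : ∀ j : ℕ, ∃ h : ℝ → ℂ, Continuous h ∧ HasCompactSupport h ∧
      lnorm p radM (fun s => ‖F s - h s‖ₑ) ≤ pw (-(1 * j)) := by
    intro j
    obtain ⟨h, h1, h2, h3, -⟩ := hmem.exists_hasCompactSupport_eLpNorm_sub_le
      ENNReal.ofReal_ne_top (pw_ne_zero (-(1 * j)))
    rw [hln] at h2
    exact ⟨h, h3, h1, h2⟩
  choose h hcont hcpt hle using happ
  set err : ℕ → ℝ → ℝ≥0∞ := fun j =>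
    totalMax (grid E) (gridNbhd E) (fun s => ‖F s - h j s‖ₑ) with herr
  have hsub : ∀ j, StronglyMeasurable fun s => F s - h j s :=
    fun j => hF.sub (hcont j).stronglyMeasurable
  have herrm : ∀ j, Measurable (err j) := fun j => measurable_totalMax D (hsub j).measurable.enorm
  have hsum : ∀ᵐ r ∂radM, ∑' j, err j r < ∞ := by
    refine ae_lt_top_of_lnorm hp0 (Measurable.tsum herrm) ?_
    refine ne_top_of_le_ne_top ?_ (lnorm_tsum_le hp herrm)
    refine ne_top_of_le_ne_top (ENNReal.mul_ne_top hC (tsum_pw_lt_top one_pos).ne) ?_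
    rw [← ENNReal.tsum_mul_left]
    refine ENNReal.tsum_le_tsum fun j => (H _ (hsub j).measurable.enorm).trans ?_
    exact mul_le_mul' le_rfl (hle j)
  set K := circleLength⁻¹ * 6
  have hK : K ≠ ∞ := ENNReal.mul_ne_top (ENNReal.inv_ne_top.2 circleLength_ne_zero) (by norm_num)
  have hbdd : ∀ j, ∃ M : ℝ, ∀ x : ℝ², ‖h j ‖x‖‖ ≤ M := by
    intro j
    obtain ⟨M, hM⟩ := (hcont j).norm.bounded_above_of_compact_support (hcpt j).norm
    exact ⟨M, fun x => by simpa using hM ‖x‖⟩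
  choose M hM using hbdd
  refine ⟨fun x => ⨅ j, (maximalFunction E (fun z : ℝ² => h j ‖z‖) x + K * err j ‖x‖), ?_, ?_⟩
  · refine Measurable.iInf fun j => Measurable.add ?_ ?_
    · exact measurable_maximalFunction_of_continuous ((hcont j).comp continuous_norm) (hM j)
    · exact ((herrm j).comp measurable_norm).const_mul _
  · filter_upwards [hfin, ae_norm_of_ae_radM hsum, ae_ne_zero] with x hx1 hx2 hx3
    have hFi := fun t (ht : t ∈ E) => integrable_profile hE hF hx3 hx1 ht
    have hhi : ∀ j, ∀ t ∈ E, Integrable (fun y : Metric.sphere (0 : ℝ²) 1 =>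
        h j ‖x - t • (y : ℝ²)‖) (sphereMeasure 2) := fun j t _ =>
      Integrable.of_bound (C := M j)
        (measurable_profile_comp (hcont j).stronglyMeasurable x t).aestronglyMeasurable
        (.of_forall fun y => hM j _)
    have h1 : ∀ j, ∀ t ∈ E, ∫⁻ y : Metric.sphere (0 : ℝ²) 1,
        ‖F ‖x - t • (y : ℝ²)‖ - h j ‖x - t • (y : ℝ²)‖‖ₑ ∂(sphereMeasure 2) ≤ K * err j ‖x‖ :=
      fun j t ht => lintegral_profile_le hE (hsub j) hx3 ht
    refine le_antisymm (le_iInf fun j => maximalFunction_le_add hFi (hhi j) (h1 j)) ?_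
    have h0 : Filter.Tendsto (fun j => maximalFunction E (fun z : ℝ² => F ‖z‖) x +
        K * err j ‖x‖ + K * err j ‖x‖) Filter.atTop
        (nhds (maximalFunction E (fun z : ℝ² => F ‖z‖) x + K * 0 + K * 0)) := by
      have := ENNReal.Tendsto.const_mul (a := K)
        (ENNReal.tendsto_atTop_zero_of_tsum_ne_top hx2.ne) (Or.inr hK)
      exact (tendsto_const_nhds.add this).add this
    rw [mul_zero, add_zero, add_zero] at h0
    refine ge_of_tendsto' h0 fun j => (iInf_le _ j).trans ?_
    refine add_le_add (maximalFunction_le_add (hhi j) hFi fun t ht => ?_) le_rfl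
    simp_rw [enorm_sub_rev (h j _)]
    exact h1 j t ht

end Profile

lemma maximalFunction_congr {f g : ℝ² → ℂ} {x : ℝ²} (h : ∀ t ∈ E,
    (fun y : Metric.sphere (0 : ℝ²) 1 => f (x - t • (y : ℝ²))) =ᵐ[sphereMeasure 2]
      fun y => g (x - t • (y : ℝ²))) : maximalFunction E f x = maximalFunction E g x :=
  iSup_congr fun t => iSup_congr fun ht => by
    rw [sphericalMean, sphericalMean, integral_congr_ae (h t ht)]

lemma comp_ae_eq_profile (hE : E ⊆ Icc 1 2) {f : ℝ² → ℂ} {F : ℝ → ℂ} {N : Set ℝ}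
    (hN : volume N = 0) (hfF : ∀ x, ‖x‖ ∉ N → f x = F ‖x‖) {x : ℝ²} (hx : x ≠ 0) {t : ℝ}
    (ht : t ∈ E) : (fun y : Metric.sphere (0 : ℝ²) 1 => f (x - t • (y : ℝ²))) =ᵐ[sphereMeasure 2]
      fun y => F ‖x - t • (y : ℝ²)‖ := by
  filter_upwards [ae_norm_sub_smul_notMem hN hx (by linarith [(hE ht).1] : 0 < t)] with y hy
  exact hfF _ hy

/-- As `t ≤ 2`, for `|x| < n` only the profile below `n + 2` matters, and this truncation lies in
`L^p`. A bound at a single small exponent, applied at `Q₁`, therefore serves all larger ones. -/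
theorem maximalWellDefined_of_locally (hE : E ⊆ Icc 1 2)
    (D : DilationData (grid E) (gridNbhd E) β γ C₀) (hp : 1 ≤ p) (hB : TotalBound E p p)
    {f : ℝ² → ℂ} {F : ℝ → ℂ} {N : Set ℝ} (hF : StronglyMeasurable F) (hN : volume N = 0)
    (hfF : ∀ x, ‖x‖ ∉ N → f x = F ‖x‖)
    (hloc : ∀ n : ℕ, ∫⁻ s in Iio (n : ℝ), ‖F s‖ₑ ^ p ∂radM ≠ ∞) : MaximalWellDefined E f := by
  have hp0 : 0 < p := by linarith
  set G : ℕ → ℝ → ℂ := fun n => (Iio ((n + 2 : ℕ) : ℝ)).indicator F with hGdef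
  have hG : ∀ n, StronglyMeasurable (G n) := fun n => hF.indicator measurableSet_Iio
  have hGp : ∀ n, lnorm p radM (fun s => ‖G n s‖ₑ) ≠ ∞ := by
    intro n
    refine ENNReal.rpow_ne_top_of_nonneg (by positivity) ?_
    have : ∀ s, ‖G n s‖ₑ ^ p = (Iio ((n + 2 : ℕ) : ℝ)).indicator (fun s => ‖F s‖ₑ ^ p) s := by
      intro s
      by_cases hs : s ∈ Iio ((n + 2 : ℕ) : ℝ)
      · simp only [hGdef, indicator_of_mem hs]
      · simp only [hGdef, indicator_of_notMem hs]
        simp [hp0]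
    simp_rw [this]
    rw [lintegral_indicator measurableSet_Iio]
    exact hloc _
  have hmain := fun n => aemeasurable_maximalFunction_profile hE D hp hB (hG n) (hGp n)
  have heq : ∀ (n : ℕ) (x : ℝ²), x ≠ 0 → ‖x‖ < n → ∀ t ∈ E,
      (fun y : Metric.sphere (0 : ℝ²) 1 => f (x - t • (y : ℝ²))) =ᵐ[sphereMeasure 2]
      fun y => G n ‖x - t • (y : ℝ²)‖ := by
    intro n x hx hxn t ht
    refine (comp_ae_eq_profile hE hN hfF hx ht).trans (.of_forall fun y => ?_)
    have h2 := hE ht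
    have : ‖x - t • (y : ℝ²)‖ < ((n + 2 : ℕ) : ℝ) := by
      refine (norm_sub_le _ _).trans_lt ?_
      rw [norm_smul, norm_eq_of_mem_sphere, Real.norm_of_nonneg (by linarith [h2.1])]
      push_cast
      linarith [h2.2]
    exact (indicator_of_mem (f := F) (by exact this : _ ∈ Iio ((n + 2 : ℕ) : ℝ))).symm
  constructor
  · filter_upwards [ae_all_iff.2 fun n => (hmain n).1, ae_ne_zero] with x hx1 hx2 t ht
    obtain ⟨n, hn⟩ := exists_nat_gt ‖x‖
    exact (integrable_profile hE (hG n) hx2 (hx1 n) ht).congr (heq n x hx2 hn t ht).symm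
  · have hun : (⋃ n : ℕ, Metric.ball (0 : ℝ²) n) = univ := by
      refine eq_univ_of_forall fun x => ?_
      obtain ⟨n, hn⟩ := exists_nat_gt ‖x‖
      exact mem_iUnion.2 ⟨n, by simpa using hn⟩
    rw [← Measure.restrict_univ (μ := (volume : Measure ℝ²)), ← hun, aemeasurable_iUnion_iff]
    intro n
    refine (hmain n).2.restrict.congr ?_
    filter_upwards [ae_restrict_mem Metric.isOpen_ball.measurableSet,
      ae_restrict_of_ae ae_ne_zero] with x hx1 hx2
    exact (maximalFunction_congr (heq n x hx2 (by simpa using hx1))).symm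

end RadialMaximal

namespace RadialMaximal

local notation "ℝ²" => EuclideanSpace ℝ (Fin 2)

/-! ### Strong type bounds -/

variable {E : Set ℝ} {β γ p q : ℝ} {C₀ : ℝ≥0∞}

lemma radM_Iio_lt_top (n : ℕ) : radM (Iio (n : ℝ)) < ∞ := by
  have h : radM (Iio (n : ℝ)) = ∫⁻ r in Ioi (0 : ℝ) ∩ Iio (n : ℝ), ENNReal.ofReal r := by
    have := setLIntegral_radM measurable_one (measurableSet_Iio (a := (n : ℝ)))
    simpa using this
  rw [h]
  calc _ ≤ ∫⁻ _ in Ioi (0 : ℝ) ∩ Iio (n : ℝ), (n : ℝ≥0∞) := by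
        refine setLIntegral_mono measurable_const fun r hr => ?_
        rw [← ENNReal.ofReal_natCast]
        exact ENNReal.ofReal_le_ofReal (le_of_lt hr.2)
    _ < ∞ := by
        rw [setLIntegral_const, Ioi_inter_Iio, Real.volume_Ioo]
        exact ENNReal.mul_lt_top (by simp) ENNReal.ofReal_lt_top

lemma setLIntegral_rpow_ne_top_of_le {p₁ : ℝ} (hp1 : 0 ≤ p₁) (hpp : p₁ ≤ p) {g : ℝ → ℝ≥0∞}
    (hg : ∫⁻ r, g r ^ p ∂radM ≠ ∞) (n : ℕ) :
    ∫⁻ r in Iio (n : ℝ), g r ^ p₁ ∂radM ≠ ∞ := by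
  have h : ∀ a : ℝ≥0∞, a ^ p₁ ≤ 1 + a ^ p := by
    intro a
    rcases le_total a 1 with ha | ha
    · exact le_add_right (ENNReal.rpow_le_one ha hp1)
    · exact le_add_left (ENNReal.rpow_le_rpow_of_exponent_le ha hpp)
  refine ne_top_of_le_ne_top ?_ (lintegral_mono fun r => h (g r))
  rw [lintegral_add_left measurable_const]
  refine ENNReal.add_ne_top.2 ⟨by simpa using (radM_Iio_lt_top n).ne, ?_⟩
  exact ne_top_of_le_ne_top hg (setLIntegral_le_lintegral _ _)

lemma lnorm_norm (hp : 0 < p) {h : ℝ → ℝ≥0∞} (hh : Measurable h) :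
    lnorm p (volume : Measure ℝ²) (fun x => h ‖x‖) = circleLength ^ (1 / p) * lnorm p radM h := by
  rw [lnorm, lintegral_norm (hh.pow_const p), ENNReal.mul_rpow_of_nonneg _ _ (by positivity), lnorm]

lemma ae_eq_profile {f : ℝ² → ℂ} {F : ℝ → ℂ} {N : Set ℝ} (hN : volume N = 0)
    (hfF : ∀ x, ‖x‖ ∉ N → f x = F ‖x‖) : f =ᵐ[volume] fun x => F ‖x‖ := by
  filter_upwards [ae_norm_notMem hN] with x hx
  exact hfF x hx

lemma ae_maximalFunction_le (hE : E ⊆ Icc 1 2) {f : ℝ² → ℂ} {F : ℝ → ℂ} {N : Set ℝ}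
    (hF : StronglyMeasurable F) (hN : volume N = 0) (hfF : ∀ x, ‖x‖ ∉ N → f x = F ‖x‖) :
    ∀ᵐ x : ℝ², maximalFunction E f x ≤
      circleLength⁻¹ * 6 * totalMax (grid E) (gridNbhd E) (fun s => ‖F s‖ₑ) ‖x‖ := by
  filter_upwards [ae_ne_zero] with x hx
  rw [maximalFunction_congr (g := fun z => F ‖z‖) fun t ht =>
    comp_ae_eq_profile hE hN hfF hx ht]
  exact maximalFunction_profile_le hE hF hx

lemma eLpNorm_ofReal {α ε : Type*} [MeasurableSpace α] [TopologicalSpace ε]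
    [ContinuousENorm ε] (μ : Measure α)
    (hp : 0 < p) (f : α → ε) : eLpNorm f (ENNReal.ofReal p) μ = lnorm p μ (fun x => ‖f x‖ₑ) := by
  rw [eLpNorm_eq_lintegral_rpow_enorm_toReal (by simpa using hp) ENNReal.ofReal_ne_top,
    ENNReal.toReal_ofReal hp.le, lnorm]

/-- Polar coordinates change the norms only by powers of the circle length. The means exist because
`L^p` is locally contained in `L^{p₁}`. -/
theorem radialStrongType_of_totalBound (hE : E ⊆ Icc 1 2)
    (D : DilationData (grid E) (gridNbhd E) β γ C₀) {p₁ : ℝ} (hp1 : 1 ≤ p₁) (hpp : p₁ ≤ p)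
    (hq : 0 < q) (hB1 : TotalBound E p₁ p₁) (hB : TotalBound E p q) :
    RadialStrongType 2 E (ENNReal.ofReal p) (ENNReal.ofReal q) := by
  have hp0 : 0 < p := by linarith
  obtain ⟨C, hC, H⟩ := hB
  set K := circleLength⁻¹ * 6
  have hK : K ≠ ∞ := ENNReal.mul_ne_top (ENNReal.inv_ne_top.2 circleLength_ne_zero) (by norm_num)
  set C' := K * (circleLength ^ (1 / q) * (C * circleLength ^ (-(1 / p))))
  have hc : ∀ a : ℝ, circleLength ^ a ≠ ∞ := fun a =>
    ENNReal.rpow_ne_top_of_ne_zero circleLength_ne_zero circleLength_ne_top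
  have hC' : C' ≠ ∞ := ENNReal.mul_ne_top hK (ENNReal.mul_ne_top (hc _)
    (ENNReal.mul_ne_top hC (hc _)))
  refine ⟨C'.toNNReal, fun f hf hfp => ?_⟩
  obtain ⟨F, hF, N, hN, hfF⟩ := hf.exists_stronglyMeasurable hfp.aestronglyMeasurable
  have hg := hF.measurable.enorm
  have hnorm : eLpNorm f (ENNReal.ofReal p) volume =
      circleLength ^ (1 / p) * lnorm p radM fun s => ‖F s‖ₑ := by
    rw [eLpNorm_congr_ae (ae_eq_profile hN hfF), eLpNorm_ofReal _ hp0, lnorm_norm hp0 hg]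
  have hfin : lnorm p radM (fun s => ‖F s‖ₑ) ≠ ∞ := by
    intro h
    have := hfp.eLpNorm_lt_top
    rw [hnorm, h, ENNReal.mul_top] at this
    · exact lt_irrefl _ this
    · simp [ENNReal.rpow_eq_zero_iff, circleLength_ne_zero, circleLength_ne_top]
  refine ⟨maximalWellDefined_of_locally hE D hp1 hB1 hF hN hfF fun n => ?_, ?_⟩
  · refine setLIntegral_rpow_ne_top_of_le (by linarith) hpp ?_ n
    rw [← lnorm_rpow hp0]
    exact ENNReal.rpow_ne_top_of_nonneg hp0.le hfin
  · have hT := measurable_totalMax D hg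
    have hT2 : Measurable fun x : ℝ² =>
      totalMax (grid E) (gridNbhd E) (fun s => ‖F s‖ₑ) ‖x‖ := hT.comp measurable_norm
    rw [ENNReal.coe_toNNReal hC', eLpNorm_ofReal _ hq]
    simp only [enorm_eq_self]
    calc _ ≤ _ := lnorm_mono_ae hq (ae_maximalFunction_le hE hF hN hfF)
      _ = K * (circleLength ^ (1 / q) *
          lnorm q radM (totalMax (grid E) (gridNbhd E) fun s => ‖F s‖ₑ)) := by
          rw [lnorm_const_mul hq _ hT2, lnorm_norm hq hT]
      _ ≤ K * (circleLength ^ (1 / q) * (C * lnorm p radM fun s => ‖F s‖ₑ)) :=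
          mul_le_mul' le_rfl (mul_le_mul' le_rfl (H _ hg))
      _ = _ := by
          have h1 : circleLength ^ (-(1 / p)) * circleLength ^ (1 / p) = 1 := by
            rw [← ENNReal.rpow_add _ _ circleLength_ne_zero circleLength_ne_top]; simp
          rw [hnorm]
          calc _ = K * (circleLength ^ (1 / q) * (C * (1 * lnorm p radM fun s => ‖F s‖ₑ))) := by
                rw [one_mul]
            _ = _ := by rw [← h1]; simp only [C']; ring

/-- Averaging does not increase a supremum, but circles are null sets in the plane. The radii at
which the profile exceeds the essential bound form a null set by polar coordinates; setting the
profile to 0 there changes no mean. -/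
theorem radialStrongType_top (hE : E ⊆ Icc 1 2)
    (D : DilationData (grid E) (gridNbhd E) β γ C₀) {p₁ : ℝ} (hp1 : 1 ≤ p₁)
    (hB1 : TotalBound E p₁ p₁) : RadialStrongType 2 E ∞ ∞ := by
  refine ⟨1, fun f hf hfp => ?_⟩
  obtain ⟨F, hF, N, hN, hfF⟩ := hf.exists_stronglyMeasurable hfp.aestronglyMeasurable
  have hg := hF.measurable.enorm
  set B := eLpNorm f ∞ volume with hBdef
  have hBtop : B ≠ ∞ := hfp.eLpNorm_ne_top
  set A : Set ℝ := {s | B < ‖F s‖ₑ}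
  have hA : MeasurableSet A := measurableSet_lt measurable_const hg
  have hA0 : radM A = 0 := by
    have h1 : ∀ᵐ x : ℝ², ‖f x‖ₑ ≤ B := by
      rw [hBdef, eLpNorm_exponent_top]; exact ae_le_eLpNormEssSup
    have h2 := lintegral_norm (measurable_one.indicator hA : Measurable (A.indicator 1))
    have h3 : ∫⁻ x : ℝ², A.indicator (1 : ℝ → ℝ≥0∞) ‖x‖ = 0 := by
      refine (lintegral_congr_ae ?_).trans lintegral_zero
      filter_upwards [h1, ae_eq_profile hN hfF] with x hx1 hx2
      have : ‖x‖ ∉ A := by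
        simp only [A, mem_ofPred_eq, not_lt]
        rw [← hx2]; exact hx1
      simp [this]
    rw [h3, lintegral_indicator_one hA] at h2
    exact (mul_eq_zero.1 h2.symm).resolve_left circleLength_ne_zero
  have hA1 : volume (A ∩ Ioi 0) = 0 := by
    have hac : volume.restrict (Ioi (0 : ℝ)) ≪ radM := by
      refine withDensity_absolutelyContinuous' (by fun_prop) ?_
      filter_upwards [ae_restrict_mem measurableSet_Ioi] with r hr
      have : (0 : ℝ) < r := hr
      simpa using this
    rw [← Measure.restrict_apply hA]
    exact hac hA0
  set N' := N ∪ (A ∩ Ioi 0 ∪ {0})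
  have hN' : volume N' = 0 :=
    measure_union_null hN (measure_union_null hA1 (by simp))
  set F' : ℝ → ℂ := Aᶜ.indicator F
  have hF' : StronglyMeasurable F' := hF.indicator hA.compl
  have hF'le : ∀ s, ‖F' s‖ₑ ≤ B := by
    intro s
    by_cases hs : s ∈ A
    · simp [F', hs]
    · simp only [F', indicator_of_mem (show s ∈ Aᶜ from hs)]
      simpa [A] using hs
  have hfF' : ∀ x, ‖x‖ ∉ N' → f x = F' ‖x‖ := by
    intro x hx
    simp only [N', mem_union, not_or, mem_singleton_iff] at hx
    have h0 : 0 < ‖x‖ := lt_of_le_of_ne (norm_nonneg _) (Ne.symm hx.2.2)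
    have hA' : ‖x‖ ∈ Aᶜ := fun h => hx.2.1 ⟨h, h0⟩
    rw [hfF x hx.1]
    exact (indicator_of_mem hA' F).symm
  refine ⟨maximalWellDefined_of_locally hE D hp1 hB1 hF' hN' hfF' fun n => ?_, ?_⟩
  · refine ne_top_of_le_ne_top ?_ (lintegral_mono (g := fun _ => B ^ p₁) fun s =>
      ENNReal.rpow_le_rpow (hF'le s) (by linarith))
    rw [setLIntegral_const]
    exact ENNReal.mul_ne_top (ENNReal.rpow_ne_top_of_nonneg (by linarith) hBtop)
      (radM_Iio_lt_top n).ne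
  · rw [eLpNorm_exponent_top, ENNReal.coe_one, one_mul]
    refine essSup_le_of_ae_le _ ?_
    filter_upwards [ae_ne_zero] with x hx
    rw [enorm_eq_self, maximalFunction_congr (g := fun z => F' ‖z‖) fun t ht =>
      comp_ae_eq_profile hE hN' hfF' hx ht]
    refine iSup₂_le fun t _ => (enorm_integral_le_lintegral_enorm _).trans ?_
    refine (lintegral_mono (g := fun _ => B) fun y => hF'le _).trans ?_
    simp

end RadialMaximal

namespace RadialMaximal

local notation "ℝ²" => EuclideanSpace ℝ (Fin 2)

/-! ### Restricted weak type bounds -/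

/-! ### Lorentz norms and distribution functions -/

section Lorentz

variable {α : Type*} [MeasurableSpace α] {μ : Measure α} {g : α → ℝ≥0∞} {p : ℝ}

lemma ofReal_mul_measure_rpow_le (hp : 0 ≤ p) (t : ℝ) :
    ENNReal.ofReal t * μ {a | ENNReal.ofReal t < g a} ^ p ≤
      ∫⁻ s in Ioi (0 : ℝ), μ {a | ENNReal.ofReal s < g a} ^ p := by
  calc _ = ∫⁻ _ in Ioc (0 : ℝ) t, μ {a | ENNReal.ofReal t < g a} ^ p := by
        rw [setLIntegral_const, Real.volume_Ioc, sub_zero, mul_comm]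
    _ ≤ ∫⁻ s in Ioc (0 : ℝ) t, μ {a | ENNReal.ofReal s < g a} ^ p := by
        refine setLIntegral_mono' measurableSet_Ioc fun s hs => ?_
        refine ENNReal.rpow_le_rpow (measure_mono fun a ha => ?_) hp
        exact (ENNReal.ofReal_le_ofReal hs.2).trans_lt ha
    _ ≤ _ := lintegral_mono_set Ioc_subset_Ioi_self

/-- The embedding of the Lorentz space `L^{p,1}` into `L^p`. -/
lemma lnorm_le_lintegral_measure_rpow (hp : 1 ≤ p) (hg : Measurable g) :
    lnorm p μ g ≤ ENNReal.ofReal p ^ (1 / p) *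
      ∫⁻ s in Ioi (0 : ℝ), μ {a | ENNReal.ofReal s < g a} ^ (1 / p) := by
  have hp0 : 0 < p := by linarith
  have hip : 0 < 1 / p := by positivity
  set lam : ℝ → ℝ≥0∞ := fun s => μ {a | ENNReal.ofReal s < g a} with hlam
  set Φ := ∫⁻ s in Ioi (0 : ℝ), lam s ^ (1 / p) with hΦ
  have hpp : ENNReal.ofReal p ≠ 0 := by simpa using hp0
  by_cases hΦtop : Φ = ∞
  · rw [hΦtop, ENNReal.mul_top]
    · exact le_top
    · simp [ENNReal.rpow_eq_zero_iff, hp0]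
  have hant : Antitone lam := fun s t hst => measure_mono fun a ha =>
    (ENNReal.ofReal_le_ofReal hst).trans_lt ha
  have hweak : ∀ t, ENNReal.ofReal t * lam t ^ (1 / p) ≤ Φ :=
    ofReal_mul_measure_rpow_le hip.le
  have hfin : ∀ᵐ a ∂μ, g a < ∞ := by
    have h1 : ∀ n : ℕ, (n : ℝ≥0∞) * μ {a | g a = ∞} ^ (1 / p) ≤ Φ := by
      intro n
      refine le_trans ?_ (hweak n)
      rw [ENNReal.ofReal_natCast]
      refine mul_le_mul' le_rfl (ENNReal.rpow_le_rpow (measure_mono fun a ha => ?_) hip.le)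
      have : g a = ∞ := ha
      simp [this]
    have h2 : μ {a | g a = ∞} = 0 := by
      by_contra h
      have h3 : μ {a | g a = ∞} ^ (1 / p) ≠ 0 := by
        rwa [ne_eq, ENNReal.rpow_eq_zero_iff_of_pos hip]
      obtain ⟨n, hn⟩ := ENNReal.exists_nat_mul_gt h3 hΦtop
      exact absurd (h1 n) (not_le.2 hn)
    filter_upwards [measure_eq_zero_iff_ae_notMem.1 h2] with a ha
    exact lt_top_iff_ne_top.2 ha
  rw [lnorm_le_iff hp0, ENNReal.mul_rpow_of_nonneg _ _ hp0.le, ← ENNReal.rpow_mul,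
    one_div_mul_cancel hp0.ne', ENNReal.rpow_one]
  have e1 : ∫⁻ a, g a ^ p ∂μ = ∫⁻ a, ENNReal.ofReal ((g a).toReal ^ p) ∂μ := by
    refine lintegral_congr_ae ?_
    filter_upwards [hfin] with a ha
    rw [← ENNReal.ofReal_rpow_of_nonneg ENNReal.toReal_nonneg hp0.le, ENNReal.ofReal_toReal ha.ne]
  rw [e1, lintegral_rpow_eq_lintegral_meas_lt_mul μ (.of_forall fun a => ENNReal.toReal_nonneg)
    hg.ennreal_toReal.aemeasurable hp0]
  refine mul_le_mul' le_rfl ?_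
  -- The weak bound `t λ(t)^(1/p) ≤ Φ` turns `t^(p-1) λ(t)` into at most `Φ^(p-1) λ(t)^(1/p)`, which
  -- integrates to `Φ^p`.
  have hstep : ∀ t ∈ Ioi (0 : ℝ), μ {a | t < (g a).toReal} * ENNReal.ofReal (t ^ (p - 1)) ≤
      Φ ^ (p - 1) * lam t ^ (1 / p) := by
    intro t ht
    have ht0 : (0 : ℝ) < t := ht
    have h1 : μ {a | t < (g a).toReal} ≤ lam t := measure_mono fun a ha =>
      (ENNReal.ofReal_lt_iff_lt_toReal ht0.le (by
        intro h
        have : t < (g a).toReal := ha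
        simp [h] at this
        linarith)).2 ha
    have h2 : lam t = lam t ^ (1 / p) * (lam t ^ (1 / p)) ^ (p - 1) := by
      rw [← ENNReal.rpow_mul, ← ENNReal.rpow_add_of_nonneg _ _ hip.le
        (mul_nonneg hip.le (by linarith))]
      have : 1 / p + 1 / p * (p - 1) = 1 := by field_simp; ring
      rw [this, ENNReal.rpow_one]
    calc _ ≤ lam t * ENNReal.ofReal (t ^ (p - 1)) := mul_le_mul' h1 le_rfl
      _ = (ENNReal.ofReal t * lam t ^ (1 / p)) ^ (p - 1) * lam t ^ (1 / p) := by
          nth_rw 1 [h2]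
          rw [ENNReal.mul_rpow_of_nonneg _ _ (by linarith), ENNReal.ofReal_rpow_of_pos ht0]
          ring
      _ ≤ _ := mul_le_mul' (ENNReal.rpow_le_rpow (hweak t) (by linarith)) le_rfl
  calc _ ≤ ∫⁻ t in Ioi (0 : ℝ), Φ ^ (p - 1) * lam t ^ (1 / p) :=
        setLIntegral_mono' measurableSet_Ioi hstep
    _ = Φ ^ (p - 1) * Φ := by
        rw [lintegral_const_mul _ (hant.measurable.pow_const _)]
    _ = Φ ^ p := by
        nth_rw 2 [← ENNReal.rpow_one Φ]
        rw [← ENNReal.rpow_add_of_nonneg _ _ (by linarith) (by norm_num)]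
        ring_nf

end Lorentz

variable {E : Set ℝ} {β γ p q : ℝ} {C₀ : ℝ≥0∞}

/-- Test with the level set itself: `σ |G| ≤ W |G|^(1-y)`. Dividing requires finite positive
measure, so `G` is exhausted by its bounded parts. -/
lemma mul_radM_rpow_le_of_setLIntegral {h : ℝ → ℝ≥0∞} (hh : Measurable h) {y : ℝ} (hy : 0 < y)
    (hy1 : y ≤ 1) {W : ℝ≥0∞} (hW : ∀ G : Set ℝ, MeasurableSet G → radM G ≠ ∞ →
      ∫⁻ r in G, h r ∂radM ≤ W * radM G ^ (1 - y)) (σ : ℝ≥0∞) :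
    σ * radM {r | σ < h r} ^ y ≤ W := by
  set G : Set ℝ := {r | σ < h r}
  have hG : MeasurableSet G := measurableSet_lt measurable_const hh
  have hn : ∀ n : ℕ, σ * radM (G ∩ Iio (n : ℝ)) ^ y ≤ W := by
    intro n
    set A := G ∩ Iio (n : ℝ)
    have hA : MeasurableSet A := hG.inter measurableSet_Iio
    have hAtop : radM A ≠ ∞ := ((measure_mono inter_subset_right).trans_lt (radM_Iio_lt_top n)).ne
    by_cases h0 : radM A = 0
    · simp [h0, hy]
    have h1 : σ * radM A ≤ W * radM A ^ (1 - y) := by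
      refine le_trans ?_ (hW A hA hAtop)
      rw [← setLIntegral_const]
      exact setLIntegral_mono hh fun r hr => le_of_lt hr.1
    have h2 : radM A ^ (1 - y) ≠ 0 := by simp [ENNReal.rpow_eq_zero_iff, h0, hAtop]
    have h3 : radM A ^ (1 - y) ≠ ∞ := ENNReal.rpow_ne_top_of_nonneg (by linarith) hAtop
    have h4 : radM A = radM A ^ y * radM A ^ (1 - y) := by
      rw [← ENNReal.rpow_add_of_nonneg _ _ hy.le (by linarith)]; simp
    rw [h4, ← mul_assoc] at h1
    conv_rhs at h1 => rw [← h4]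
    exact (ENNReal.mul_le_mul_iff_left h2 h3).1 h1
  have hun : G = ⋃ n : ℕ, G ∩ Iio (n : ℝ) := by
    rw [← inter_iUnion, eq_comm, inter_eq_left]
    intro r _
    obtain ⟨n, hn⟩ := exists_nat_gt r
    exact mem_iUnion.2 ⟨n, hn⟩
  have hmono : Monotone fun n : ℕ => G ∩ Iio (n : ℝ) := fun m n hmn =>
    inter_subset_inter_right _ (Iio_subset_Iio (by exact_mod_cast hmn))
  have hlim := tendsto_measure_iUnion_atTop (μ := radM) hmono
  rw [← hun] at hlim
  by_cases hσ : σ = ∞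
  · have : G = ∅ := by ext r; simp [G, hσ]
    simp [this, hy]
  · have h5 := ENNReal.Tendsto.const_mul (a := σ)
      ((ENNReal.continuous_rpow_const (y := y)).tendsto _ |>.comp hlim) (Or.inr hσ)
    exact le_of_tendsto' h5 hn

lemma mul_measure_rpow_le_lnorm {α : Type*} [MeasurableSpace α] {μ : Measure α} {h : α → ℝ≥0∞}
    (hq : 0 < q) (hh : Measurable h) (σ : ℝ≥0∞) :
    σ * μ {a | σ < h a} ^ (1 / q) ≤ lnorm q μ h := by
  have h1 : σ ^ q * μ {a | σ < h a} ≤ ∫⁻ a, h a ^ q ∂μ := by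
    refine le_trans ?_ (mul_meas_ge_le_lintegral (hh.pow_const q) (σ ^ q))
    refine mul_le_mul' le_rfl (measure_mono fun a ha => ?_)
    exact ENNReal.rpow_le_rpow (le_of_lt ha) hq.le
  have h2 := ENNReal.rpow_le_rpow h1 (by positivity : 0 ≤ 1 / q)
  rwa [ENNReal.mul_rpow_of_nonneg _ _ (by positivity), ← ENNReal.rpow_mul,
    mul_one_div_cancel hq.ne', ENNReal.rpow_one] at h2

lemma volume_norm_preimage {A : Set ℝ} (hA : MeasurableSet A) :
    (volume : Measure ℝ²) {x | ‖x‖ ∈ A} = circleLength * radM A := by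
  have h := lintegral_norm (measurable_one.indicator hA : Measurable (A.indicator 1))
  rw [lintegral_indicator_one hA] at h
  rw [← h]
  exact (lintegral_indicator_one (measurable_norm hA)).symm

lemma lorentzOneNorm_eq {f : ℝ² → ℂ} {F : ℝ → ℂ} {N : Set ℝ} (hF : StronglyMeasurable F)
    (hN : volume N = 0) (hfF : ∀ x, ‖x‖ ∉ N → f x = F ‖x‖) (hp : 0 < p) :
    lorentzOneNorm p f = ENNReal.ofReal p * circleLength ^ (1 / p) *
      ∫⁻ s in Ioi (0 : ℝ), radM (superlevel (fun s => ‖F s‖ₑ) s) ^ (1 / p) := by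
  have h : ∀ s : ℝ, (volume {x | ENNReal.ofReal s < ‖f x‖ₑ}) ^ (1 / p) =
      circleLength ^ (1 / p) * radM (superlevel (fun s => ‖F s‖ₑ) s) ^ (1 / p) := by
    intro s
    rw [← ENNReal.mul_rpow_of_nonneg _ _ (by positivity),
      ← volume_norm_preimage (measurableSet_superlevel hF.measurable.enorm s)]
    congr 1
    refine measure_congr ?_
    filter_upwards [ae_eq_profile hN hfF] with x hx
    exact congrArg (fun z : ℂ => ENNReal.ofReal s < ‖z‖ₑ) hx
  have hm : Antitone fun s => radM (superlevel (fun s => ‖F s‖ₑ) s) := fun s t hst =>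
    measure_mono fun a ha => (ENNReal.ofReal_le_ofReal hst).trans_lt ha
  unfold lorentzOneNorm
  simp_rw [h]
  rw [lintegral_const_mul _ (hm.measurable.pow_const _), mul_assoc]

/-- The outer part is still of strong type at the endpoint, hence bounded from `L^{p,1} ⊂ L^p`; only
the inner part needs the restricted bound. The level is divided equally between the two. -/
theorem radialRestrictedWeakType_of_bounds (hE : E ⊆ Icc 1 2)
    (D : DilationData (grid E) (gridNbhd E) β γ C₀) {p₁ : ℝ} (hp1 : 1 ≤ p₁) (hpp : p₁ ≤ p)
    (hpq : p ≤ q) (hB1 : TotalBound E p₁ p₁) (hβ : β < 1) (hγ : 0 ≤ γ)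
    (hcrit : 2 * (1 / p) - 1 ≤ (1 - β) * (1 / q)) (hε : 1 / p - (1 - β) * (1 / q) < 1 / 2)
    (hx : 1 / p < 1) (h1 : 1 / p = 2 * (1 / q)) (h2 : 1 / p - (1 - γ) * (1 / q) = 1 / 2) :
    RadialRestrictedWeakType 2 E p q := by
  have hp : 1 ≤ p := hp1.trans hpp
  have hp0 : 0 < p := by linarith
  have hq0 : 0 < q := by linarith
  have hy : 0 < 1 / q := by positivity
  have hy1 : 1 / q ≤ 1 := by linarith
  obtain ⟨Co, hCo, Ho⟩ := lnorm_outerMax_le D hβ hp hpq hcrit hε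
  obtain ⟨Ci, hCi, Hi⟩ := setLIntegral_innerMax_le D hγ hy hx h1 h2
  set K := circleLength⁻¹ * 6
  have hK : K ≠ ∞ := ENNReal.mul_ne_top (ENNReal.inv_ne_top.2 circleLength_ne_zero) (by norm_num)
  have hK0 : K ≠ 0 := mul_ne_zero (ENNReal.inv_ne_zero.2 circleLength_ne_top) (by norm_num)
  have hc : ∀ a : ℝ, circleLength ^ a ≠ ∞ := fun a =>
    ENNReal.rpow_ne_top_of_ne_zero circleLength_ne_zero circleLength_ne_top
  set P := ENNReal.ofReal p * circleLength ^ (1 / p)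
  have hP : P ≠ ∞ := ENNReal.mul_ne_top ENNReal.ofReal_ne_top (hc _)
  have hP0 : P ≠ 0 := mul_ne_zero (by simpa using hp0)
    (by simp [ENNReal.rpow_eq_zero_iff, circleLength_ne_zero, circleLength_ne_top])
  set W := Co * ENNReal.ofReal p ^ (1 / p) + Ci
  have hW : W ≠ ∞ := ENNReal.add_ne_top.2 ⟨ENNReal.mul_ne_top hCo
    (ENNReal.rpow_ne_top_of_nonneg (by positivity) ENNReal.ofReal_ne_top), hCi⟩
  set C' := 2 * K * circleLength ^ (1 / q) * W * P⁻¹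
  have hC' : C' ≠ ∞ := ENNReal.mul_ne_top (ENNReal.mul_ne_top (ENNReal.mul_ne_top
    (ENNReal.mul_ne_top (by norm_num) hK) (hc _)) hW) (ENNReal.inv_ne_top.2 hP0)
  refine ⟨C'.toNNReal, fun f hf hfm hfp => ?_⟩
  obtain ⟨F, hF, N, hN, hfF⟩ := hf.exists_stronglyMeasurable hfm
  have hg := hF.measurable.enorm
  set g : ℝ → ℝ≥0∞ := fun s => ‖F s‖ₑ
  set Φ := ∫⁻ s in Ioi (0 : ℝ), radM (superlevel g s) ^ (1 / p) with hΦ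
  rw [lorentzOneNorm_eq hF hN hfF hp0] at hfp ⊢
  have hΦtop : Φ ≠ ∞ := by
    intro h
    change P * Φ < ∞ at hfp
    rw [h, ENNReal.mul_top hP0] at hfp
    exact lt_irrefl _ hfp
  have hlp : lnorm p radM g ≤ ENNReal.ofReal p ^ (1 / p) * Φ :=
    lnorm_le_lintegral_measure_rpow hp hg
  have hfin : lnorm p radM g ≠ ∞ := ne_top_of_le_ne_top (ENNReal.mul_ne_top
    (ENNReal.rpow_ne_top_of_nonneg (by positivity) ENNReal.ofReal_ne_top) hΦtop) hlp
  refine ⟨maximalWellDefined_of_locally hE D hp1 hB1 hF hN hfF fun n => ?_, ?_⟩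
  · refine setLIntegral_rpow_ne_top_of_le (by linarith) hpp ?_ n
    rw [← lnorm_rpow hp0]
    exact ENNReal.rpow_ne_top_of_nonneg hp0.le hfin
  rw [ENNReal.coe_toNNReal hC']
  refine iSup₂_le fun s hs => ?_
  set σ := ENNReal.ofReal s / (2 * K)
  have h2K0 : 2 * K ≠ 0 := mul_ne_zero (by norm_num) hK0
  have h2K : 2 * K ≠ ∞ := ENNReal.mul_ne_top (by norm_num) hK
  have hσ : ENNReal.ofReal s = 2 * K * σ := (ENNReal.mul_div_cancel h2K0 h2K).symm
  have hom := measurable_outerMax D hg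
  have him : Measurable (innerMax (grid E) g) := measurable_innerMax hg
  set A : Set ℝ := {r | σ < outerMax (grid E) (gridNbhd E) g r}
  set B : Set ℝ := {r | σ < innerMax (grid E) g r}
  have hA : MeasurableSet A := measurableSet_lt measurable_const hom
  have hB : MeasurableSet B := measurableSet_lt measurable_const him
  have hsub : volume {x | ENNReal.ofReal s < maximalFunction E f x} ≤
      circleLength * (radM A + radM B) := by
    calc _ ≤ volume {x : ℝ² | ‖x‖ ∈ A ∪ B} := by
          refine measure_mono_ae ?_
          filter_upwards [ae_maximalFunction_le hE hF hN hfF] with x hx hx2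
          have h3 : 2 * K * σ < K * totalMax (grid E) (gridNbhd E) g ‖x‖ := by
            rw [← hσ]; exact lt_of_lt_of_le hx2 hx
          by_contra hcon
          have hcon' : ‖x‖ ∉ A ∧ ‖x‖ ∉ B := by
            simpa only [mem_union, not_or] using (show ¬ (‖x‖ ∈ A ∪ B) from hcon)
          simp only [A, B, mem_ofPred_eq, not_lt] at hcon'
          refine absurd h3 (not_lt.2 ?_)
          calc K * totalMax (grid E) (gridNbhd E) g ‖x‖ ≤ K * (σ + σ) :=
                mul_le_mul' le_rfl (add_le_add hcon'.1 hcon'.2)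
            _ = _ := by ring
      _ = circleLength * radM (A ∪ B) := volume_norm_preimage (hA.union hB)
      _ ≤ _ := mul_le_mul' le_rfl (measure_union_le _ _)
  have hAle : σ * radM A ^ (1 / q) ≤ Co * ENNReal.ofReal p ^ (1 / p) * Φ := by
    refine (mul_measure_rpow_le_lnorm hq0 hom σ).trans ((Ho g hg).trans ?_)
    rw [mul_assoc]
    exact mul_le_mul' le_rfl hlp
  have hBle : σ * radM B ^ (1 / q) ≤ Ci * Φ := by
    refine mul_radM_rpow_le_of_setLIntegral him hy hy1 (fun G hG hGt => ?_) σ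
    refine (Hi g hg G hG hGt).trans (le_of_eq ?_)
    ring
  calc _ ≤ ENNReal.ofReal s * (circleLength * (radM A + radM B)) ^ (1 / q) :=
        mul_le_mul' le_rfl (ENNReal.rpow_le_rpow hsub hy.le)
    _ ≤ 2 * K * σ * (circleLength ^ (1 / q) * (radM A ^ (1 / q) + radM B ^ (1 / q))) := by
        rw [hσ, ENNReal.mul_rpow_of_nonneg _ _ hy.le]
        exact mul_le_mul' le_rfl (mul_le_mul' le_rfl
          (ENNReal.rpow_add_le_add_rpow _ _ hy.le hy1))
    _ = 2 * K * circleLength ^ (1 / q) * (σ * radM A ^ (1 / q) + σ * radM B ^ (1 / q)) := by ring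
    _ ≤ 2 * K * circleLength ^ (1 / q) * (Co * ENNReal.ofReal p ^ (1 / p) * Φ + Ci * Φ) :=
        mul_le_mul' le_rfl (add_le_add hAle hBle)
    _ = 2 * K * circleLength ^ (1 / q) * W * (P⁻¹ * P) * Φ := by
        rw [ENNReal.inv_mul_cancel hP0 hP]; ring
    _ = _ := by simp only [C', P]; ring

end RadialMaximal

namespace RadialMaximal

/-! ### The exponents -/

variable {β γ x y : ℝ}

lemma smallExp_le_assouad (hy : 0 ≤ y) (m n : ℕ) :
    smallExp β γ x y m n ≤ -((2 * y - x) * m) - (1 / 2 - x + (1 - γ) * y) * n := by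
  have := mul_le_mul_of_nonneg_left (min_le_right (β * (m + n : ℝ)) (γ * n)) hy
  unfold smallExp
  linarith

lemma smallExp_le_minkowski (hy : 0 ≤ y) (m n : ℕ) :
    smallExp β γ x y m n ≤ -((2 * y - x - β * y) * m) - (1 / 2 - x + (1 - β) * y) * n := by
  have := mul_le_mul_of_nonneg_left (min_le_left (β * (m + n : ℝ)) (γ * n)) hy
  unfold smallExp
  linarith

/-- The decay of the pieces of the majorant near the origin when the Assouad exponent alone is not
sufficient: the exponents decay away from the ray `n = β / (γ - β) * m`. -/
lemma exists_smallExp_le_ray (hβγ : β < γ) (hy : 0 ≤ y)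
    (hM : x - (1 - β) * y < 1 / 2) (hA : 1 / 2 < x - (1 - γ) * y) :
    ∃ ε > 0, ∀ m n : ℕ, smallExp β γ x y m n ≤
      (-(β / 2) + γ * x - y * (2 * γ - β - γ * β)) / (γ - β) * m -
        ε * |(n : ℝ) - β / (γ - β) * m| := by
  have hd : 0 < γ - β := by linarith
  set κ := β / (γ - β) with hκ
  have hκd : κ * (γ - β) = β := div_mul_cancel₀ _ hd.ne'
  set c := (-(β / 2) + γ * x - y * (2 * γ - β - γ * β)) / (γ - β) with hc
  -- On the ray `β(m+n) = γn`, so the Minkowski and Assouad bounds agree there; `c` is their common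
  -- slope.
  have hc1 : c = -(2 * y - x) - (1 / 2 - x + (1 - γ) * y) * κ := by
    rw [hc, hκ]; field_simp; ring
  have hc2 : c = -(2 * y - x - β * y) - (1 / 2 - x + (1 - β) * y) * κ := by
    rw [hc, hκ]; field_simp; ring
  set ε := min (x - (1 - γ) * y - 1 / 2) (1 / 2 - x + (1 - β) * y)
  have hε1 : ε ≤ x - (1 - γ) * y - 1 / 2 := min_le_left _ _
  have hε2 : ε ≤ 1 / 2 - x + (1 - β) * y := min_le_right _ _
  refine ⟨ε, lt_min (by linarith) (by linarith), fun m n => ?_⟩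
  rcases le_total ((n : ℝ) - κ * m) 0 with h | h
  · rw [abs_of_nonpos h]
    have h1 := smallExp_le_assouad (β := β) (γ := γ) (x := x) hy m n
    have h2 := mul_le_mul_of_nonneg_right hε1 (by linarith : 0 ≤ -((n : ℝ) - κ * m))
    rw [hc1]; linarith
  · rw [abs_of_nonneg h]
    have h1 := smallExp_le_minkowski (β := β) (γ := γ) (x := x) hy m n
    have h2 := mul_le_mul_of_nonneg_right hε2 h
    rw [hc2]; linarith

/-- The points at which the maximal operator is shown to be bounded. -/
structure Admissible (β γ x y : ℝ) : Prop where
  pos : 0 < y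
  le : y ≤ x
  le_two_mul : x ≤ 2 * y
  -- The boundary line passes through `Q₁(β)` and `Q₂(β)`, and contains `Q₃`.
  knapp : 2 * x - (1 - β) * y ≤ 1
  minkowski : x - (1 - β) * y < 1 / 2
  -- Either the Assouad count alone gives decay in `n`, or the point is not beyond the line through
  -- `Q₃` and `Q₂(2γ-1)` and is not the latter vertex.
  assouad : x - (1 - γ) * y < 1 / 2 ∨ (1 + β ≤ 2 * γ ∧
    -(β / 2) + γ * x - y * (2 * γ - β - γ * β) ≤ 0 ∧ ¬ (x = 2 * y ∧ x - (1 - γ) * y = 1 / 2))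

lemma Admissible.mul_le_one (h : Admissible β γ x y) (hβ1 : β < 1) : (1 + β) * x ≤ 1 := by
  nlinarith [h.knapp, h.le]

lemma Admissible.mul_lt_one (h : Admissible β γ x y) (hβ1 : β < 1) (hyx : y < x) : (1 + β) * x < 1 := by
  nlinarith [h.knapp]

/-- The sign of `x - (1-γ)y - 1/2` decides. If negative, the Assouad count decays in `n`, and also
in `m` unless `x = 2y`, when the ray is `n = 0`. If zero, its decay in `m` is combined with the
Minkowski bound. If positive, both counts give decay off the critical ray; on the diagonal `x = y`,
where `p` cannot be perturbed, the slope along the ray is strictly negative. -/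
theorem Admissible.innerDecay (h : Admissible β γ x y) (hβ0 : 0 ≤ β) (hβ1 : β < 1) :
    InnerDecay β γ (1 / x) (1 / y) := by
  have hy := h.pos
  have hx : 0 < x := hy.trans_le h.le
  unfold InnerDecay
  simp only [one_div_one_div]
  have hcrit : y < x → 1 < 1 / x ∧ 1 / x < 1 / y := by
    intro hyx
    have h1 := h.mul_lt_one hβ1 hyx
    refine ⟨?_, one_div_lt_one_div_of_lt hy hyx⟩
    rw [lt_div_iff₀ hx]
    nlinarith
  rcases lt_trichotomy (x - (1 - γ) * y) (1 / 2) with hA | hA | hA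
  · rcases h.le_two_mul.lt_or_eq with ha | ha
    · left
      refine ⟨min (2 * y - x) (1 / 2 - x + (1 - γ) * y), lt_min (by linarith) (by linarith),
        fun m n => ?_⟩
      have h1 := smallExp_le_assouad (β := β) (γ := γ) (x := x) hy.le m n
      have h2 := mul_le_mul_of_nonneg_right
        (min_le_left (2 * y - x) (1 / 2 - x + (1 - γ) * y)) (Nat.cast_nonneg (α := ℝ) m)
      have h3 := mul_le_mul_of_nonneg_right
        (min_le_right (2 * y - x) (1 / 2 - x + (1 - γ) * y)) (Nat.cast_nonneg (α := ℝ) n)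
      linarith
    · right
      obtain ⟨hp, hpq⟩ := hcrit (by linarith)
      refine ⟨hp, hpq, 1 / 2 - x + (1 - γ) * y, by linarith, 0, le_rfl, fun m n => ?_⟩
      have h1 := smallExp_le_assouad (β := β) (γ := γ) (x := x) hy.le m n
      rw [zero_mul, sub_zero, abs_of_nonneg (Nat.cast_nonneg n)]
      rw [ha] at h1 ⊢
      linarith
  · have hne : x < 2 * y := by
      rcases h.assouad with h' | h'
      · linarith
      · exact lt_of_le_of_ne h.le_two_mul fun e => h'.2.2 ⟨e, hA⟩
    left
    set a := 2 * y - x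
    have ha : 0 < a := by simp only [a]; linarith
    -- A share `lam` of the Minkowski bound supplies decay in `n` at the cost of at most half of the
    -- decay `a` in `m`.
    set lam := min 1 (a / (2 * (β * y + 1)))
    have hby : 0 ≤ β * y := mul_nonneg hβ0 hy.le
    have hlam0 : 0 < lam := lt_min one_pos (by positivity)
    have hlam1 : lam ≤ 1 := min_le_left _ _
    have hlam2 : lam * (β * y) ≤ a / 2 := by
      have : lam * (2 * (β * y + 1)) ≤ a := by
        rw [← le_div_iff₀ (by positivity)]; exact min_le_right _ _
      nlinarith
    have hεM : 0 < 1 / 2 - x + (1 - β) * y := by linarith [h.minkowski]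
    refine ⟨min (a / 2) (lam * (1 / 2 - x + (1 - β) * y)), lt_min (by positivity) (by positivity),
      fun m n => ?_⟩
    have h1 := smallExp_le_assouad (β := β) (γ := γ) (x := x) hy.le m n
    have h2 := smallExp_le_minkowski (β := β) (γ := γ) (x := x) hy.le m n
    have h3 := mul_le_mul_of_nonneg_left h1 (by linarith : 0 ≤ 1 - lam)
    have h4 := mul_le_mul_of_nonneg_left h2 hlam0.le
    have e0 : 1 / 2 - x + (1 - γ) * y = 0 := by linarith
    rw [e0] at h3
    have h5 := mul_le_mul_of_nonneg_right
      (min_le_left (a / 2) (lam * (1 / 2 - x + (1 - β) * y))) (Nat.cast_nonneg (α := ℝ) m)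
    have h6 := mul_le_mul_of_nonneg_right
      (min_le_right (a / 2) (lam * (1 / 2 - x + (1 - β) * y))) (Nat.cast_nonneg (α := ℝ) n)
    have h7 := mul_le_mul_of_nonneg_right hlam2 (Nat.cast_nonneg (α := ℝ) m)
    simp only [a] at h5 h6 h7 ⊢
    linarith
  · obtain ⟨hγβ, hℓ, -⟩ := h.assouad.resolve_left (by linarith)
    have hβγ : β < γ := by linarith
    have hd : 0 < γ - β := by linarith
    obtain ⟨ε, hε, H⟩ := exists_smallExp_le_ray hβγ hy.le h.minkowski hA
    set κ := β / (γ - β)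
    have hκ : 0 ≤ κ := div_nonneg hβ0 hd.le
    rcases h.le.lt_or_eq with hyx | rfl
    · right
      obtain ⟨hp, hpq⟩ := hcrit hyx
      refine ⟨hp, hpq, ε, hε, κ, hκ, fun m n => (H m n).trans ?_⟩
      have := mul_nonneg_of_nonpos_of_nonpos
        (div_nonpos_of_nonpos_of_nonneg hℓ hd.le) (neg_nonpos.2 (Nat.cast_nonneg (α := ℝ) m))
      linarith
    · left
      have hneg : -(β / 2) + γ * y - y * (2 * γ - β - γ * β) < 0 := by
        have h1 := h.mul_le_one hβ1
        nlinarith [mul_pos hy (sub_pos.2 hβ1)]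
      set c := (-(β / 2) + γ * y - y * (2 * γ - β - γ * β)) / (γ - β)
      have hc : c < 0 := div_neg_of_neg_of_pos hneg hd
      have hc' : 0 < -c / (1 + κ) := div_pos (by linarith) (by linarith)
      -- Since `m + n = (1+κ)m + (n - κm)`, decay along the ray and decay away from it together give
      -- decay in `m + n`.
      refine ⟨min ε (-c / (1 + κ)), lt_min hε hc', fun m n => (H m n).trans ?_⟩
      set δ := min ε (-c / (1 + κ))
      have hδ : 0 ≤ δ := (lt_min hε hc').le
      have h1 : δ * (1 + κ) ≤ -c := by
        rw [← le_div_iff₀ (by linarith)]; exact min_le_right _ _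
      have h2 : δ * |(n : ℝ) - κ * m| ≤ ε * |(n : ℝ) - κ * m| :=
        mul_le_mul_of_nonneg_right (min_le_left _ _) (abs_nonneg _)
      have h3 := mul_le_mul_of_nonneg_left (le_abs_self ((n : ℝ) - κ * m)) hδ
      have h4 := mul_le_mul_of_nonneg_right h1 (Nat.cast_nonneg (α := ℝ) m)
      linarith

theorem Admissible.totalBound (h : Admissible β γ x y) {E : Set ℝ} {C₀ : ℝ≥0∞}
    (hβ0 : 0 ≤ β) (hβ1 : β < 1)
    (D : DilationData (grid E) (gridNbhd E) β γ C₀) : TotalBound E (1 / x) (1 / y) := by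
  have hy := h.pos
  have hx : 0 < x := hy.trans_le h.le
  have hp : 1 ≤ 1 / x := by
    rw [le_div_iff₀ hx]
    nlinarith [h.mul_le_one hβ1]
  have hpq : 1 / x ≤ 1 / y := one_div_le_one_div_of_le hy h.le
  have hq : 0 < 1 / y := by positivity
  obtain ⟨C₁, hC₁, H₁⟩ := lnorm_outerMax_le D hβ1 hp hpq
    (by rw [one_div_one_div, one_div_one_div]; linarith [h.knapp])
    (by rw [one_div_one_div, one_div_one_div]; exact h.minkowski)
  obtain ⟨C₂, hC₂, H₂⟩ := lnorm_innerMax_le D hp hpq (h.innerDecay hβ0 hβ1)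
  refine ⟨C₁ + C₂, ENNReal.add_ne_top.2 ⟨hC₁, hC₂⟩, fun g hg => ?_⟩
  rw [add_mul]
  exact (lnorm_add_le (hp.trans hpq) (measurable_outerMax D hg) (measurable_innerMax hg)).trans
    (add_le_add (H₁ g hg) (H₂ g hg))

/-! ### The regions -/

lemma le_of_mem_convexHull {s : Set (ℝ × ℝ)} {z : ℝ × ℝ} (hz : z ∈ convexHull ℝ s) (a b c : ℝ)
    (hs : ∀ v ∈ s, a * v.1 + b * v.2 ≤ c) : a * z.1 + b * z.2 ≤ c := by
  have hl : IsLinearMap ℝ fun v : ℝ × ℝ => a * v.1 + b * v.2 :=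
    ⟨fun u v => by simp only [Prod.fst_add, Prod.snd_add]; ring,
      fun r v => by simp only [Prod.smul_fst, Prod.smul_snd, smul_eq_mul]; ring⟩
  exact convexHull_min hs (convex_halfSpace_le hl c) hz

lemma lt_of_mem_convexHull {s : Set (ℝ × ℝ)} {z : ℝ × ℝ} (hz : z ∈ convexHull ℝ s) (a b c : ℝ)
    (hs : ∀ v ∈ s, a * v.1 + b * v.2 < c) : a * z.1 + b * z.2 < c := by
  have hl : IsLinearMap ℝ fun v : ℝ × ℝ => a * v.1 + b * v.2 :=
    ⟨fun u v => by simp only [Prod.fst_add, Prod.snd_add]; ring,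
      fun r v => by simp only [Prod.smul_fst, Prod.smul_snd, smul_eq_mul]; ring⟩
  exact convexHull_min hs (convex_halfSpace_lt hl c) hz

lemma Q₁_two (β : ℝ) : Q₁ 2 β = (1 / (1 + β), 1 / (1 + β)) := by
  unfold Q₁; norm_num

lemma Q₂_two (β : ℝ) : Q₂ 2 β = (2 / (3 + β), 1 / (3 + β)) := by
  unfold Q₂; norm_num

lemma Q₂_two_mul_sub_one (γ : ℝ) :
    Q₂ 2 (2 * γ - 1) = (2 / (2 * (1 + γ)), 1 / (2 * (1 + γ))) := by
  rw [Q₂_two, show 3 + (2 * γ - 1) = 2 * (1 + γ) by ring]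

lemma mul_div_add_mul_div_le {a b c u v d : ℝ} (hd : 0 < d) (h : a * u + b * v ≤ c * d) :
    a * (u / d) + b * (v / d) ≤ c := by
  rw [← mul_div_assoc, ← mul_div_assoc, ← add_div, div_le_iff₀ hd]
  exact h

lemma mul_div_add_mul_div_lt {a b c u v d : ℝ} (hd : 0 < d) (h : a * u + b * v < c * d) :
    a * (u / d) + b * (v / d) < c := by
  rw [← mul_div_assoc, ← mul_div_assoc, ← add_div, div_lt_iff₀ hd]
  exact h

lemma eq_zero_or_pos_of_le {z : ℝ × ℝ} (h1 : z.2 ≤ z.1) (h2 : z.1 ≤ 2 * z.2) :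
    z = (0, 0) ∨ 0 < z.2 := by
  rcases (show 0 ≤ z.2 by linarith).eq_or_lt with h | h
  · left
    ext
    · simp only; linarith
    · exact h.symm
  · exact Or.inr h

/-- Every condition is linear, so it need only hold at the vertices. At `Q₁` and `Q₂(β)` the Assouad
condition amounts to `2γ < β + 1`. -/
lemma admissible_of_mem_triangle (hβ0 : 0 ≤ β) (hβ1 : β < 1) (hγ : 2 * γ < β + 1) {z : ℝ × ℝ}
    (hz : z ∈ triangle 2 β) : z = (0, 0) ∨ Admissible β γ z.1 z.2 := by
  unfold triangle at hz
  rw [Q₁_two, Q₂_two] at hz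
  have h1 : 0 < 1 + β := by linarith
  have h3 : 0 < 3 + β := by linarith
  have hle : ∀ a b c : ℝ, 0 ≤ c → a * 1 + b * 1 ≤ c * (1 + β) → a * 2 + b * 1 ≤ c * (3 + β) →
      a * z.1 + b * z.2 ≤ c := by
    intro a b c h0 hq1 hq2
    refine le_of_mem_convexHull hz a b c ?_
    rintro v (rfl | rfl | rfl)
    · simpa using h0
    · exact mul_div_add_mul_div_le h1 hq1
    · exact mul_div_add_mul_div_le h3 hq2
  have hlt : ∀ a b c : ℝ, 0 < c → a * 1 + b * 1 < c * (1 + β) → a * 2 + b * 1 < c * (3 + β) →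
      a * z.1 + b * z.2 < c := by
    intro a b c h0 hq1 hq2
    refine lt_of_mem_convexHull hz a b c ?_
    rintro v (rfl | rfl | rfl)
    · simpa using h0
    · exact mul_div_add_mul_div_lt h1 hq1
    · exact mul_div_add_mul_div_lt h3 hq2
  have e1 := hle (-1) 1 0 (by linarith) (by linarith) (by linarith)
  have e2 := hle 1 (-2) 0 (by linarith) (by linarith) (by linarith)
  have e3 := hle 2 (-(1 - β)) 1 (by linarith) (by linarith) (by linarith)
  have e4 := hlt 1 (-(1 - β)) (1 / 2) (by linarith) (by linarith) (by linarith)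
  have e5 := hlt 1 (-(1 - γ)) (1 / 2) (by linarith) (by linarith) (by linarith)
  refine (eq_zero_or_pos_of_le (z := z) (by linarith) (by linarith)).imp_right fun hpos =>
    ⟨hpos, by linarith, by linarith, by linarith, by linarith, Or.inl (by linarith)⟩

lemma admissible_of_mem_quadrilateral (hβ0 : 0 ≤ β) (hβ1 : β < 1) (hγ : β + 1 ≤ 2 * γ)
    {z : ℝ × ℝ} (hz : z ∈ quadrilateral β γ) (hne : z ≠ Q₂ 2 (2 * γ - 1)) :
    z = (0, 0) ∨ Admissible β γ z.1 z.2 := by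
  rw [Q₂_two_mul_sub_one] at hne
  unfold quadrilateral Q₃ at hz
  rw [Q₁_two, Q₂_two_mul_sub_one] at hz
  have hβγ : β < γ := by linarith
  have hd : 0 < 2 * (γ - β) := by linarith
  set T := theta β γ with hT
  -- This identity places `Q₃` on the line through `Q₁(β)` and `Q₂(β)`.
  have hTe : T * (2 * (γ - β)) = 1 - β := div_mul_cancel₀ _ hd.ne'
  have hT0 : 0 < T := div_pos (by linarith) hd
  have hT1 : T ≤ 1 := by rw [hT, theta, div_le_one hd]; linarith
  have hβT : 0 ≤ β * T := mul_nonneg hβ0 hT0.le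
  have hγT : 0 < γ * T := mul_pos (by linarith) hT0
  have hβT1 : β * T ≤ β := mul_le_of_le_one_right hβ0 hT1
  have hlt' : β * T < γ * T := mul_lt_mul_of_pos_right hβγ hT0
  have h1 : 0 < 1 + β := by linarith
  have h3 : 0 < 2 * (1 + γ) := by linarith
  have h4 : 0 < 2 * (1 + γ * T) := by linarith
  have hle : ∀ a b c : ℝ, 0 ≤ c → a * 1 + b * 1 ≤ c * (1 + β) →
      a * (2 - β * (1 - T)) + b * 1 ≤ c * (2 * (1 + γ * T)) →
      a * 2 + b * 1 ≤ c * (2 * (1 + γ)) → a * z.1 + b * z.2 ≤ c := by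
    intro a b c h0 hq1 hq2 hq3
    refine le_of_mem_convexHull hz a b c ?_
    rintro v (rfl | rfl | rfl | rfl)
    · simpa using h0
    · exact mul_div_add_mul_div_le h1 hq1
    · exact mul_div_add_mul_div_le h4 hq2
    · exact mul_div_add_mul_div_le h3 hq3
  have hlt : ∀ a b c : ℝ, 0 < c → a * 1 + b * 1 < c * (1 + β) →
      a * (2 - β * (1 - T)) + b * 1 < c * (2 * (1 + γ * T)) →
      a * 2 + b * 1 < c * (2 * (1 + γ)) → a * z.1 + b * z.2 < c := by
    intro a b c h0 hq1 hq2 hq3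
    refine lt_of_mem_convexHull hz a b c ?_
    rintro v (rfl | rfl | rfl | rfl)
    · simpa using h0
    · exact mul_div_add_mul_div_lt h1 hq1
    · exact mul_div_add_mul_div_lt h4 hq2
    · exact mul_div_add_mul_div_lt h3 hq3
  have e1 := hle (-1) 1 0 (by linarith) (by linarith) (by linarith) (by linarith)
  have e2 := hle 1 (-2) 0 (by linarith) (by linarith) (by linarith) (by linarith)
  have e3 := hle 2 (-(1 - β)) 1 (by linarith) (by linarith) (by linarith) (by linarith)
  have e4 := hlt 1 (-(1 - β)) (1 / 2) (by linarith) (by linarith) (by linarith) (by linarith)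
  -- The line through `Q₃` and `Q₂(2γ-1)`.
  have e5 := hle γ (-(2 * γ - β - γ * β)) (β / 2) (by linarith)
    (by nlinarith [mul_pos (sub_pos.2 hβ1) (by linarith : 0 < 2 * γ - β)]) (by linarith)
    (by linarith)
  refine (eq_zero_or_pos_of_le (z := z) (by linarith) (by linarith)).imp_right fun hpos =>
    ⟨hpos, by linarith, by linarith, by linarith, by linarith,
      Or.inr ⟨by linarith, by linarith, fun ⟨ha, hb⟩ => hne ?_⟩⟩
  have : z.2 = 1 / (2 * (1 + γ)) := by
    rw [eq_div_iff h3.ne']; linarith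
  ext
  · simp only
    rw [ha, this]; ring
  · exact this

end RadialMaximal

/-! ### Membership in the radial type set and the theorem -/

namespace RadialMaximal

variable {E : Set ℝ} {β γ : ℝ} {C₀ : ℝ≥0∞}

lemma zero_mem_radialTypeSet (hE : E ⊆ Icc 1 2) (D : DilationData (grid E) (gridNbhd E) β γ C₀)
    (hβ0 : 0 ≤ β) (hB : TotalBound E (1 + β) (1 + β)) : ((0 : ℝ), (0 : ℝ)) ∈ radialTypeSet 2 E := by
  refine ⟨⟨le_rfl, zero_le_one⟩, ⟨le_rfl, zero_le_one⟩, ?_⟩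
  simpa using radialStrongType_top hE D (by linarith) hB

lemma Admissible.mem_radialTypeSet {z : ℝ × ℝ} (h : Admissible β γ z.1 z.2) (hE : E ⊆ Icc 1 2)
    (D : DilationData (grid E) (gridNbhd E) β γ C₀) (hβ0 : 0 ≤ β) (hβ1 : β < 1)
    (hB : TotalBound E (1 + β) (1 + β)) : z ∈ radialTypeSet 2 E := by
  have hy := h.pos
  have hx : 0 < z.1 := hy.trans_le h.le
  have h1 := h.mul_le_one hβ1
  have hx1 : z.1 ≤ 1 := by nlinarith
  refine ⟨⟨hx.le, hx1⟩, ⟨hy.le, h.le.trans hx1⟩, ?_⟩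
  rw [← ENNReal.ofReal_inv_of_pos hx, ← ENNReal.ofReal_inv_of_pos hy, ← one_div, ← one_div]
  refine radialStrongType_of_totalBound hE D (p₁ := 1 + β) (by linarith) ?_ (by positivity) hB
    (h.totalBound hβ0 hβ1 D)
  rwa [le_div_iff₀ hx]

lemma totalBound_of_admissible_Q₁ (hβ0 : 0 ≤ β) (hβ1 : β < 1)
    (D : DilationData (grid E) (gridNbhd E) β γ C₀)
    (h : Q₁ 2 β = (0, 0) ∨ Admissible β γ (Q₁ 2 β).1 (Q₁ 2 β).2) :
    TotalBound E (1 + β) (1 + β) := by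
  rw [Q₁_two] at h
  have hpos : 0 < 1 / (1 + β) := by positivity
  rcases h with h | h
  · exact absurd (congrArg Prod.fst h) hpos.ne'
  · simpa using h.totalBound hβ0 hβ1 D

end RadialMaximal

open RadialMaximal in
theorem theorem1p5 (E : Set ℝ) (hE : E ⊆ Set.Icc 1 2) (β γ : ℝ)
    (hβ0 : 0 ≤ β) (hβ1 : β < 1) (hβγ : β ≤ γ) (hγ1 : γ ≤ 1)
    (hM : (⨆ δ ∈ Set.Ioo (0 : ℝ) 1, RadialMaximal.minkowskiChar E β δ) < ∞)
    (hA : (⨆ δ ∈ Set.Ioo (0 : ℝ) 1, RadialMaximal.assouadChar E γ δ) < ∞) :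
    (2 * γ < β + 1 →
      RadialMaximal.triangle 2 β ⊆ RadialMaximal.radialTypeSet 2 E) ∧
    (β + 1 ≤ 2 * γ →
      RadialMaximal.quadrilateral β γ \ {RadialMaximal.Q₂ 2 (2 * γ - 1)} ⊆
        RadialMaximal.radialTypeSet 2 E ∧
      ∀ p q : ℝ, (1 / p, 1 / q) = RadialMaximal.Q₂ 2 (2 * γ - 1) →
        RadialMaximal.RadialRestrictedWeakType 2 E p q) := by
  obtain ⟨C₀, D⟩ := exists_dilationData hE hβ1.le hγ1 hM hA
  have hmem : TotalBound E (1 + β) (1 + β) → ∀ z : ℝ × ℝ,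
      z = (0, 0) ∨ Admissible β γ z.1 z.2 → z ∈ radialTypeSet 2 E := by
    rintro hB z (rfl | h)
    · exact zero_mem_radialTypeSet hE D hβ0 hB
    · exact h.mem_radialTypeSet hE D hβ0 hβ1 hB
  refine ⟨fun hγ z hz => ?_, fun hγ => ?_⟩
  · have hB : TotalBound E (1 + β) (1 + β) := totalBound_of_admissible_Q₁ hβ0 hβ1 D
      (admissible_of_mem_triangle hβ0 hβ1 hγ (subset_convexHull ℝ _ (by simp)))
    exact hmem hB z (admissible_of_mem_triangle hβ0 hβ1 hγ hz)
  · have hγ0 : 0 < γ := by linarith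
    -- `Q₁` lies on the diagonal and `Q₂(2γ-1)` does not, so `Q₁` is not the excluded vertex.
    have hB : TotalBound E (1 + β) (1 + β) := by
      refine totalBound_of_admissible_Q₁ hβ0 hβ1 D (admissible_of_mem_quadrilateral hβ0 hβ1 hγ
        (subset_convexHull ℝ _ (by simp)) fun h => ?_)
      rw [Q₁_two, Q₂_two_mul_sub_one, Prod.mk.injEq] at h
      have h1 : 1 / (2 * (1 + γ)) < 2 / (2 * (1 + γ)) :=
        div_lt_div_of_pos_right (by norm_num) (by positivity)
      linarith [h.1, h.2]
    refine ⟨fun z hz => hmem hB z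
      (admissible_of_mem_quadrilateral hβ0 hβ1 hγ hz.1 fun h => hz.2 h), fun p q hpq => ?_⟩
    rw [Q₂_two_mul_sub_one, Prod.mk.injEq] at hpq
    obtain ⟨hp, hq⟩ := hpq
    have hp' : p = 1 + γ := by
      rw [← one_div_one_div p, hp, one_div_div]; ring
    have hq' : q = 2 * (1 + γ) := by
      rw [← one_div_one_div q, hq, one_div_one_div]
    have hxy : 1 / q * (1 + γ) = 1 / 2 := by rw [hq]; field_simp
    have hx2 : 1 / p = 2 * (1 / q) := by rw [hp, hq]; ring
    have hq0 : 0 < 1 / q := by rw [hq]; positivity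
    refine radialRestrictedWeakType_of_bounds hE D (p₁ := 1 + β) (by linarith) (by linarith)
      (by linarith) hB hβ1 hγ0.le ?_ ?_ ?_ hx2 (by rw [hx2]; linarith) <;> rw [hx2] <;> nlinarith
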